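/- Let $\mathcal G \rightrightarrows X$ be a complex Lie groupoid (source $s$, target $t$) acting holomorphically and linearly on a holomorphic line bundle $L \to X$; equivalently, the pull-back $L_{\mathcal G} = t^*L$ carries the LB-groupoid structure $(L_{\mathcal G} \rightrightarrows 0_X; \mathcal G \rightrightarrows X)$ with product $(g,\ell)(h,\ell') = (gh, \ell + g.\ell')$. Let $H \subset T^{1,0}\mathcal G$ be a holomorphic contact structure whose normal bundle is identified with $L_{\mathcal G}$ by means of a surjective holomorphic structure form $\theta : T^{1,0}\mathcal G \to t^*L$ with $\ker\theta = H$; if $H$ is multiplicative, it is understood that $L_{\mathcal G}$ is the LB-groupoid $T^{1,0}\mathcal G/H$, i.e. that $\theta$ is a map of groupoids: $\theta(V\cdot W) = \theta(V) + g.\theta(W)$ for all composable $V \in T^{1,0}_g\mathcal G$, $W \in T^{1,0}_h\mathcal G$. Let $\widehat{\mathcal G} \rightrightarrows \widehat M$ be the groupoid formed by the real projective bundles of the complex duals $L_{\mathcal G}^* \to \mathcal G$ and $L^* \to X$. Its arrows are pairs $(g,[\epsilon])$ with $g\in\mathcal G$, $0 \ne \epsilon \in L^*_{t(g)}$, and $[\epsilon]$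 the real line spanned by $\epsilon$; the target of $(g,[\epsilon])$ is $[\epsilon]$, its source is $[\epsilon\circ g]$, and $(g,[\epsilon])(h,[\epsilon\circ g]) = (gh,[\epsilon])$. On $\widetilde{\mathcal G} = L_{\mathcal G}^*\smallsetminus 0$, with projection $p : \widetilde{\mathcal G}\to\mathcal G$ and holomorphic Euler vector field $\mathcal Z$, let $\Theta_\epsilon = \langle \epsilon, \theta\circ p_*\rangle$ and $\Omega = d\Theta$. Let $\widehat H \subset T\widehat{\mathcal G}$ be the real contact structure induced by $H$, i.e. the one whose symplectization is $\operatorname{Re}\Omega$: it is the image of $\ker \iota_{2\operatorname{Re}\mathcal Z}\operatorname{Re}\Omega$ under the differential of the projection $\widetilde{\mathcal G} \to \widehat{\mathcal G}$. Call $H$ multiplicative if it is a VB-subgroupoid of the tangent groupoid $T^{1,0}\mathcal G \rightrightarrows T^{1,0}X$ covering the whole of $T^{1,0}X$, and $\widehat H$ multiplicative if it is a VB-subgroupoid of $T\widehat{\mathcal G} \rightrightarrows T\widehat M$ covering the whole of $T\widehat M$. Then $\widehat H$ is multiplicative if and only if $H$ is multiplicative. -/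

import Mathlib

open scoped Manifold ContDiff Bundle LinearAlgebra.Projectivization
open Bundle
set_option linter.unusedSectionVars false

namespace HolContact

noncomputable section

theorem contMDiffOn_restrictScalars {E F : Type*} [NormedAddCommGroup E] [NormedSpace ℂ E]
    [NormedAddCommGroup F] [NormedSpace ℂ F]
    {B : Type*} [TopologicalSpace B] [ChartedSpace E B] {f : B → F} {s : Set B}
    (hf : ContMDiffOn 𝓘(ℂ, E) 𝓘(ℂ, F) ω f s) : ContMDiffOn 𝓘(ℝ, E) 𝓘(ℝ, F) ∞ f s := by
  intro x hx
  have h := hf x hx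
  rw [contMDiffWithinAt_iff] at h ⊢
  exact ⟨h.1, (h.2.restrict_scalars ℝ).of_le le_top⟩

theorem isManifold_real (E : Type*) [NormedAddCommGroup E] [NormedSpace ℂ E]
    (B : Type*) [TopologicalSpace B] [ChartedSpace E B] [IsManifold 𝓘(ℂ, E) ω B] :
    IsManifold 𝓘(ℝ, E) ∞ B := by
  apply isManifold_of_contDiffOn
  intro e e' he he'
  have h := contDiffGroupoid ω 𝓘(ℂ, E) |>.compatible he he'
  have h := (contDiffGroupoid ω 𝓘(ℂ, E)).compatible (M := B) he he'
  rw [contDiffGroupoid, mem_groupoid_of_pregroupoid] at h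
  exact (ContDiffOn.restrict_scalars ℝ h.1).of_le le_top

/-- If `P` is charted over the `C^n` manifold `N` with `C^n` coordinate changes, then `P` with the
composed charts is a `C^n` manifold. -/
theorem isManifold_comp {𝕜 : Type*} [NontriviallyNormedField 𝕜] {E : Type*} [NormedAddCommGroup E]
    [NormedSpace 𝕜 E] {H : Type*} [TopologicalSpace H] (I : ModelWithCorners 𝕜 E H) (n : WithTop ℕ∞)
    (N P : Type*) [TopologicalSpace N] [ChartedSpace H N] [IsManifold I n N]
    (c : ChartedSpaceCore N P)
    (hc : ∀ e ∈ c.atlas, ∀ e' ∈ c.atlas,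
      ContMDiffOn I I n (e.symm.trans e') (e.symm.trans e').source) :
    @IsManifold 𝕜 _ E _ _ H _ I n P c.toTopologicalSpace
      (@ChartedSpace.comp H _ N _ P c.toTopologicalSpace _ c.toChartedSpace) := by
  let _ := c.toTopologicalSpace
  let _ := c.toChartedSpace
  let PG : Pregroupoid N :=
    { property := fun f s => ContMDiffOn I I n f s
      comp := fun hf hg _ _ _ => hg.comp' hf
      id_mem := contMDiffOn_id
      locality := fun {f u} _ h x hx => by
        obtain ⟨v, hv, hxv, hfv⟩ := h x hx
        exact ((hfv x ⟨hx, hxv⟩).mono_of_mem_nhdsWithin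
          (inter_mem_nhdsWithin _ (hv.mem_nhds hxv)))
      congr := fun _ h hf => hf.congr h }
  have : HasGroupoid P PG.groupoid := by
    constructor
    rintro _ _ ⟨_, ⟨e, rfl⟩, _, ⟨he, rfl⟩, rfl⟩ ⟨_, ⟨e', rfl⟩, _, ⟨he', rfl⟩, rfl⟩
    rw [mem_groupoid_of_pregroupoid]
    exact ⟨hc _ he _ he', hc _ he' _ he⟩
  let _ := ChartedSpace.comp H N P
  refine { StructureGroupoid.HasGroupoid.comp PG.groupoid ?_ with }
  intro e he
  rw [mem_groupoid_of_pregroupoid] at he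
  rw [isLocalStructomorphOn_contDiffGroupoid_iff]
  exact he

section LineBundle

variable {EX : Type*} [NormedAddCommGroup EX] [NormedSpace ℂ EX]
  {X : Type*} [TopologicalSpace X] [ChartedSpace EX X]
  (L : X → Type*) [∀ x, AddCommGroup (L x)] [∀ x, Module ℂ (L x)] [∀ x, TopologicalSpace (L x)]
  [TopologicalSpace (TotalSpace ℂ L)] [FiberBundle ℂ L] [VectorBundle ℂ ℂ L]

/-- The coordinate of a covector `ε ∈ L_x^*` in the trivialization of `L` around `x₀`. -/
def lineCoord (x₀ x : X) (ε : L x →L[ℂ] ℂ) : ℂ :=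
  ε ((trivializationAt ℂ L x₀).symmL ℂ x 1)

/-- The covector `ε ∈ L_x^*` with coordinate `z` in the trivialization of `L` around `x₀`. -/
def ofLineCoord (x₀ x : X) (z : ℂ) : L x →L[ℂ] ℂ :=
  z • (trivializationAt ℂ L x₀).continuousLinearMapAt ℂ x

variable {L}

theorem lineCoord_smul (x₀ x : X) (c : ℂ) (ε : L x →L[ℂ] ℂ) :
    lineCoord L x₀ x (c • ε) = c * lineCoord L x₀ x ε := rfl

theorem lineCoord_ofLineCoord {x₀ x : X} (hx : x ∈ (trivializationAt ℂ L x₀).baseSet) (z : ℂ) :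
    lineCoord L x₀ x (ofLineCoord L x₀ x z) = z := by
  have h := (trivializationAt ℂ L x₀).continuousLinearMapAt_symmL (R := ℂ) hx 1
  simp only [lineCoord, ofLineCoord, smul_apply, h, smul_eq_mul, mul_one]

theorem ofLineCoord_lineCoord {x₀ x : X} (hx : x ∈ (trivializationAt ℂ L x₀).baseSet)
    (ε : L x →L[ℂ] ℂ) : ofLineCoord L x₀ x (lineCoord L x₀ x ε) = ε := by
  ext v
  have h := (trivializationAt ℂ L x₀).symmL_continuousLinearMapAt (R := ℂ) hx v
  simp only [lineCoord, ofLineCoord, smul_apply, smul_eq_mul]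
  conv_rhs => rw [← h]
  rw [mul_comm, ← smul_eq_mul, ← map_smul, ← map_smul]
  simp

theorem lineCoord_ne_zero {x₀ x : X} (hx : x ∈ (trivializationAt ℂ L x₀).baseSet)
    {ε : L x →L[ℂ] ℂ} (hε : ε ≠ 0) : lineCoord L x₀ x ε ≠ 0 := by
  intro h
  apply hε
  rw [← ofLineCoord_lineCoord hx ε, h]
  simp [ofLineCoord]

theorem ofLineCoord_ne_zero {x₀ x : X} (hx : x ∈ (trivializationAt ℂ L x₀).baseSet)
    {z : ℂ} (hz : z ≠ 0) : ofLineCoord L x₀ x z ≠ 0 := by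
  intro h
  apply hz
  rw [← lineCoord_ofLineCoord hx z, h]
  simp [lineCoord]

variable (L) in
/-- The transition function of `L^*` between the trivializations around `x₀` and `x₁`. -/
def lineTransition (x₀ x₁ x : X) : ℂ := lineCoord L x₁ x (ofLineCoord L x₀ x 1)

theorem lineCoord_ofLineCoord' (x₀ x₁ x : X) (z : ℂ) :
    lineCoord L x₁ x (ofLineCoord L x₀ x z) = z * lineTransition L x₀ x₁ x := by
  rw [lineTransition, ← lineCoord_smul]
  congr 1
  simp [ofLineCoord]

theorem contMDiffOn_lineTransition [ContMDiffVectorBundle ω ℂ L 𝓘(ℂ, EX)] (x₀ x₁ : X) :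
    ContMDiffOn 𝓘(ℂ, EX) 𝓘(ℂ, ℂ) ω (lineTransition L x₀ x₁)
      ((trivializationAt ℂ L x₀).baseSet ∩ (trivializationAt ℂ L x₁).baseSet) := by
  have h := contMDiffOn_coordChangeL (IB := 𝓘(ℂ, EX)) (n := ω)
    (trivializationAt ℂ L x₁) (trivializationAt ℂ L x₀)
  rw [Set.inter_comm] at h
  refine (h.clm_apply (contMDiffOn_const (c := (1 : ℂ)))).congr ?_
  intro x hx
  rw [ContinuousLinearEquiv.coe_coe, Trivialization.coordChangeL_apply _ _ hx.symm]
  simp [lineTransition, lineCoord, ofLineCoord, Trivialization.continuousLinearMapAt_apply,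
    Trivialization.linearMapAt_apply, hx.1,
    Trivialization.symmL_apply _ hx.2]

end LineBundle

section Total

variable {EX : Type*} [NormedAddCommGroup EX] [NormedSpace ℂ EX]
  {X : Type*} [TopologicalSpace X] [ChartedSpace EX X]
  (L : X → Type*) [∀ x, AddCommGroup (L x)] [∀ x, Module ℂ (L x)] [∀ x, TopologicalSpace (L x)]
  [TopologicalSpace (TotalSpace ℂ L)] [FiberBundle ℂ L] [VectorBundle ℂ ℂ L]
  {E : Type*} [NormedAddCommGroup E] [NormedSpace ℂ E]
  {B : Type*} [TopologicalSpace B] [ChartedSpace E B]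
  (f : ContMDiffMap 𝓘(ℂ, E) 𝓘(ℂ, EX) B X ω)

/-- The complex homogenization `(f^*L)^* ∖ 0` of the pull-back of the holomorphic line bundle
`L → X` along a holomorphic map `f : B → X`. -/
@[ext]
structure Slit where
  base : B
  covec : L (f base) →L[ℂ] ℂ
  ne_zero : covec ≠ 0

/-- The real projective bundle of the complex dual of `f^*L`: its points are the real lines in
the fibres of `(f^*L)^*`. -/
@[ext]
structure RProj where
  base : B
  line : ℙ ℝ (L (f base) →L[ℂ] ℂ)

variable {L f}

open Classical in
/-- The trivialization of `(f^*L)^* ∖ 0` around `x₀`. -/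
def slitTriv (x₀ : X) : PartialEquiv (Slit L f) (B × ℂ) where
  toFun p := (p.base, lineCoord L x₀ (f p.base) p.covec)
  invFun q :=
    if h : ofLineCoord L x₀ (f q.1) q.2 ≠ 0 then ⟨q.1, _, h⟩
    else ⟨q.1, ofLineCoord L (f q.1) (f q.1) 1,
      ofLineCoord_ne_zero (FiberBundle.mem_baseSet_trivializationAt' _) one_ne_zero⟩
  source := {p | f p.base ∈ (trivializationAt ℂ L x₀).baseSet}
  target := {q | f q.1 ∈ (trivializationAt ℂ L x₀).baseSet ∧ q.2 ≠ 0}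
  map_source' p hp := ⟨hp, lineCoord_ne_zero hp p.ne_zero⟩
  map_target' q hq := by
    rw [dif_pos (ofLineCoord_ne_zero hq.1 hq.2)]
    exact hq.1
  left_inv' p hp := by
    have h := ofLineCoord_lineCoord hp p.covec
    have h' : ofLineCoord L x₀ (f p.base) (lineCoord L x₀ (f p.base) p.covec) ≠ 0 := by
      rw [h]; exact p.ne_zero
    simp only [dif_pos h']
    cases p
    simp only [Slit.mk.injEq, heq_eq_eq, true_and]
    exact h
  right_inv' q hq := by
    rw [dif_pos (ofLineCoord_ne_zero hq.1 hq.2)]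
    exact Prod.ext rfl (lineCoord_ofLineCoord hq.1 q.2)

theorem slitTriv_symm (x₀ : X) {q : B × ℂ} (hq : q ∈ (slitTriv (L := L) (f := f) x₀).target) :
    (slitTriv (L := L) (f := f) x₀).symm q =
      ⟨q.1, _, ofLineCoord_ne_zero hq.1 hq.2⟩ :=
  dif_pos (ofLineCoord_ne_zero hq.1 hq.2)

theorem slitTriv_trans_source (x₀ x₁ : X) :
    ((slitTriv (L := L) (f := f) x₀).symm.trans (slitTriv x₁)).source =
      {q | f q.1 ∈ (trivializationAt ℂ L x₀).baseSet ∩ (trivializationAt ℂ L x₁).baseSet ∧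
        q.2 ≠ 0} := by
  ext q
  rw [PartialEquiv.trans_source, PartialEquiv.symm_source]
  constructor
  · rintro ⟨h, h'⟩
    rw [Set.mem_preimage, slitTriv_symm x₀ h] at h'
    exact ⟨⟨h.1, h'⟩, h.2⟩
  · rintro ⟨h, h'⟩
    refine ⟨⟨h.1, h'⟩, ?_⟩
    rw [Set.mem_preimage, slitTriv_symm x₀ ⟨h.1, h'⟩]
    exact h.2

theorem contMDiffOn_slitTriv_trans [ContMDiffVectorBundle ω ℂ L 𝓘(ℂ, EX)] (x₀ x₁ : X) :
    ContMDiffOn (𝓘(ℂ, E).prod 𝓘(ℂ, ℂ)) (𝓘(ℂ, E).prod 𝓘(ℂ, ℂ)) ω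
      ((slitTriv (L := L) (f := f) x₀).symm.trans (slitTriv x₁))
      ((slitTriv (L := L) (f := f) x₀).symm.trans (slitTriv x₁)).source := by
  rw [slitTriv_trans_source]
  have h1 : ContMDiffOn (𝓘(ℂ, E).prod 𝓘(ℂ, ℂ)) 𝓘(ℂ, ℂ) ω
      (fun q : B × ℂ => q.2 * lineTransition L x₀ x₁ (f q.1))
      {q | f q.1 ∈ (trivializationAt ℂ L x₀).baseSet ∩ (trivializationAt ℂ L x₁).baseSet ∧
        q.2 ≠ 0} := by
    have h2 := (contMDiffOn_lineTransition (L := L) (EX := EX) x₀ x₁).comp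
      (f.contMDiff.comp (contMDiff_fst (I := 𝓘(ℂ, E)) (J := 𝓘(ℂ, ℂ)))).contMDiffOn
      (fun q (hq : q ∈ {q : B × ℂ | f q.1 ∈ (trivializationAt ℂ L x₀).baseSet ∩
        (trivializationAt ℂ L x₁).baseSet ∧ q.2 ≠ 0}) => hq.1)
    exact (contMDiff_snd (I := 𝓘(ℂ, E)) (J := 𝓘(ℂ, ℂ))).contMDiffOn.smul h2
  refine ((contMDiff_fst (I := 𝓘(ℂ, E)) (J := 𝓘(ℂ, ℂ))).contMDiffOn.prodMk h1).congr ?_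
  intro q hq
  have hq' : q ∈ (slitTriv (L := L) (f := f) x₀).target := ⟨hq.1.1, hq.2⟩
  rw [PartialEquiv.coe_trans, Function.comp_apply, slitTriv_symm x₀ hq']
  exact Prod.ext rfl (lineCoord_ofLineCoord' x₀ x₁ (f q.1) q.2)

/-- The affine coordinate of the real line spanned by `w` relative to the real line spanned by
`c`, i.e. the real number `τ` with `w ∈ ℝ (1 + i τ) c`. -/
def slope (c w : ℂ) : ℝ := (w / c).im / (w / c).re

theorem slope_real_smul (c w : ℂ) {r : ℝ} (hr : r ≠ 0) : slope c (r * w) = slope c w := by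
  rw [slope, slope, mul_div_assoc, Complex.re_ofReal_mul, Complex.im_ofReal_mul,
    mul_div_mul_left _ _ hr]

theorem slope_line {c : ℂ} (hc : c ≠ 0) (τ : ℝ) : slope c ((1 + τ * Complex.I) * c) = τ := by
  rw [slope, mul_div_cancel_right₀ _ hc]
  simp

theorem lineCoord_real_smul (x₀ x : X) (r : ℝ) (ε : L x →L[ℂ] ℂ) :
    lineCoord L x₀ x (r • ε) = r * lineCoord L x₀ x ε := by
  simp [lineCoord]

theorem lineCoord_rep_mk (x₀ x : X) {ε : L x →L[ℂ] ℂ} (hε : ε ≠ 0) :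
    ∃ r : ℝ, r ≠ 0 ∧
      lineCoord L x₀ x (Projectivization.mk ℝ ε hε).rep = r * lineCoord L x₀ x ε := by
  obtain ⟨a, ha⟩ := Projectivization.exists_smul_eq_mk_rep ℝ ε hε
  refine ⟨a, a.ne_zero, ?_⟩
  rw [← ha, Units.smul_def, lineCoord_real_smul]

theorem one_add_mul_I_ne_zero (τ : ℝ) : (1 + τ * Complex.I : ℂ) ≠ 0 := by
  intro h
  have := congrArg Complex.re h
  simp at this

theorem mk_ofLineCoord {x₀ x : X} (hx : x ∈ (trivializationAt ℂ L x₀).baseSet) {c : ℂ}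
    (ℓ : ℙ ℝ (L x →L[ℂ] ℂ)) (h : (lineCoord L x₀ x ℓ.rep / c).re ≠ 0)
    (h' : ofLineCoord L x₀ x ((1 + slope c (lineCoord L x₀ x ℓ.rep) * Complex.I) * c) ≠ 0) :
    Projectivization.mk ℝ _ h' = ℓ := by
  have hc : c ≠ 0 := by rintro rfl; simp at h
  set w := lineCoord L x₀ x ℓ.rep with hw
  conv_rhs => rw [← ℓ.mk_rep]
  rw [Projectivization.mk_eq_mk_iff']
  refine ⟨(w / c).re⁻¹, ?_⟩
  rw [← ofLineCoord_lineCoord hx ((w / c).re⁻¹ • ℓ.rep), lineCoord_real_smul, ← hw]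
  congr 1
  have hwc : w = (w / c) * c := (div_mul_cancel₀ w hc).symm
  have h2 : ((w / c).re⁻¹ : ℂ) * (w / c) = 1 + slope c w * Complex.I := by
    apply Complex.ext
    · rw [← Complex.ofReal_inv, Complex.re_ofReal_mul]; simp [h]
    · rw [← Complex.ofReal_inv, Complex.im_ofReal_mul]; simp [slope]; ring
  rw [← h2, mul_assoc, div_mul_cancel₀ w hc, Complex.ofReal_inv]

open Classical in
/-- The trivialization, over the domain of the trivialization of `L` around `x₀`, of the open set
of the real lines in `(f^*L)^*` that are not orthogonal to the real line with coordinate `c`. -/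
def rprojTriv (x₀ : X) (c : ℂ) : PartialEquiv (RProj L f) (B × ℝ) where
  toFun p := (p.base, slope c (lineCoord L x₀ (f p.base) p.line.rep))
  invFun q :=
    if h : ofLineCoord L x₀ (f q.1) ((1 + q.2 * Complex.I) * c) ≠ 0 then
      ⟨q.1, Projectivization.mk ℝ _ h⟩
    else ⟨q.1, Projectivization.mk ℝ (ofLineCoord L (f q.1) (f q.1) 1)
      (ofLineCoord_ne_zero (FiberBundle.mem_baseSet_trivializationAt' _) one_ne_zero)⟩
  source := {p | f p.base ∈ (trivializationAt ℂ L x₀).baseSet ∧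
    (lineCoord L x₀ (f p.base) p.line.rep / c).re ≠ 0}
  target := {q | f q.1 ∈ (trivializationAt ℂ L x₀).baseSet ∧ c ≠ 0}
  map_source' p hp := ⟨hp.1, by rintro rfl; simpa using hp.2⟩
  map_target' q hq := by
    have h := ofLineCoord_ne_zero hq.1 (mul_ne_zero (one_add_mul_I_ne_zero q.2) hq.2)
    rw [dif_pos h]
    refine ⟨hq.1, ?_⟩
    obtain ⟨r, hr, h'⟩ := lineCoord_rep_mk x₀ (f q.1) h
    change (lineCoord L x₀ (f q.1) (Projectivization.mk ℝ _ h).rep / c).re ≠ 0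
    rw [h', lineCoord_ofLineCoord hq.1, ← mul_assoc, mul_div_cancel_right₀ _ hq.2,
      Complex.re_ofReal_mul]
    simpa using hr
  left_inv' p hp := by
    have hc : c ≠ 0 := by rintro rfl; simpa using hp.2
    have h := ofLineCoord_ne_zero hp.1 (mul_ne_zero (one_add_mul_I_ne_zero
      (slope c (lineCoord L x₀ (f p.base) p.line.rep))) hc)
    simp only [dif_pos h]
    cases p
    simp only [RProj.mk.injEq, heq_eq_eq, true_and]
    exact mk_ofLineCoord hp.1 _ hp.2 h
  right_inv' q hq := by
    have h := ofLineCoord_ne_zero hq.1 (mul_ne_zero (one_add_mul_I_ne_zero q.2) hq.2)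
    rw [dif_pos h]
    refine Prod.ext rfl ?_
    obtain ⟨r, hr, h'⟩ := lineCoord_rep_mk x₀ (f q.1) h
    change slope c (lineCoord L x₀ (f q.1) (Projectivization.mk ℝ _ h).rep) = q.2
    rw [h', slope_real_smul _ _ hr, lineCoord_ofLineCoord hq.1, slope_line hq.2]

theorem rprojTriv_symm (x₀ : X) {c : ℂ} {q : B × ℝ}
    (hq : q ∈ (rprojTriv (L := L) (f := f) x₀ c).target) :
    (rprojTriv (L := L) (f := f) x₀ c).symm q =
      ⟨q.1, Projectivization.mk ℝ _
        (ofLineCoord_ne_zero hq.1 (mul_ne_zero (one_add_mul_I_ne_zero q.2) hq.2))⟩ :=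
  dif_pos (ofLineCoord_ne_zero hq.1 (mul_ne_zero (one_add_mul_I_ne_zero q.2) hq.2))

theorem rprojTriv_trans_source (x₀ x₁ : X) (c d : ℂ) :
    ((rprojTriv (L := L) (f := f) x₀ c).symm.trans (rprojTriv x₁ d)).source =
      {q | f q.1 ∈ (trivializationAt ℂ L x₀).baseSet ∩ (trivializationAt ℂ L x₁).baseSet ∧
        ((1 + q.2 * Complex.I) * c * lineTransition L x₀ x₁ (f q.1) / d).re ≠ 0} := by
  have key : ∀ q (hq : q ∈ (rprojTriv (L := L) (f := f) x₀ c).target),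
      ((lineCoord L x₁ (f q.1) (Projectivization.mk ℝ _
        (ofLineCoord_ne_zero hq.1 (mul_ne_zero (one_add_mul_I_ne_zero q.2) hq.2))).rep / d).re ≠ 0
      ↔ ((1 + q.2 * Complex.I) * c * lineTransition L x₀ x₁ (f q.1) / d).re ≠ 0) := by
    intro q hq
    obtain ⟨r, hr, h'⟩ := lineCoord_rep_mk x₁ (f q.1)
      (ofLineCoord_ne_zero hq.1 (mul_ne_zero (one_add_mul_I_ne_zero q.2) hq.2))
    rw [h', lineCoord_ofLineCoord', mul_div_assoc, Complex.re_ofReal_mul, mul_ne_zero_iff]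
    exact and_iff_right hr
  ext q
  rw [PartialEquiv.trans_source, PartialEquiv.symm_source]
  constructor
  · rintro ⟨h, h'⟩
    rw [Set.mem_preimage, rprojTriv_symm x₀ h] at h'
    exact ⟨⟨h.1, h'.1⟩, (key q h).1 h'.2⟩
  · rintro ⟨h, h'⟩
    have hc : c ≠ 0 := by rintro rfl; simp at h'
    refine ⟨⟨h.1, hc⟩, ?_⟩
    rw [Set.mem_preimage, rprojTriv_symm x₀ ⟨h.1, hc⟩]
    exact ⟨h.2, (key q ⟨h.1, hc⟩).2 h'⟩

theorem rprojTriv_trans_apply (x₀ x₁ : X) (c d : ℂ) {q : B × ℝ}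
    (hq : q ∈ (rprojTriv (L := L) (f := f) x₀ c).target) :
    (rprojTriv (L := L) (f := f) x₀ c).symm.trans (rprojTriv x₁ d) q =
      (q.1, slope d ((1 + q.2 * Complex.I) * c * lineTransition L x₀ x₁ (f q.1))) := by
  rw [PartialEquiv.coe_trans, Function.comp_apply, rprojTriv_symm x₀ hq]
  refine Prod.ext rfl ?_
  obtain ⟨r, hr, h'⟩ := lineCoord_rep_mk x₁ (f q.1)
    (ofLineCoord_ne_zero hq.1 (mul_ne_zero (one_add_mul_I_ne_zero q.2) hq.2))
  refine (congrArg (slope d) h').trans ?_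
  rw [slope_real_smul _ _ hr, lineCoord_ofLineCoord']

theorem contMDiffOn_line_arg [ContMDiffVectorBundle ω ℂ L 𝓘(ℂ, EX)] (x₀ x₁ : X) (c d : ℂ) :
    ContMDiffOn (𝓘(ℝ, E).prod 𝓘(ℝ, ℝ)) 𝓘(ℝ, ℂ) ∞
      (fun q : B × ℝ => (1 + q.2 * Complex.I) * c * lineTransition L x₀ x₁ (f q.1) / d)
      {q | f q.1 ∈ (trivializationAt ℂ L x₀).baseSet ∩ (trivializationAt ℂ L x₁).baseSet} := by
  have h1 : ContMDiffOn 𝓘(ℂ, E) 𝓘(ℂ, ℂ) ω (fun b : B => lineTransition L x₀ x₁ (f b))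
      {b | f b ∈ (trivializationAt ℂ L x₀).baseSet ∩ (trivializationAt ℂ L x₁).baseSet} :=
    (contMDiffOn_lineTransition (L := L) (EX := EX) x₀ x₁).comp f.contMDiff.contMDiffOn
      (fun _ h => h)
  have h2 : ContMDiffOn (𝓘(ℝ, E).prod 𝓘(ℝ, ℝ)) 𝓘(ℝ, ℂ) ∞
      (fun q : B × ℝ => lineTransition L x₀ x₁ (f q.1))
      {q | f q.1 ∈ (trivializationAt ℂ L x₀).baseSet ∩ (trivializationAt ℂ L x₁).baseSet} :=
    (contMDiffOn_restrictScalars h1).comp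
      (contMDiff_fst (I := 𝓘(ℝ, E)) (J := 𝓘(ℝ, ℝ))).contMDiffOn (fun _ h => h)
  have h3 : ContDiff ℝ ∞ (fun t : ℝ => (1 + t * Complex.I) * c) :=
    ((contDiff_const.add (Complex.ofRealCLM.contDiff.mul contDiff_const)).mul contDiff_const)
  have h4 : ContMDiffOn (𝓘(ℝ, E).prod 𝓘(ℝ, ℝ)) 𝓘(ℝ, ℂ) ∞
      (fun q : B × ℝ => (1 + q.2 * Complex.I) * c)
      {q | f q.1 ∈ (trivializationAt ℂ L x₀).baseSet ∩ (trivializationAt ℂ L x₁).baseSet} :=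
    h3.contMDiff.comp_contMDiffOn (contMDiff_snd (I := 𝓘(ℝ, E)) (J := 𝓘(ℝ, ℝ))).contMDiffOn
  have h5 : ContDiff ℝ ∞ (fun p : ℂ × ℂ => p.1 * p.2 / d) := by
    simp only [div_eq_mul_inv]
    exact (contDiff_fst.mul contDiff_snd).mul contDiff_const
  exact h5.contMDiff.comp_contMDiffOn (h4.prodMk_space h2)

theorem contMDiffOn_rprojTriv_trans [ContMDiffVectorBundle ω ℂ L 𝓘(ℂ, EX)] (x₀ x₁ : X) (c d : ℂ) :
    ContMDiffOn (𝓘(ℝ, E).prod 𝓘(ℝ, ℝ)) (𝓘(ℝ, E).prod 𝓘(ℝ, ℝ)) ∞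
      ((rprojTriv (L := L) (f := f) x₀ c).symm.trans (rprojTriv x₁ d))
      ((rprojTriv (L := L) (f := f) x₀ c).symm.trans (rprojTriv x₁ d)).source := by
  have hsub : ∀ q ∈ ((rprojTriv (L := L) (f := f) x₀ c).symm.trans (rprojTriv x₁ d)).source,
      q ∈ (rprojTriv (L := L) (f := f) x₀ c).target := fun q hq => hq.1
  have h1 : ContMDiffOn (𝓘(ℝ, E).prod 𝓘(ℝ, ℝ)) 𝓘(ℝ, ℝ) ∞
      (fun q : B × ℝ => slope d ((1 + q.2 * Complex.I) * c * lineTransition L x₀ x₁ (f q.1)))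
      ((rprojTriv (L := L) (f := f) x₀ c).symm.trans (rprojTriv x₁ d)).source := by
    have h2 := (contMDiffOn_line_arg (L := L) (f := f) x₀ x₁ c d).mono
      (t := ((rprojTriv (L := L) (f := f) x₀ c).symm.trans (rprojTriv x₁ d)).source) (by
        rw [rprojTriv_trans_source]; exact fun q hq => hq.1)
    have him := Complex.imCLM.contDiff (n := ∞) |>.contMDiff.comp_contMDiffOn h2
    have hre := Complex.reCLM.contDiff (n := ∞) |>.contMDiff.comp_contMDiffOn h2
    refine him.div₀ hre ?_
    intro q hq
    rw [rprojTriv_trans_source] at hq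
    exact hq.2
  refine ((contMDiff_fst (I := 𝓘(ℝ, E)) (J := 𝓘(ℝ, ℝ))).contMDiffOn.prodMk h1).congr ?_
  intro q hq
  exact rprojTriv_trans_apply x₀ x₁ c d (hsub q hq)

variable [ContMDiffVectorBundle ω ℂ L 𝓘(ℂ, EX)]

variable (L f) in
/-- The atlas of `(f^*L)^* ∖ 0` given by the trivializations of `L`. -/
def slitCore : ChartedSpaceCore (B × ℂ) (Slit L f) where
  atlas := Set.range slitTriv
  chartAt p := slitTriv (f p.base)
  mem_chart_source _ := FiberBundle.mem_baseSet_trivializationAt' _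
  chart_mem_atlas p := ⟨f p.base, rfl⟩
  open_source := by
    rintro _ _ ⟨x₀, rfl⟩ ⟨x₁, rfl⟩
    rw [slitTriv_trans_source]
    exact (((trivializationAt ℂ L x₀).open_baseSet.inter
      (trivializationAt ℂ L x₁).open_baseSet).preimage
        (f.contMDiff.continuous.comp continuous_fst)).inter
      (isOpen_ne.preimage continuous_snd)
  continuousOn_toFun := by
    rintro _ _ ⟨x₀, rfl⟩ ⟨x₁, rfl⟩
    exact (contMDiffOn_slitTriv_trans x₀ x₁).continuousOn

variable (L f) in
/-- The atlas of the real projective bundle of `(f^*L)^*` given by the trivializations of `L` and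
the affine charts of the real projective line. -/
def rprojCore : ChartedSpaceCore (B × ℝ) (RProj L f) where
  atlas := Set.range fun i : X × ℂ => rprojTriv i.1 i.2
  chartAt p := rprojTriv (f p.base) (lineCoord L (f p.base) (f p.base) p.line.rep)
  mem_chart_source p := by
    have h : f p.base ∈ (trivializationAt ℂ L (f p.base)).baseSet :=
      FiberBundle.mem_baseSet_trivializationAt' _
    refine ⟨h, ?_⟩
    rw [div_self (lineCoord_ne_zero h p.line.rep_nonzero)]
    simp
  chart_mem_atlas p := ⟨(f p.base, lineCoord L (f p.base) (f p.base) p.line.rep), rfl⟩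
  open_source := by
    rintro _ _ ⟨⟨x₀, c⟩, rfl⟩ ⟨⟨x₁, d⟩, rfl⟩
    simp only [rprojTriv_trans_source]
    exact (Complex.continuous_re.comp_continuousOn
      (contMDiffOn_line_arg (L := L) (f := f) x₀ x₁ c d).continuousOn).isOpen_inter_preimage
      (((trivializationAt ℂ L x₀).open_baseSet.inter
        (trivializationAt ℂ L x₁).open_baseSet).preimage
          (f.contMDiff.continuous.comp continuous_fst)) isOpen_ne
  continuousOn_toFun := by
    rintro _ _ ⟨⟨x₀, c⟩, rfl⟩ ⟨⟨x₁, d⟩, rfl⟩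
    exact (contMDiffOn_rprojTriv_trans x₀ x₁ c d).continuousOn

instance : TopologicalSpace (Slit L f) := (slitCore L f).toTopologicalSpace

instance : ChartedSpace (ModelProd E ℂ) (Slit L f) :=
  letI := (slitCore L f).toChartedSpace
  ChartedSpace.comp (ModelProd E ℂ) (B × ℂ) (Slit L f)

instance [IsManifold 𝓘(ℂ, E) ω B] : IsManifold (𝓘(ℂ, E).prod 𝓘(ℂ, ℂ)) ω (Slit L f) :=
  isManifold_comp _ _ (B × ℂ) (Slit L f) (slitCore L f) (by
    rintro _ ⟨x₀, rfl⟩ _ ⟨x₁, rfl⟩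
    exact contMDiffOn_slitTriv_trans x₀ x₁)

instance : TopologicalSpace (RProj L f) := (rprojCore L f).toTopologicalSpace

instance : ChartedSpace (ModelProd E ℝ) (RProj L f) :=
  letI := (rprojCore L f).toChartedSpace
  ChartedSpace.comp (ModelProd E ℝ) (B × ℝ) (RProj L f)

instance [IsManifold 𝓘(ℂ, E) ω B] : IsManifold (𝓘(ℝ, E).prod 𝓘(ℝ, ℝ)) ∞ (RProj L f) :=
  have := isManifold_real E B
  isManifold_comp _ _ (B × ℝ) (RProj L f) (rprojCore L f) (by
    rintro _ ⟨⟨x₀, c⟩, rfl⟩ _ ⟨⟨x₁, d⟩, rfl⟩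
    exact contMDiffOn_rprojTriv_trans x₀ x₁ c d)

/-- The projection `(f^*L)^* ∖ 0 → ℝℙ((f^*L)^*)`, with fibres the orbits of `ℝ^×`. -/
def Slit.toRProj (p : Slit L f) : RProj L f := ⟨p.base, Projectivization.mk ℝ p.covec p.ne_zero⟩

/-- The flow of the Euler vector field, `(z, ε) ↦ exp(z) ε`. -/
def Slit.flow (p : Slit L f) (z : ℂ) : Slit L f :=
  ⟨p.base, Complex.exp z • p.covec, smul_ne_zero (Complex.exp_ne_zero z) p.ne_zero⟩

end Total

section Groupoids

/-- A groupoid with arrows `G` and objects `M`. An arrow `g` goes from `src g` to `tgt g`, and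
`mul g h` is the product of arrows with `src g = tgt h` (its other values are irrelevant). -/
structure GroupoidStr (G M : Type*) where
  src : G → M
  tgt : G → M
  unit : M → G
  inv : G → G
  mul : G → G → G
  src_unit : ∀ x, src (unit x) = x
  tgt_unit : ∀ x, tgt (unit x) = x
  src_inv : ∀ g, src (inv g) = tgt g
  tgt_inv : ∀ g, tgt (inv g) = src g
  src_mul : ∀ g h, src g = tgt h → src (mul g h) = src h
  tgt_mul : ∀ g h, src g = tgt h → tgt (mul g h) = tgt g
  mul_assoc : ∀ g h k, src g = tgt h → src h = tgt k → mul (mul g h) k = mul g (mul h k)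
  unit_mul : ∀ g, mul (unit (tgt g)) g = g
  mul_unit : ∀ g, mul g (unit (src g)) = g
  mul_inv : ∀ g, mul g (inv g) = unit (tgt g)
  inv_mul : ∀ g, mul (inv g) g = unit (src g)

variable {𝕜 : Type*} [NontriviallyNormedField 𝕜]
  {E : Type*} [NormedAddCommGroup E] [NormedSpace 𝕜 E] {K : Type*} [TopologicalSpace K]
  (I : ModelWithCorners 𝕜 E K)
  {F : Type*} [NormedAddCommGroup F] [NormedSpace 𝕜 F] {K' : Type*} [TopologicalSpace K']
  (J : ModelWithCorners 𝕜 F K')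
  (n : WithTop ℕ∞)
  (G : Type*) [TopologicalSpace G] [ChartedSpace K G]
  (M : Type*) [TopologicalSpace M] [ChartedSpace K' M]

/-- The set `G⁽²⁾` of composable pairs of arrows. -/
def GroupoidStr.composable {G M : Type*} (Γ : GroupoidStr G M) : Set (G × G) :=
  {p | Γ.src p.1 = Γ.tgt p.2}

/-- Lie groupoids of class `C^n`; for `𝕜 = ℂ` and `n = ω` these are the complex Lie groupoids.
Smoothness of the multiplication on the closed submanifold `G⁽²⁾` of `G × G` is smoothness within
that subset. -/
structure LieGroupoid extends GroupoidStr G M where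
  contMDiff_src : ContMDiff I J n src
  contMDiff_tgt : ContMDiff I J n tgt
  contMDiff_unit : ContMDiff J I n unit
  contMDiff_inv : ContMDiff I I n inv
  contMDiffOn_mul : ContMDiffOn (I.prod I) I n (fun p : G × G => mul p.1 p.2)
    toGroupoidStr.composable
  submersion_src : ∀ g, Function.Surjective (mfderiv I J src g)
  submersion_tgt : ∀ g, Function.Surjective (mfderiv I J tgt g)

variable {I J n G M}

/-- The target map, bundled. -/
def LieGroupoid.tgtMap (Γ : LieGroupoid I J n G M) : ContMDiffMap I J G M n :=
  ⟨Γ.tgt, Γ.contMDiff_tgt⟩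

/-- The multiplication of the tangent groupoid `TG ⇉ TM`: the differential of the multiplication
along `G⁽²⁾`. It is meaningful for tangent vectors `V`, `W` with `ds(V) = dt(W)`. -/
def GroupoidStr.tangentMul (Γ : GroupoidStr G M) (I : ModelWithCorners 𝕜 E K)
    (V W : TangentBundle I G) : TangentBundle I G :=
  ⟨Γ.mul V.proj W.proj,
    mfderivWithin (I.prod I) I (fun p : G × G => Γ.mul p.1 p.2) Γ.composable (V.proj, W.proj)
      (V.snd, W.snd)⟩

/-- A distribution `D ⊂ TG` is multiplicative and covers `TM` if it is a VB-subgroupoid of the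
tangent groupoid `TG ⇉ TM` with space of objects all of `TM`. -/
structure IsMultiplicative (Γ : GroupoidStr G M) (I : ModelWithCorners 𝕜 E K)
    (J : ModelWithCorners 𝕜 F K') (D : ∀ g : G, Submodule 𝕜 (TangentSpace I g)) : Prop where
  covers : ∀ g, ∀ u : TangentSpace J (Γ.src g), ∃ v ∈ D g, mfderiv I J Γ.src g v = u
  unit_mem : ∀ x, ∀ u : TangentSpace J x, mfderiv J I Γ.unit x u ∈ D (Γ.unit x)
  inv_mem : ∀ g, ∀ v ∈ D g, mfderiv I I Γ.inv g v ∈ D (Γ.inv g)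
  mul_mem : ∀ V W : TangentBundle I G, tangentMap I J Γ.src V = tangentMap I J Γ.tgt W →
    V.snd ∈ D V.proj → W.snd ∈ D W.proj →
    (Γ.tangentMul I V W).snd ∈ D (Γ.tangentMul I V W).proj

/-- A distribution `D` is maximally non-integrable if its curvature `D × D → TG / D`,
`(v, w) ↦ [V, W] mod D`, is non-degenerate; here `V`, `W` are any local sections of `D` that
extend `v`, `w`. -/
def IsMaximallyNonintegrable (I : ModelWithCorners 𝕜 E K) [IsManifold I 1 G] (n : WithTop ℕ∞)
    (D : ∀ g : G, Submodule 𝕜 (TangentSpace I g)) : Prop :=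
  ∀ g, ∀ v ∈ D g, v ≠ 0 → ∃ V W : ∀ y : G, TangentSpace I y,
    ContMDiffAt I I.tangent n (fun y => (⟨y, V y⟩ : TangentBundle I G)) g ∧
    ContMDiffAt I I.tangent n (fun y => (⟨y, W y⟩ : TangentBundle I G)) g ∧
    (∀ᶠ y in nhds g, V y ∈ D y) ∧ (∀ᶠ y in nhds g, W y ∈ D y) ∧
    V g = v ∧ VectorField.mlieBracket I V W g ∉ D g

/-- The exterior derivative of a `1`-form on a manifold without boundary, computed in the
preferred chart at each point: `dα(v, w) = v(α(w)) - w(α(v))` for constant `v`, `w`. -/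
def extDerivOne (I : ModelWithCorners 𝕜 E K) (α : ∀ p : G, TangentSpace I p →L[𝕜] 𝕜) (p : G) :
    TangentSpace I p →L[𝕜] TangentSpace I p →L[𝕜] 𝕜 :=
  let φ := extChartAt I p
  let a : E → E →L[𝕜] 𝕜 := fun y => (α (φ.symm y)).comp (mfderiv 𝓘(𝕜, E) I φ.symm y)
  let A : E →L[𝕜] E →L[𝕜] 𝕜 := fderiv 𝕜 a (φ p)
  let d : E →L[𝕜] E := mfderiv I 𝓘(𝕜, E) φ p
  let r : E →L[𝕜] E →L[𝕜] 𝕜 := (A - A.flip).bilinearComp d d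
  r

end Groupoids

section Contact

variable {EX : Type*} [NormedAddCommGroup EX] [NormedSpace ℂ EX]
  {X : Type*} [TopologicalSpace X] [ChartedSpace EX X]
  {EG : Type*} [NormedAddCommGroup EG] [NormedSpace ℂ EG]
  {G : Type*} [TopologicalSpace G] [ChartedSpace EG G]
  (Γ : LieGroupoid 𝓘(ℂ, EG) 𝓘(ℂ, EX) ω G X)
  (L : X → Type*) [∀ x, AddCommGroup (L x)] [∀ x, Module ℂ (L x)] [∀ x, TopologicalSpace (L x)]
  [TopologicalSpace (TotalSpace ℂ L)] [FiberBundle ℂ L] [VectorBundle ℂ ℂ L]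

/-- A holomorphic action of the complex Lie groupoid `G ⇉ X` on the holomorphic line bundle
`L → X`, by linear isomorphisms `g : L_{s(g)} → L_{t(g)}`. Vectors of fibres of `L` over points
that are only propositionally equal are compared as points of the total space of `L`. Such an
action is the same as an LB-groupoid structure on `t^*L ⇉ 0_X`, with product
`(g, ℓ)(h, ℓ') = (gh, ℓ + g.ℓ')`. -/
structure LineAction where
  act : ∀ g, L (Γ.src g) ≃L[ℂ] L (Γ.tgt g)
  act_unit : ∀ x, ∀ v : L (Γ.src (Γ.unit x)),
    (⟨_, act (Γ.unit x) v⟩ : TotalSpace ℂ L) = ⟨_, v⟩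
  act_mul : ∀ g h, Γ.src g = Γ.tgt h →
    ∀ (u : L (Γ.src (Γ.mul g h))) (v : L (Γ.src h)) (w : L (Γ.src g)),
      (⟨_, u⟩ : TotalSpace ℂ L) = ⟨_, v⟩ → (⟨_, w⟩ : TotalSpace ℂ L) = ⟨_, act h v⟩ →
      (⟨_, act (Γ.mul g h) u⟩ : TotalSpace ℂ L) = ⟨_, act g w⟩
  holomorphic : ∀ g₀, ContMDiffAt 𝓘(ℂ, EG) 𝓘(ℂ, ℂ →L[ℂ] ℂ) ω
    (fun g => ContinuousLinearMap.inCoordinates ℂ L ℂ L (Γ.src g₀) (Γ.src g) (Γ.tgt g₀) (Γ.tgt g)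
      (act g : L (Γ.src g) →L[ℂ] L (Γ.tgt g))) g₀

variable {Γ L}

/-- Holomorphy of a `t^*L`-valued `(1,0)`-form on `G`. -/
def IsHolomorphicForm [IsManifold 𝓘(ℂ, EG) ω G]
    (θ : ∀ g, TangentSpace 𝓘(ℂ, EG) g →L[ℂ] L (Γ.tgt g)) : Prop :=
  ∀ g₀, ContMDiffAt 𝓘(ℂ, EG) 𝓘(ℂ, EG →L[ℂ] ℂ) ω
    (fun g => ContinuousLinearMap.inCoordinates EG (TangentSpace 𝓘(ℂ, EG)) ℂ L g₀ g
      (Γ.tgt g₀) (Γ.tgt g) (θ g)) g₀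

/-- The map `θ : TG → t^*L` is a map of groupoids from the tangent groupoid to the LB-groupoid
`t^*L ⇉ 0_X` of the action: `θ(V · W) = θ(V) + g.θ(W)` for composable `V ∈ T_gG`, `W ∈ T_hG`.
If `θ` is surjective with multiplicative kernel `H`, this says that the induced isomorphism
`TG / H ≅ t^*L` is one of LB-groupoids, where the product in `TG / H` is `[V] · [W] = [V · W]`. -/
def IsGroupoidMap (A : LineAction Γ L)
    (θ : ∀ g, TangentSpace 𝓘(ℂ, EG) g →L[ℂ] L (Γ.tgt g)) : Prop :=
  ∀ V W : TangentBundle 𝓘(ℂ, EG) G,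
    tangentMap 𝓘(ℂ, EG) 𝓘(ℂ, EX) Γ.src V = tangentMap 𝓘(ℂ, EG) 𝓘(ℂ, EX) Γ.tgt W →
    ∀ ℓ : L (Γ.src V.proj), (⟨_, ℓ⟩ : TotalSpace ℂ L) = ⟨_, θ W.proj W.snd⟩ →
      (⟨_, θ _ (Γ.tangentMul 𝓘(ℂ, EG) V W).snd⟩ : TotalSpace ℂ L) =
        ⟨_, θ V.proj V.snd + A.act V.proj ℓ⟩

variable (X) in
/-- The identity of `X`, bundled. -/
def idMap : ContMDiffMap 𝓘(ℂ, EX) 𝓘(ℂ, EX) X X ω := ⟨fun x => x, contMDiff_id⟩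

/-- `M̂`, the real projective bundle of the complex dual of `L`. -/
abbrev BaseHat (_ : LieGroupoid 𝓘(ℂ, EG) 𝓘(ℂ, EX) ω G X) (L : X → Type*)
    [∀ x, AddCommGroup (L x)] [∀ x, Module ℂ (L x)] [∀ x, TopologicalSpace (L x)] := RProj L (idMap (EX := EX) X)

variable (Γ L) in
/-- `Ĝ`, the real projective bundle of the complex dual of `L_G = t^*L`. -/
abbrev ArrowHat := RProj L Γ.tgtMap

variable (Γ L) in
/-- `G̃ = L_G^* ∖ 0`, the complex homogenization of `L_G = t^*L`. -/
abbrev ArrowTilde := Slit L Γ.tgtMap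

/-- `ε ↦ ε ∘ g`, the action of `g⁻¹` on covectors. -/
def LineAction.dual (A : LineAction Γ L) (g : G) :
    (L (Γ.tgt g) →L[ℂ] ℂ) →ₗ[ℝ] (L (Γ.src g) →L[ℂ] ℂ) where
  toFun ε := ε.comp (A.act g : L (Γ.src g) →L[ℂ] L (Γ.tgt g))
  map_add' _ _ := rfl
  map_smul' _ _ := rfl

theorem LineAction.dual_injective (A : LineAction Γ L) (g : G) :
    Function.Injective (A.dual g) := by
  intro ε η h
  ext v
  have h' : ε (A.act g ((A.act g).symm v)) = η (A.act g ((A.act g).symm v)) :=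
    DFunLike.congr_fun h ((A.act g).symm v)
  rwa [ContinuousLinearEquiv.apply_symm_apply] at h'

/-- The target of an arrow `(g, [ε])` of `Ĝ`. -/
def tgtHat (z : ArrowHat Γ L) : BaseHat Γ L := ⟨Γ.tgt z.base, z.line⟩

/-- The source `[ε ∘ g]` of an arrow `(g, [ε])` of `Ĝ`. -/
def srcHat (A : LineAction Γ L) (z : ArrowHat Γ L) : BaseHat Γ L :=
  ⟨Γ.src z.base, z.line.map (A.dual z.base) (A.dual_injective z.base)⟩

/-- Transport of real lines in the fibres of `L^*` along an equality of base points. -/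
def castLine {x y : X} (h : x = y) (ℓ : ℙ ℝ (L y →L[ℂ] ℂ)) : ℙ ℝ (L x →L[ℂ] ℂ) := h ▸ ℓ

/-- The arrow of `Ĝ` over `g` with target `p`. -/
def arrowOf (g : G) (p : BaseHat Γ L) (h : Γ.tgt g = p.base) : ArrowHat Γ L :=
  ⟨g, castLine h p.line⟩

theorem tgtHat_arrowOf (g : G) (p : BaseHat Γ L) (h : Γ.tgt g = p.base) :
    tgtHat (arrowOf (Γ := Γ) g p h) = p := by
  obtain ⟨x, ℓ⟩ := p
  change Γ.tgt g = x at h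
  subst h
  rfl

theorem arrowHat_ext {z w : ArrowHat Γ L} (h : z.base = w.base) (h' : tgtHat z = tgtHat w) :
    z = w := by
  obtain ⟨g, ℓ⟩ := z
  obtain ⟨g', ℓ'⟩ := w
  obtain rfl : g = g' := h
  exact congrArg (RProj.mk g) (eq_of_heq (RProj.mk.inj h').2)

theorem srcHat_arrowOf_eq (A : LineAction Γ L) (g : G) {x y : X} {ε : L x →L[ℂ] ℂ} (hε : ε ≠ 0)
    {η : L y →L[ℂ] ℂ} (hη : η ≠ 0) (hx : Γ.tgt g = x) (hy : Γ.src g = y)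
    (H : ∀ (v : L (Γ.src g)) (v' : L y) (w : L x), (⟨_, v⟩ : TotalSpace ℂ L) = ⟨_, v'⟩ →
      (⟨_, A.act g v⟩ : TotalSpace ℂ L) = ⟨_, w⟩ → η v' = ε w) :
    srcHat A (arrowOf g ⟨x, Projectivization.mk ℝ ε hε⟩ hx) =
      ⟨y, Projectivization.mk ℝ η hη⟩ := by
  subst hx hy
  have : η = A.dual g ε := by
    ext v
    exact H v v _ rfl rfl
  subst this
  rfl

theorem exists_srcHat_arrowOf (A : LineAction Γ L) (g : G) {x : X} {ε : L x →L[ℂ] ℂ}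
    (hε : ε ≠ 0) (hx : Γ.tgt g = x) :
    ∃ (η : L (Γ.src g) →L[ℂ] ℂ) (hη : η ≠ 0),
      srcHat A (arrowOf g ⟨x, Projectivization.mk ℝ ε hε⟩ hx) =
        ⟨Γ.src g, Projectivization.mk ℝ η hη⟩ ∧
      ∀ (v : L (Γ.src g)) (w : L x), (⟨_, A.act g v⟩ : TotalSpace ℂ L) = ⟨_, w⟩ → η v = ε w := by
  subst hx
  refine ⟨A.dual g ε, fun h => hε (A.dual_injective g (h.trans (map_zero _).symm)), rfl, ?_⟩
  intro v w h
  have : A.act g v = w := by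
    rw [TotalSpace.mk.injEq] at h
    exact eq_of_heq h.2
  rw [← this]
  rfl

theorem exists_mk (p : BaseHat Γ L) : ∃ (x : X) (ε : L x →L[ℂ] ℂ) (hε : ε ≠ 0),
    p = ⟨x, Projectivization.mk ℝ ε hε⟩ :=
  ⟨p.base, p.line.rep, p.line.rep_nonzero, by rw [Projectivization.mk_rep]⟩

theorem srcHat_unit (A : LineAction Γ L) (p : BaseHat Γ L) :
    srcHat A (arrowOf (Γ.unit p.base) p (Γ.tgt_unit _)) = p := by
  obtain ⟨x, ε, hε, rfl⟩ := exists_mk p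
  refine srcHat_arrowOf_eq A _ hε hε _ (Γ.src_unit x) ?_
  intro v v' w h1 h2
  rw [A.act_unit, h1, TotalSpace.mk.injEq] at h2
  rw [eq_of_heq h2.2]

theorem srcHat_mul (A : LineAction Γ L) (g h : G) (hgh : Γ.src g = Γ.tgt h) (p : BaseHat Γ L)
    (hp : Γ.tgt g = p.base) :
    srcHat A (arrowOf (Γ.mul g h) p ((Γ.tgt_mul g h hgh).trans hp)) =
      srcHat A (arrowOf h (srcHat A (arrowOf g p hp)) hgh.symm) := by
  obtain ⟨x, ε, hε, rfl⟩ := exists_mk p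
  obtain ⟨η, hη, e1, H1⟩ := exists_srcHat_arrowOf A g hε hp
  obtain ⟨κ, hκ, e2, H2⟩ := exists_srcHat_arrowOf A h hη hgh.symm
  simp only [e1]
  rw [e2]
  refine srcHat_arrowOf_eq A _ hε hκ _ (Γ.src_mul g h hgh) ?_
  intro u v w h1 h2
  obtain ⟨w', hw'⟩ : ∃ w' : L (Γ.src g),
      (⟨_, w'⟩ : TotalSpace ℂ L) = ⟨Γ.tgt h, A.act h v⟩ := by
    rw [hgh]
    exact ⟨_, rfl⟩
  rw [H2 v w' hw'.symm]
  exact H1 w' w ((A.act_mul g h hgh u v w' h1 hw').symm.trans h2)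

theorem srcHat_congr (A : LineAction Γ L) {g g' : G} {p p' : BaseHat Γ L} (hg : g = g')
    (hp : p = p') (h : Γ.tgt g = p.base) (h' : Γ.tgt g' = p'.base) :
    srcHat A (arrowOf g p h) = srcHat A (arrowOf g' p' h') := by
  subst hg hp
  rfl

theorem arrowOf_tgtHat (z : ArrowHat Γ L) : arrowOf z.base (tgtHat z) rfl = z :=
  arrowHat_ext rfl (tgtHat_arrowOf _ _ _)

open Classical in
/-- The multiplication of `Ĝ`: `(g, [ε]) (h, [ε ∘ g]) = (gh, [ε])`. -/
def mulHat (z w : ArrowHat Γ L) : ArrowHat Γ L :=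
  if h : Γ.src z.base = Γ.tgt w.base then
    arrowOf (Γ.mul z.base w.base) (tgtHat z) (Γ.tgt_mul _ _ h) else z

theorem mulHat_eq {z w : ArrowHat Γ L} (h : Γ.src z.base = Γ.tgt w.base) :
    mulHat z w = arrowOf (Γ.mul z.base w.base) (tgtHat z) (Γ.tgt_mul _ _ h) := dif_pos h

theorem mulHat_base {z w : ArrowHat Γ L} (h : Γ.src z.base = Γ.tgt w.base) :
    (mulHat z w).base = Γ.mul z.base w.base := by rw [mulHat_eq h]; rfl

theorem tgtHat_mulHat {z w : ArrowHat Γ L} (h : Γ.src z.base = Γ.tgt w.base) :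
    tgtHat (mulHat z w) = tgtHat z := by rw [mulHat_eq h]; exact tgtHat_arrowOf _ _ _

/-- The groupoid `Ĝ ⇉ M̂`, i.e. the action groupoid of the action of `G` on `M̂` induced by the
one on `L`. -/
def groupoidHat (A : LineAction Γ L) : GroupoidStr (ArrowHat Γ L) (BaseHat Γ L) where
  src := srcHat A
  tgt := tgtHat
  unit p := arrowOf (Γ.unit p.base) p (Γ.tgt_unit _)
  inv z := arrowOf (Γ.inv z.base) (srcHat A z) (Γ.tgt_inv _)
  mul := mulHat
  src_unit p := srcHat_unit A p
  tgt_unit p := tgtHat_arrowOf _ _ _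
  src_inv z := by
    have h := srcHat_mul A z.base (Γ.inv z.base) (Γ.tgt_inv _).symm (tgtHat z) rfl
    refine Eq.trans (srcHat_congr A rfl (by rw [arrowOf_tgtHat]) _ _) (h.symm.trans ?_)
    exact (srcHat_congr A (Γ.mul_inv _) rfl _ (Γ.tgt_unit _)).trans (srcHat_unit A (tgtHat z))
  tgt_inv z := tgtHat_arrowOf _ _ _
  src_mul z w h := by
    have h0 : Γ.src z.base = Γ.tgt w.base := congrArg RProj.base h
    rw [mulHat_eq h0]
    refine (srcHat_mul A z.base w.base h0 (tgtHat z) rfl).trans ?_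
    refine (srcHat_congr A rfl ?_ _ rfl).trans (congrArg (srcHat A) (arrowOf_tgtHat w))
    rw [arrowOf_tgtHat, h]
  tgt_mul z w h := tgtHat_mulHat (congrArg RProj.base h)
  mul_assoc z w u h h' := by
    have h0 : Γ.src z.base = Γ.tgt w.base := congrArg RProj.base h
    have h0' : Γ.src w.base = Γ.tgt u.base := congrArg RProj.base h'
    have h1 : Γ.src (mulHat z w).base = Γ.tgt u.base := by
      rw [mulHat_base h0, Γ.src_mul _ _ h0, h0']
    have h2 : Γ.src z.base = Γ.tgt (mulHat w u).base := by
      rw [mulHat_base h0', Γ.tgt_mul _ _ h0', h0]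
    apply arrowHat_ext
    · rw [mulHat_base h1, mulHat_base h2, mulHat_base h0, mulHat_base h0',
        Γ.mul_assoc _ _ _ h0 h0']
    · rw [tgtHat_mulHat h1, tgtHat_mulHat h2, tgtHat_mulHat h0]
  unit_mul z := by
    have h : Γ.src (arrowOf (Γ.unit (tgtHat z).base) (tgtHat z) (Γ.tgt_unit _)).base =
      Γ.tgt z.base := Γ.src_unit _
    apply arrowHat_ext
    · exact (mulHat_base h).trans (Γ.unit_mul _)
    · exact (tgtHat_mulHat h).trans (tgtHat_arrowOf _ _ _)
  mul_unit z := by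
    have h : Γ.src z.base = Γ.tgt (arrowOf (Γ := Γ) (Γ.unit (srcHat A z).base)
      (srcHat A z) (Γ.tgt_unit _)).base := (Γ.tgt_unit _).symm
    apply arrowHat_ext
    · exact (mulHat_base h).trans (Γ.mul_unit _)
    · exact tgtHat_mulHat h
  mul_inv z := by
    have h : Γ.src z.base = Γ.tgt (arrowOf (Γ := Γ) (Γ.inv z.base)
      (srcHat A z) (Γ.tgt_inv _)).base := (Γ.tgt_inv _).symm
    apply arrowHat_ext
    · exact (mulHat_base h).trans (Γ.mul_inv _)
    · exact (tgtHat_mulHat h).trans (tgtHat_arrowOf _ _ _).symm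
  inv_mul z := by
    have h : Γ.src (arrowOf (Γ := Γ) (Γ.inv z.base) (srcHat A z) (Γ.tgt_inv _)).base =
      Γ.tgt z.base := Γ.src_inv _
    apply arrowHat_ext
    · exact (mulHat_base h).trans (Γ.inv_mul _)
    · exact (tgtHat_mulHat h).trans ((tgtHat_arrowOf _ _ _).trans (tgtHat_arrowOf _ _ _).symm)

variable [ContMDiffVectorBundle ω ℂ L 𝓘(ℂ, EX)]

/-- The holomorphic Euler vector field `Z` on `G̃`: the velocity of `z ↦ exp(z) ε` at `z = 0`.
Under the identification `T^{1,0}G̃ ≅ TG̃` it is the real vector field `2 Re Z`. -/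
def eulerField (p : ArrowTilde Γ L) : TangentSpace (𝓘(ℂ, EG).prod 𝓘(ℂ, ℂ)) p :=
  (mfderiv 𝓘(ℂ, ℂ) (𝓘(ℂ, EG).prod 𝓘(ℂ, ℂ)) p.flow 0 (1 : ℂ) :)

/-- The holomorphic `1`-form `Θ` on `G̃`, `Θ_ε(v) = ⟨ε, θ(dp(v))⟩`, with `p : G̃ → G` the
projection. -/
def liouvilleForm (θ : ∀ g, TangentSpace 𝓘(ℂ, EG) g →L[ℂ] L (Γ.tgt g)) (p : ArrowTilde Γ L) :
    TangentSpace (𝓘(ℂ, EG).prod 𝓘(ℂ, ℂ)) p →L[ℂ] ℂ :=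
  (p.covec.comp (θ p.base)).comp
    (mfderiv (𝓘(ℂ, EG).prod 𝓘(ℂ, ℂ)) 𝓘(ℂ, EG) Slit.base p)

/-- The complex symplectization form `Ω = dΘ` on `G̃`. -/
def symplectization (θ : ∀ g, TangentSpace 𝓘(ℂ, EG) g →L[ℂ] L (Γ.tgt g)) (p : ArrowTilde Γ L) :
    TangentSpace (𝓘(ℂ, EG).prod 𝓘(ℂ, ℂ)) p →L[ℂ]
      TangentSpace (𝓘(ℂ, EG).prod 𝓘(ℂ, ℂ)) p →L[ℂ] ℂ :=
  extDerivOne (𝓘(ℂ, EG).prod 𝓘(ℂ, ℂ)) (liouvilleForm θ) p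

/-- The kernel of the real `1`-form `ι_{2 Re Z} Re Ω` on `G̃`. -/
def reKernel (θ : ∀ g, TangentSpace 𝓘(ℂ, EG) g →L[ℂ] L (Γ.tgt g)) (p : ArrowTilde Γ L) :
    Submodule ℝ (TangentSpace (𝓘(ℝ, EG).prod 𝓘(ℝ, ℂ)) p) where
  carrier := {v | (symplectization θ p (eulerField p) v).re = 0}
  add_mem' {v w} hv hw := by
    have h := (symplectization θ p (eulerField p)).map_add v w
    simp only [Set.mem_ofPred_eq] at hv hw ⊢
    exact (congrArg Complex.re h).trans (by rw [Complex.add_re, hv, hw, add_zero])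
  zero_mem' := congrArg Complex.re ((symplectization θ p (eulerField p)).map_zero)
  smul_mem' r v hv := by
    have h := (symplectization θ p (eulerField p)).map_smul (r : ℂ) v
    simp only [Set.mem_ofPred_eq] at hv ⊢
    exact (congrArg Complex.re h).trans (by rw [smul_eq_mul, Complex.re_ofReal_mul, hv, mul_zero])

/-- The contact structure `Ĥ` on `Ĝ` induced by `H = ker θ`, whose symplectization is `Re Ω`: at
a point `z` of `Ĝ` it is the image, under the projection `G̃ → Ĝ`, of the kernel of
`ι_{2 Re Z} Re Ω` at a point of `G̃` over `z`. By homogeneity this image is the same for all the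
points over `z`, so that the supremum below is of a constant family. -/
def contactHat (θ : ∀ g, TangentSpace 𝓘(ℂ, EG) g →L[ℂ] L (Γ.tgt g)) (z : ArrowHat Γ L) :
    Submodule ℝ (TangentSpace (𝓘(ℝ, EG).prod 𝓘(ℝ, ℝ)) z) :=
  ⨆ (p : ArrowTilde Γ L) (h : p.toRProj = z),
    h ▸ (reKernel θ p).map (mfderiv (𝓘(ℝ, EG).prod 𝓘(ℝ, ℂ)) (𝓘(ℝ, EG).prod 𝓘(ℝ, ℝ))
      Slit.toRProj p).toLinearMap

end Contact

end

end HolContact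

/-! The form `Θ` is homogeneous of degree one along the fibres of `G̃`: in a trivialization it is
`y₂ b(y₁)(dy₁)`, and the Euler field is `y₂ ∂/∂y₂`. Hence `ι_Z Ω = Θ`
(`symplectization_eulerField`), and the kernel of `ι_{2 Re Z} Re Ω` at `ε` is the kernel of `Re ⟨ε,
θ ∘ dp⟩`. This kernel depends only on the real line `[ε]`, so `Ĥ` at `(g, [ε])` consists of the
vectors whose projection `v ∈ T_gG` satisfies `Re ε(θ(v)) = 0` (`contactHat_eq`, `mem_contactHat`).

The projection `TĜ → TG` commutes with all structure maps of the tangent groupoids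
(`dbase_mfderiv_unitHat`, `dbase_mfderiv_invHat`, `dbase_tangentMul`). Moreover `TĜ` is the fibre
product of `TG` and `TM̂` over `TX`, along targets as well as along sources (`exists_lift_tgtHat`,
`exists_lift_srcHat`). Multiplicativity of `Ĥ` thus becomes a statement about `θ` on `TG`, tested
against the real lines `[ε]`.

Suppose `H` is multiplicative. Then `ε(θ(V · W)) = ε(θ(V)) + (ε ∘ g)(θ(W))`, and both terms have
real part zero when the factors lie in `Ĥ`, because `[ε ∘ g]` is the target of the second arrow.
Inverses follow from the same formula applied to `V · V⁻¹`, which is a unit. Units and the covering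
of `TM̂` follow from `ker θ` by lifting.

Suppose `Ĥ` is multiplicative. Vectors of `ker θ` lift into `Ĥ` over every line `[ε]`, so `Re ε(θ(V
· W)) = 0` for every `ε`, which forces `θ(V · W) = 0` (`eq_zero_of_annihilates`); units and inverses
are treated alike. That `ker θ` covers `TX` needs a separate argument
(`ker_covers_of_contactHat_covers`): otherwise `θ` would vanish on `ker ds`, and a vector on which
`ε ∘ θ` equals `1` would share its source with a vector of `Ĥ`, on which `ε ∘ θ` is purely
imaginary. -/

open Filter Topology

namespace HolContact

noncomputable section

/-! ### Smoothness of the intermediate charts of a manifold with composed charts -/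

section CompositeCharts

variable {𝕜 : Type*} [NontriviallyNormedField 𝕜] {E : Type*} [NormedAddCommGroup E]
    [NormedSpace 𝕜 E] {H : Type*} [TopologicalSpace H] (I : ModelWithCorners 𝕜 E H) (n : WithTop ℕ∞)
    {N P : Type*} [TopologicalSpace N] [ChartedSpace H N] [IsManifold I n N]

/-- The charts over `N` of a manifold with composed charts are `C^n`. -/
theorem contMDiffOn_chart_comp [TopologicalSpace P] [ChartedSpace N P]
    (hP : @IsManifold 𝕜 _ E _ _ H _ I n P _ (ChartedSpace.comp H N P))
    {e : OpenPartialHomeomorph P N} (he : e ∈ atlas N P) :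
    letI := ChartedSpace.comp H N P
    ContMDiffOn I I n e e.source ∧ ContMDiffOn I I n e.symm e.target := by
  let _ := ChartedSpace.comp H N P
  -- Composites of `e` with charts of `N` are charts of `P`. Near each point `e` is such a chart of
  -- `P` followed by the inverse of a chart of `N`, and dually for its inverse.
  have hmem : ∀ y, e.trans (chartAt H y) ∈ IsManifold.maximalAtlas I n P := fun y =>
    StructureGroupoid.subset_maximalAtlas _ ⟨e, he, chartAt H y, chart_mem_atlas H y, rfl⟩
  constructor
  · intro x hx
    refine ContMDiffAt.contMDiffWithinAt ?_
    have hx' : x ∈ (e.trans (chartAt H (e x))).source := by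
      rw [OpenPartialHomeomorph.trans_source]
      exact ⟨hx, mem_chart_source H (e x)⟩
    have h1 := contMDiffAt_of_mem_maximalAtlas (hmem (e x)) hx'
    have h2 : ContMDiffAt I I n (chartAt H (e x)).symm (e.trans (chartAt H (e x)) x) :=
      contMDiffAt_symm_of_mem_maximalAtlas (IsManifold.chart_mem_maximalAtlas (e x))
        (mem_chart_target H (e x))
    refine (h2.comp x h1).congr_of_eventuallyEq ?_
    filter_upwards [(e.trans (chartAt H (e x))).open_source.mem_nhds hx'] with y hy
    rw [OpenPartialHomeomorph.trans_source] at hy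
    exact ((chartAt H (e x)).left_inv hy.2).symm
  · intro y hy
    refine ContMDiffAt.contMDiffWithinAt ?_
    have h1 : ContMDiffAt I I n (chartAt H y) y :=
      contMDiffAt_of_mem_maximalAtlas (IsManifold.chart_mem_maximalAtlas y) (mem_chart_source H y)
    have h2 : ContMDiffAt I I n (e.trans (chartAt H y)).symm (chartAt H y y) :=
      contMDiffAt_symm_of_mem_maximalAtlas (hmem y) (by
        rw [OpenPartialHomeomorph.trans_target]
        refine ⟨mem_chart_target H y, ?_⟩
        rw [Set.mem_preimage, OpenPartialHomeomorph.left_inv _ (mem_chart_source H y)]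
        exact hy)
    refine (h2.comp y h1).congr_of_eventuallyEq ?_
    filter_upwards [(chartAt H y).open_source.mem_nhds (mem_chart_source H y)] with z hz
    exact congrArg e.symm ((chartAt H y).left_inv hz).symm

theorem contMDiffOn_core (c : ChartedSpaceCore N P)
    (hP : @IsManifold 𝕜 _ E _ _ H _ I n P c.toTopologicalSpace
      (@ChartedSpace.comp H _ N _ P c.toTopologicalSpace _ c.toChartedSpace))
    {e : PartialEquiv P N} (he : e ∈ c.atlas) :
    letI := c.toTopologicalSpace
    letI := c.toChartedSpace
    letI := ChartedSpace.comp H N P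
    IsOpen e.source ∧ IsOpen e.target ∧
      ContMDiffOn I I n e e.source ∧ ContMDiffOn I I n e.symm e.target := by
  let _ := c.toTopologicalSpace
  let _ := c.toChartedSpace
  have h : c.openPartialHomeomorph e he ∈ atlas N P :=
    Set.mem_iUnion₂.2 ⟨e, he, rfl⟩
  exact ⟨c.open_source' he, c.open_target he, contMDiffOn_chart_comp I n hP h⟩

end CompositeCharts

/-! ### Real smooth structure on the slit line bundle; trivializations as diffeomorphisms -/

section Slit

variable {EX : Type*} [NormedAddCommGroup EX] [NormedSpace ℂ EX]
  {X : Type*} [TopologicalSpace X] [ChartedSpace EX X]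
  {L : X → Type*} [∀ x, AddCommGroup (L x)] [∀ x, Module ℂ (L x)] [∀ x, TopologicalSpace (L x)]
  [TopologicalSpace (TotalSpace ℂ L)] [FiberBundle ℂ L] [VectorBundle ℂ ℂ L]
  [ContMDiffVectorBundle ω ℂ L 𝓘(ℂ, EX)]
  {E : Type*} [NormedAddCommGroup E] [NormedSpace ℂ E]
  {B : Type*} [TopologicalSpace B] [ChartedSpace E B] [IsManifold 𝓘(ℂ, E) ω B]
  {f : ContMDiffMap 𝓘(ℂ, E) 𝓘(ℂ, EX) B X ω}

/-- The coordinate change multiplies the fibre coordinate by the holomorphic transition function of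
`L^*`. Scalars are restricted on that factor, a function on `B`, and the product is then formed over
the reals. -/
theorem contMDiffOn_real_slitTriv_trans (x₀ x₁ : X) :
    ContMDiffOn (𝓘(ℝ, E).prod 𝓘(ℝ, ℂ)) (𝓘(ℝ, E).prod 𝓘(ℝ, ℂ)) ∞
      ((slitTriv (L := L) (f := f) x₀).symm.trans (slitTriv x₁))
      ((slitTriv (L := L) (f := f) x₀).symm.trans (slitTriv x₁)).source := by
  rw [slitTriv_trans_source]
  have h1 : ContMDiffOn 𝓘(ℂ, E) 𝓘(ℂ, ℂ) ω (fun b : B => lineTransition L x₀ x₁ (f b))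
      {b | f b ∈ (trivializationAt ℂ L x₀).baseSet ∩ (trivializationAt ℂ L x₁).baseSet} :=
    (contMDiffOn_lineTransition (L := L) (EX := EX) x₀ x₁).comp f.contMDiff.contMDiffOn
      (fun _ h => h)
  have h2 : ContMDiffOn (𝓘(ℝ, E).prod 𝓘(ℝ, ℂ)) 𝓘(ℝ, ℂ) ∞
      (fun q : B × ℂ => lineTransition L x₀ x₁ (f q.1))
      {q | f q.1 ∈ (trivializationAt ℂ L x₀).baseSet ∩ (trivializationAt ℂ L x₁).baseSet ∧
        q.2 ≠ 0} :=
    (contMDiffOn_restrictScalars h1).comp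
      (contMDiff_fst (I := 𝓘(ℝ, E)) (J := 𝓘(ℝ, ℂ))).contMDiffOn (fun _ h => h.1)
  have h3 : ContDiff ℝ ∞ (fun p : ℂ × ℂ => p.1 * p.2) := contDiff_fst.mul contDiff_snd
  have h4 := h3.contMDiff.comp_contMDiffOn
    ((contMDiff_snd (I := 𝓘(ℝ, E)) (J := 𝓘(ℝ, ℂ))).contMDiffOn.prodMk_space h2)
  refine ((contMDiff_fst (I := 𝓘(ℝ, E)) (J := 𝓘(ℝ, ℂ))).contMDiffOn.prodMk h4).congr ?_
  intro q hq
  have hq' : q ∈ (slitTriv (L := L) (f := f) x₀).target := ⟨hq.1.1, hq.2⟩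
  rw [PartialEquiv.coe_trans, Function.comp_apply, slitTriv_symm x₀ hq']
  exact Prod.ext rfl (lineCoord_ofLineCoord' x₀ x₁ (f q.1) q.2)

/-- The projective bundle is only a real manifold, so the differential of `Slit.toRProj` requires
the real structure on its source. -/
instance : IsManifold (𝓘(ℝ, E).prod 𝓘(ℝ, ℂ)) ∞ (Slit L f) :=
  have := isManifold_real E B
  isManifold_comp _ _ (B × ℂ) (Slit L f) (slitCore L f) (by
    rintro _ ⟨x₀, rfl⟩ _ ⟨x₁, rfl⟩
    exact contMDiffOn_real_slitTriv_trans x₀ x₁)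

theorem isOpen_slitTriv_source (x₀ : X) : IsOpen (slitTriv (L := L) (f := f) x₀).source :=
  (slitCore L f).open_source' ⟨x₀, rfl⟩

theorem isOpen_slitTriv_target (x₀ : X) : IsOpen (slitTriv (L := L) (f := f) x₀).target :=
  (slitCore L f).open_target ⟨x₀, rfl⟩

theorem contMDiffOn_slitTriv (x₀ : X) :
    ContMDiffOn (𝓘(ℝ, E).prod 𝓘(ℝ, ℂ)) (𝓘(ℝ, E).prod 𝓘(ℝ, ℂ)) ∞
      (slitTriv (L := L) (f := f) x₀) (slitTriv (L := L) (f := f) x₀).source :=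
  have := isManifold_real E B
  (contMDiffOn_core _ _ (slitCore L f) inferInstance ⟨x₀, rfl⟩).2.2.1

theorem contMDiffOn_slitTriv_symm (x₀ : X) :
    ContMDiffOn (𝓘(ℝ, E).prod 𝓘(ℝ, ℂ)) (𝓘(ℝ, E).prod 𝓘(ℝ, ℂ)) ∞
      (slitTriv (L := L) (f := f) x₀).symm (slitTriv (L := L) (f := f) x₀).target :=
  have := isManifold_real E B
  (contMDiffOn_core _ _ (slitCore L f) inferInstance ⟨x₀, rfl⟩).2.2.2

theorem contMDiffOn_complex_slitTriv (x₀ : X) :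
    ContMDiffOn (𝓘(ℂ, E).prod 𝓘(ℂ, ℂ)) (𝓘(ℂ, E).prod 𝓘(ℂ, ℂ)) ω
      (slitTriv (L := L) (f := f) x₀) (slitTriv (L := L) (f := f) x₀).source :=
  (contMDiffOn_core _ _ (slitCore L f) inferInstance ⟨x₀, rfl⟩).2.2.1

theorem isOpen_rprojTriv_source (x₀ : X) (c : ℂ) :
    IsOpen (rprojTriv (L := L) (f := f) x₀ c).source :=
  (rprojCore L f).open_source' ⟨(x₀, c), rfl⟩

theorem isOpen_rprojTriv_target (x₀ : X) (c : ℂ) :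
    IsOpen (rprojTriv (L := L) (f := f) x₀ c).target :=
  (rprojCore L f).open_target ⟨(x₀, c), rfl⟩

theorem contMDiffOn_rprojTriv (x₀ : X) (c : ℂ) :
    ContMDiffOn (𝓘(ℝ, E).prod 𝓘(ℝ, ℝ)) (𝓘(ℝ, E).prod 𝓘(ℝ, ℝ)) ∞
      (rprojTriv (L := L) (f := f) x₀ c) (rprojTriv (L := L) (f := f) x₀ c).source :=
  have := isManifold_real E B
  (contMDiffOn_core _ _ (rprojCore L f) inferInstance ⟨(x₀, c), rfl⟩).2.2.1

theorem contMDiffOn_rprojTriv_symm (x₀ : X) (c : ℂ) :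
    ContMDiffOn (𝓘(ℝ, E).prod 𝓘(ℝ, ℝ)) (𝓘(ℝ, E).prod 𝓘(ℝ, ℝ)) ∞
      (rprojTriv (L := L) (f := f) x₀ c).symm (rprojTriv (L := L) (f := f) x₀ c).target :=
  have := isManifold_real E B
  (contMDiffOn_core _ _ (rprojCore L f) inferInstance ⟨(x₀, c), rfl⟩).2.2.2

end Slit

/-! ### Smoothness criteria for maps into and out of the slit and projective bundles -/

section Maps

variable {EX : Type*} [NormedAddCommGroup EX] [NormedSpace ℂ EX]
  {X : Type*} [TopologicalSpace X] [ChartedSpace EX X]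
  {L : X → Type*} [∀ x, AddCommGroup (L x)] [∀ x, Module ℂ (L x)] [∀ x, TopologicalSpace (L x)]
  [TopologicalSpace (TotalSpace ℂ L)] [FiberBundle ℂ L] [VectorBundle ℂ ℂ L]
  [ContMDiffVectorBundle ω ℂ L 𝓘(ℂ, EX)]
  {E : Type*} [NormedAddCommGroup E] [NormedSpace ℂ E]
  {B : Type*} [TopologicalSpace B] [ChartedSpace E B] [IsManifold 𝓘(ℂ, E) ω B]
  {f : ContMDiffMap 𝓘(ℂ, E) 𝓘(ℂ, EX) B X ω}
  {F : Type*} [NormedAddCommGroup F] [NormedSpace ℝ F] {K : Type*} [TopologicalSpace K]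
  {J : ModelWithCorners ℝ F K} {N : Type*} [TopologicalSpace N] [ChartedSpace K N]

theorem Slit.contMDiff_base :
    ContMDiff (𝓘(ℝ, E).prod 𝓘(ℝ, ℂ)) 𝓘(ℝ, E) ∞ (Slit.base : Slit L f → B) := by
  intro p
  have hp : p ∈ (slitTriv (L := L) (f := f) (f p.base)).source :=
    FiberBundle.mem_baseSet_trivializationAt' _
  exact contMDiff_fst.contMDiffAt.comp p
    ((contMDiffOn_slitTriv (f p.base)).contMDiffAt ((isOpen_slitTriv_source _).mem_nhds hp))

theorem Slit.contMDiff_complex_base :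
    ContMDiff (𝓘(ℂ, E).prod 𝓘(ℂ, ℂ)) 𝓘(ℂ, E) ω (Slit.base : Slit L f → B) := by
  intro p
  have hp : p ∈ (slitTriv (L := L) (f := f) (f p.base)).source :=
    FiberBundle.mem_baseSet_trivializationAt' _
  exact contMDiff_fst.contMDiffAt.comp p
    ((contMDiffOn_complex_slitTriv (f p.base)).contMDiffAt
      ((isOpen_slitTriv_source _).mem_nhds hp))

theorem RProj.exists_mem_source (z : RProj L f) :
    ∃ c, z ∈ (rprojTriv (L := L) (f := f) (f z.base) c).source :=
  ⟨_, (rprojCore L f).mem_chart_source z⟩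

theorem RProj.contMDiff_base :
    ContMDiff (𝓘(ℝ, E).prod 𝓘(ℝ, ℝ)) 𝓘(ℝ, E) ∞ (RProj.base : RProj L f → B) := by
  intro p
  obtain ⟨c, hp⟩ := p.exists_mem_source
  exact contMDiff_fst.contMDiffAt.comp p
    ((contMDiffOn_rprojTriv (f p.base) c).contMDiffAt ((isOpen_rprojTriv_source _ _).mem_nhds hp))

/-- A map into the projective bundle is smooth if it is smooth in one trivialization. -/
theorem contMDiffWithinAt_rproj {Φ : N → RProj L f} {s : Set N} {x : N} (x₀ : X) (c : ℂ)
    (hx : Φ x ∈ (rprojTriv (L := L) (f := f) x₀ c).source)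
    (hs : ∀ᶠ y in 𝓝[s] x, Φ y ∈ (rprojTriv (L := L) (f := f) x₀ c).source)
    (h : ContMDiffWithinAt J (𝓘(ℝ, E).prod 𝓘(ℝ, ℝ)) ∞ (fun y => rprojTriv x₀ c (Φ y)) s x) :
    ContMDiffWithinAt J (𝓘(ℝ, E).prod 𝓘(ℝ, ℝ)) ∞ Φ s x := by
  have h1 : ContMDiffAt (𝓘(ℝ, E).prod 𝓘(ℝ, ℝ)) (𝓘(ℝ, E).prod 𝓘(ℝ, ℝ)) ∞
      (rprojTriv (L := L) (f := f) x₀ c).symm (rprojTriv x₀ c (Φ x)) :=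
    (contMDiffOn_rprojTriv_symm x₀ c).contMDiffAt ((isOpen_rprojTriv_target _ _).mem_nhds
      (PartialEquiv.map_source _ hx))
  refine (h1.comp_contMDiffWithinAt x h).congr_of_eventuallyEq ?_ ?_
  · filter_upwards [hs] with y hy
    exact ((rprojTriv x₀ c).left_inv hy).symm
  · exact ((rprojTriv x₀ c).left_inv hx).symm

/-- A map into the slit line bundle is smooth if it is smooth in one trivialization. -/
theorem contMDiffAt_slit {Φ : N → Slit L f} {x : N} (x₀ : X)
    (hx : ∀ᶠ y in 𝓝 x, Φ y ∈ (slitTriv (L := L) (f := f) x₀).source)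
    (h : ContMDiffAt J (𝓘(ℝ, E).prod 𝓘(ℝ, ℂ)) ∞ (fun y => slitTriv x₀ (Φ y)) x) :
    ContMDiffAt J (𝓘(ℝ, E).prod 𝓘(ℝ, ℂ)) ∞ Φ x := by
  have h1 : ContMDiffAt (𝓘(ℝ, E).prod 𝓘(ℝ, ℂ)) (𝓘(ℝ, E).prod 𝓘(ℝ, ℂ)) ∞
      (slitTriv (L := L) (f := f) x₀).symm (slitTriv x₀ (Φ x)) :=
    (contMDiffOn_slitTriv_symm x₀).contMDiffAt ((isOpen_slitTriv_target _).mem_nhds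
      (PartialEquiv.map_source _ hx.self_of_nhds))
  refine (h1.comp x h).congr_of_eventuallyEq ?_
  filter_upwards [hx] with y hy
  exact ((slitTriv x₀).left_inv hy).symm

theorem contDiffOn_slope (c : ℂ) : ContDiffOn ℝ ∞ (slope c) {w | (w / c).re ≠ 0} := by
  have h : ContDiff ℝ ∞ (fun w : ℂ => w / c) := by
    simp only [div_eq_mul_inv]
    exact contDiff_id.mul contDiff_const
  have h1 : ContDiff ℝ ∞ (fun w : ℂ => (w / c).im) := Complex.imCLM.contDiff.comp h
  have h2 : ContDiff ℝ ∞ (fun w : ℂ => (w / c).re) := Complex.reCLM.contDiff.comp h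
  exact h1.contDiffOn.div h2.contDiffOn (fun _ hw => hw)

theorem isOpen_re_div_ne_zero (c : ℂ) : IsOpen {w : ℂ | (w / c).re ≠ 0} :=
  isOpen_ne.preimage (Complex.continuous_re.comp (continuous_id.div_const c))

/-- The representative chosen in the line of `p` is a nonzero real multiple of `p.covec`, and
neither the domain condition nor the slope sees such a factor. -/
theorem toRProj_mem_source_iff (x₀ : X) (c : ℂ) (p : Slit L f) :
    p.toRProj ∈ (rprojTriv (L := L) (f := f) x₀ c).source ↔
      p ∈ (slitTriv (L := L) (f := f) x₀).source ∧
        (((slitTriv (L := L) (f := f) x₀) p).2 / c).re ≠ 0 := by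
  obtain ⟨r, hr, h⟩ := lineCoord_rep_mk x₀ (f p.base) p.ne_zero
  refine and_congr Iff.rfl ?_
  change (lineCoord L x₀ (f p.base) (Projectivization.mk ℝ p.covec p.ne_zero).rep / c).re ≠ 0 ↔ _
  rw [h, mul_div_assoc, Complex.re_ofReal_mul, mul_ne_zero_iff]
  exact and_iff_right hr

theorem rprojTriv_toRProj (x₀ : X) (c : ℂ) (p : Slit L f) :
    rprojTriv x₀ c p.toRProj = ((slitTriv x₀ p).1, slope c (slitTriv x₀ p).2) := by
  obtain ⟨r, hr, h⟩ := lineCoord_rep_mk x₀ (f p.base) p.ne_zero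
  refine Prod.ext rfl ?_
  change slope c (lineCoord L x₀ (f p.base) (Projectivization.mk ℝ p.covec p.ne_zero).rep) = _
  rw [h, slope_real_smul _ _ hr]
  rfl

/-- In trivializations the projection is `(b, w) ↦ (b, slope c w)`, a quotient of real-linear
functions of `w`. -/
theorem Slit.contMDiff_toRProj :
    ContMDiff (𝓘(ℝ, E).prod 𝓘(ℝ, ℂ)) (𝓘(ℝ, E).prod 𝓘(ℝ, ℝ)) ∞
      (Slit.toRProj : Slit L f → RProj L f) := by
  intro p
  obtain ⟨c, hc⟩ := p.toRProj.exists_mem_source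
  have hp := (toRProj_mem_source_iff _ c p).1 hc
  have h1 : ContMDiffAt (𝓘(ℝ, E).prod 𝓘(ℝ, ℂ)) (𝓘(ℝ, E).prod 𝓘(ℝ, ℂ)) ∞
      (slitTriv (L := L) (f := f) (f p.base)) p :=
    (contMDiffOn_slitTriv (f p.base)).contMDiffAt ((isOpen_slitTriv_source _).mem_nhds hp.1)
  have h2 : ContMDiffAt 𝓘(ℝ, ℂ) 𝓘(ℝ, ℝ) ∞ (slope c)
      (slitTriv (L := L) (f := f) (f p.base) p).2 :=
    ((contDiffOn_slope c).contDiffAt ((isOpen_re_div_ne_zero c).mem_nhds hp.2)).contMDiffAt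
  have h3 : ContMDiffAt (𝓘(ℝ, E).prod 𝓘(ℝ, ℂ)) 𝓘(ℝ, ℂ) ∞
      (fun q => (slitTriv (L := L) (f := f) (f p.base) q).2) p :=
    contMDiff_snd.contMDiffAt.comp p h1
  refine contMDiffWithinAt_rproj (f p.base) c hc ?_ ?_
  · rw [nhdsWithin_univ]
    filter_upwards [(isOpen_slitTriv_source _).mem_nhds hp.1,
      h3.continuousAt.preimage_mem_nhds ((isOpen_re_div_ne_zero c).mem_nhds hp.2)] with q hq hq'
    exact (toRProj_mem_source_iff _ c q).2 ⟨hq, hq'⟩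
  · simp only [rprojTriv_toRProj]
    exact (contMDiff_fst.contMDiffAt.comp p h1).prodMk (h2.comp p h3)

theorem Slit.toRProj_surjective : Function.Surjective (Slit.toRProj : Slit L f → RProj L f) := by
  intro z
  refine ⟨⟨z.base, z.line.rep, z.line.rep_nonzero⟩, ?_⟩
  simp [Slit.toRProj, Projectivization.mk_rep]

/-- Local sections of the projection of the slit line bundle to the projective bundle. -/
theorem exists_section_toRProj (p : Slit L f) :
    ∃ σ : RProj L f → Slit L f,
      ContMDiffAt (𝓘(ℝ, E).prod 𝓘(ℝ, ℝ)) (𝓘(ℝ, E).prod 𝓘(ℝ, ℂ)) ∞ σ p.toRProj ∧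
      σ p.toRProj = p ∧ ∀ᶠ z in 𝓝 p.toRProj, (σ z).toRProj = z := by
  set x₀ := f p.base
  -- With the coordinate of `p` itself as reference, the line of `p` has slope `0`.
  set c := (slitTriv (L := L) (f := f) x₀ p).2 with hc
  have hp : p ∈ (slitTriv (L := L) (f := f) x₀).source :=
    FiberBundle.mem_baseSet_trivializationAt' _
  have hc0 : c ≠ 0 := lineCoord_ne_zero hp p.ne_zero
  have hz : p.toRProj ∈ (rprojTriv (L := L) (f := f) x₀ c).source := by
    rw [toRProj_mem_source_iff]
    refine ⟨hp, ?_⟩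
    rw [← hc, div_self hc0]
    simp
  -- The section in coordinates: the line of slope `t` is spanned by `(1 + i t) c`, which at `t = 0`
  -- is the coordinate of `p`.
  let τ : B × ℝ → B × ℂ := fun q => (q.1, (1 + q.2 * Complex.I) * c)
  have hτ : ContMDiff (𝓘(ℝ, E).prod 𝓘(ℝ, ℝ)) (𝓘(ℝ, E).prod 𝓘(ℝ, ℂ)) ∞ τ := by
    have h3 : ContDiff ℝ ∞ (fun t : ℝ => (1 + t * Complex.I) * c) :=
      ((contDiff_const.add (Complex.ofRealCLM.contDiff.mul contDiff_const)).mul contDiff_const)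
    exact contMDiff_fst.prodMk (h3.contMDiff.comp contMDiff_snd)
  have hτt : ∀ q ∈ (rprojTriv (L := L) (f := f) x₀ c).target,
      τ q ∈ (slitTriv (L := L) (f := f) x₀).target := fun q hq =>
    ⟨hq.1, mul_ne_zero (one_add_mul_I_ne_zero q.2) hq.2⟩
  have hcoord : rprojTriv x₀ c p.toRProj = (p.base, 0) := by
    rw [rprojTriv_toRProj, ← hc]
    refine Prod.ext rfl ?_
    simp [slope, div_self hc0]
  refine ⟨fun z => (slitTriv x₀).symm (τ (rprojTriv x₀ c z)), ?_, ?_, ?_⟩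
  · have h1 := (contMDiffOn_rprojTriv (L := L) (f := f) x₀ c).contMDiffAt
      ((isOpen_rprojTriv_source _ _).mem_nhds hz)
    have h2 := (contMDiffOn_slitTriv_symm (L := L) (f := f) x₀).contMDiffAt
      ((isOpen_slitTriv_target _).mem_nhds (hτt _ (PartialEquiv.map_source _ hz)))
    exact h2.comp p.toRProj (hτ.contMDiffAt.comp p.toRProj h1)
  · have : τ (p.base, 0) = slitTriv x₀ p := by
      refine Prod.ext rfl ?_
      simp [τ, hc]
    change (slitTriv x₀).symm (τ (rprojTriv x₀ c p.toRProj)) = p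
    rw [hcoord, this, PartialEquiv.left_inv _ hp]
  · filter_upwards [(isOpen_rprojTriv_source _ _).mem_nhds hz] with z hz
    have h1 := PartialEquiv.map_source _ hz
    have h2 : (slitTriv (L := L) (f := f) x₀) ((slitTriv x₀).symm (τ (rprojTriv x₀ c z))) =
      τ (rprojTriv x₀ c z) := PartialEquiv.right_inv _ (hτt _ h1)
    refine (rprojTriv x₀ c).injOn ?_ hz ?_
    · rw [toRProj_mem_source_iff, h2]
      refine ⟨PartialEquiv.map_target _ (hτt _ h1), ?_⟩
      change ((1 + _ * Complex.I) * c / c).re ≠ 0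
      rw [mul_div_cancel_right₀ _ hc0]
      simp
    · rw [rprojTriv_toRProj, h2]
      exact Prod.ext rfl (slope_line hc0 _)

/-- Smoothness of maps out of the projective bundle can be tested on the slit line bundle. -/
theorem contMDiffAt_of_comp_toRProj {Φ : RProj L f → N} {p : Slit L f}
    (h : ContMDiffAt (𝓘(ℝ, E).prod 𝓘(ℝ, ℂ)) J ∞ (fun q : Slit L f => Φ q.toRProj) p) :
    ContMDiffAt (𝓘(ℝ, E).prod 𝓘(ℝ, ℝ)) J ∞ Φ p.toRProj := by
  obtain ⟨σ, h1, h2, h3⟩ := exists_section_toRProj p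
  rw [← h2] at h
  refine (h.comp p.toRProj h1).congr_of_eventuallyEq ?_
  filter_upwards [h3] with z hz
  exact congrArg Φ hz.symm

end Maps

/-! ### Complex differentials as real differentials -/

section RestrictScalars

variable {E F : Type*} [NormedAddCommGroup E] [NormedSpace ℂ E]
  [NormedAddCommGroup F] [NormedSpace ℂ F]
  {M : Type*} [TopologicalSpace M] [ChartedSpace E M]
  {N : Type*} [TopologicalSpace N] [ChartedSpace F N]

theorem hasMFDerivAt_real {f : M → N} {x : M} {f' : E →L[ℂ] F}
    (h : HasMFDerivAt 𝓘(ℂ, E) 𝓘(ℂ, F) f x f') :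
    HasMFDerivAt 𝓘(ℝ, E) 𝓘(ℝ, F) f x (f'.restrictScalars ℝ) :=
  ⟨h.1, h.2.restrictScalars ℝ⟩

theorem hasMFDerivWithinAt_real_prod {f : M × M → N} {s : Set (M × M)} {x : M × M}
    {f' : E × E →L[ℂ] F} (h : HasMFDerivWithinAt (𝓘(ℂ, E).prod 𝓘(ℂ, E)) 𝓘(ℂ, F) f s x f') :
    HasMFDerivWithinAt (𝓘(ℝ, E).prod 𝓘(ℝ, E)) 𝓘(ℝ, F) f s x (f'.restrictScalars ℝ) :=
  ⟨h.1, h.2.restrictScalars ℝ⟩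

theorem hasMFDerivAt_real_prod {P : Type*} [TopologicalSpace P] [ChartedSpace (ModelProd E ℂ) P]
    {f : P → N} {x : P}
    {f' : E × ℂ →L[ℂ] F} (h : HasMFDerivAt (𝓘(ℂ, E).prod 𝓘(ℂ, ℂ)) 𝓘(ℂ, F) f x f') :
    HasMFDerivAt (𝓘(ℝ, E).prod 𝓘(ℝ, ℂ)) 𝓘(ℝ, F) f x (f'.restrictScalars ℝ) :=
  ⟨h.1, h.2.restrictScalars ℝ⟩

end RestrictScalars

/-! ### Curves with prescribed velocity in manifolds and in fibre products -/

section CurveInChart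

variable {𝕜 : Type*} [NontriviallyNormedField 𝕜] {E : Type*} [NormedAddCommGroup E]
  [NormedSpace 𝕜 E] {H : Type*} [TopologicalSpace H] {I : ModelWithCorners 𝕜 E H} [I.Boundaryless]
  {M : Type*} [TopologicalSpace M] [ChartedSpace H M]

/-- A curve in a chart with velocity `v` defines a curve in the manifold with velocity `v`. -/
theorem hasMFDerivAt_extChartAt_symm_comp {x : M} {γ : 𝕜 → E} {γ' : 𝕜 →L[𝕜] E}
    (h0 : γ 0 = extChartAt I x x) (h : HasFDerivAt γ γ' 0) :
    HasMFDerivAt 𝓘(𝕜, 𝕜) I (fun τ => (extChartAt I x).symm (γ τ)) 0 γ' := by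
  have hx : (extChartAt I x).symm (γ 0) = x := by rw [h0, extChartAt_to_inv]
  have hc : ContinuousAt (fun τ => (extChartAt I x).symm (γ τ)) 0 := by
    refine ContinuousAt.comp ?_ h.continuousAt
    rw [h0]
    exact continuousAt_extChartAt_symm x
  refine ⟨hc, ?_⟩
  simp only [writtenInExtChartAt, extChartAt_model_space_eq_id, hx]
  refine (h.congr_of_eventuallyEq ?_).hasFDerivWithinAt
  have : (extChartAt I x).target ∈ 𝓝 (γ 0) := by rw [h0]; exact extChartAt_target_mem_nhds x
  filter_upwards [h.continuousAt this] with τ hτ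
  exact (extChartAt I x).right_inv hτ

end CurveInChart

section Curves

variable {E₁ E₂ E₃ : Type*} [NormedAddCommGroup E₁] [NormedSpace ℝ E₁]
  [NormedAddCommGroup E₂] [NormedSpace ℝ E₂] [NormedAddCommGroup E₃] [NormedSpace ℝ E₃]
  {H₁ H₂ H₃ : Type*} [TopologicalSpace H₁] [TopologicalSpace H₂] [TopologicalSpace H₃]
  {I₁ : ModelWithCorners ℝ E₁ H₁} {I₂ : ModelWithCorners ℝ E₂ H₂} {I₃ : ModelWithCorners ℝ E₃ H₃}
  [I₁.Boundaryless] [I₂.Boundaryless] [I₃.Boundaryless]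
  {M₁ M₂ M₃ : Type*} [TopologicalSpace M₁] [ChartedSpace H₁ M₁]
  [TopologicalSpace M₂] [ChartedSpace H₂ M₂] [TopologicalSpace M₃] [ChartedSpace H₃ M₃]

/-- The implicit function theorem needs strict differentiability, which a `C¹` map has in charts
when there is no boundary. -/
theorem hasStrictFDerivAt_writtenInExtChartAt {f : M₁ → M₃} {x : M₁}
    (hf : ContMDiffAt I₁ I₃ 1 f x) :
    HasStrictFDerivAt (writtenInExtChartAt I₁ I₃ x f) (mfderiv I₁ I₃ f x : E₁ →L[ℝ] E₃)
      (extChartAt I₁ x x) := by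
  have h := (contMDiffAt_iff.1 hf).2
  rw [I₁.range_eq_univ, contDiffWithinAt_univ] at h
  have h2 := h.hasStrictFDerivAt (by simp)
  rw [hf.mdifferentiableAt (by simp) |>.mfderiv, I₁.range_eq_univ, fderivWithin_univ]
  exact h2

/-- Tangent vectors to a fibre product `{f = g}`, with `g` a submersion, are velocities of curves
in the fibre product. -/
theorem exists_curve_fiberProduct [CompleteSpace E₁] [CompleteSpace E₂] [FiniteDimensional ℝ E₃]
    {f : M₁ → M₃} {g : M₂ → M₃} {x : M₁} {y : M₂}
    (hf : ContMDiffAt I₁ I₃ 1 f x) (hg : ContMDiffAt I₂ I₃ 1 g y) (hxy : f x = g y)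
    (hs : Function.Surjective (mfderiv I₂ I₃ g y)) {V : E₁} {W : E₂}
    (hVW : (mfderiv I₁ I₃ f x V : E₃) = (mfderiv I₂ I₃ g y W : E₃)) :
    ∃ c : ℝ → M₁ × M₂, c 0 = (x, y) ∧ (∀ᶠ τ in 𝓝 0, f (c τ).1 = g (c τ).2) ∧
      HasMFDerivAt 𝓘(ℝ, ℝ) (I₁.prod I₂) c 0
        (ContinuousLinearMap.toSpanSingleton ℝ ((V, W) : E₁ × E₂)) := by
  have hF := hasStrictFDerivAt_writtenInExtChartAt hf
  have hG := hasStrictFDerivAt_writtenInExtChartAt hg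
  set F := writtenInExtChartAt I₁ I₃ x f with hFd
  set G := writtenInExtChartAt I₂ I₃ y g with hGd
  set F' : E₁ →L[ℝ] E₃ := mfderiv I₁ I₃ f x
  set G' : E₂ →L[ℝ] E₃ := mfderiv I₂ I₃ g y
  -- Both maps must be read in the same chart of `M₃` for their difference to make sense.
  have hG' : G = extChartAt I₃ (f x) ∘ g ∘ (extChartAt I₂ y).symm := by rw [hxy]; rfl
  let a₀ : E₁ × E₂ := (extChartAt I₁ x x, extChartAt I₂ y y)
  -- In charts the fibre product is the zero set of `D`, and `(V, W)` lies in the kernel of its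
  -- derivative. The derivative is onto because `g` is a submersion.
  let D : E₁ × E₂ → E₃ := fun a => F a.1 - G a.2
  let D' : E₁ × E₂ →L[ℝ] E₃ := F' ∘L .fst ℝ E₁ E₂ - G' ∘L .snd ℝ E₁ E₂
  have hD : HasStrictFDerivAt D D' a₀ :=
    (hF.comp a₀ hasStrictFDerivAt_fst).sub (hG.comp a₀ hasStrictFDerivAt_snd)
  have hr : D'.range = ⊤ := by
    rw [LinearMap.range_eq_top]
    intro w
    obtain ⟨b, hb⟩ := hs (-w : E₃)
    refine ⟨(0, b), ?_⟩
    change F' 0 - G' b = w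
    have hb' : G' b = -w := hb
    rw [map_zero, hb']
    simp
  let k : D'.ker := ⟨(V, W), by
    change F' V - G' W = 0
    exact sub_eq_zero.2 hVW⟩
  have hD0 : D a₀ = 0 := by
    simp [D, a₀, hFd, hGd, writtenInExtChartAt, hxy]
  -- `ψ` parametrizes the level set through `a₀` by the kernel of `D'`, with the inclusion as
  -- derivative at `0`. The image of the line `τ • k` is then a curve in the fibre product with
  -- velocity `(V, W)`.
  let ψ := hD.implicitFunction D D' hr (D a₀)
  have hψ : HasStrictFDerivAt ψ D'.ker.subtypeL 0 := hD.to_implicitFunction hr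
  have hψ0 : ψ 0 = a₀ := hD.implicitFunction_apply_image hr
  let γ : ℝ → E₁ × E₂ := fun τ => ψ (τ • k)
  have hl : HasFDerivAt (fun τ : ℝ => τ • k) (ContinuousLinearMap.toSpanSingleton ℝ k) 0 :=
    (ContinuousLinearMap.toSpanSingleton ℝ k).hasFDerivAt
  have hγ0 : γ 0 = a₀ := by simp [γ, hψ0]
  have hγ : HasFDerivAt γ (ContinuousLinearMap.toSpanSingleton ℝ ((V, W) : E₁ × E₂)) 0 := by
    have h1 : HasFDerivAt ψ D'.ker.subtypeL ((0 : ℝ) • k) := by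
      rw [zero_smul]; exact hψ.hasFDerivAt
    refine (h1.comp (0 : ℝ) hl).congr_fderiv ?_
    ext <;> simp [k]
  have hDγ : ∀ᶠ τ in 𝓝 (0 : ℝ), D (γ τ) = 0 := by
    have h1 := hD.map_implicitFunction_eq hr
    have h2 : Tendsto (fun τ : ℝ => (D a₀, τ • k)) (𝓝 0) (𝓝 (D a₀, 0)) := by
      refine tendsto_const_nhds.prodMk_nhds ?_
      have := hl.continuousAt.tendsto
      rwa [zero_smul] at this
    filter_upwards [h2.eventually h1] with τ hτ
    exact hτ.trans hD0
  have h₁ : HasMFDerivAt 𝓘(ℝ, ℝ) I₁ (fun τ => (extChartAt I₁ x).symm (γ τ).1) 0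
      (ContinuousLinearMap.toSpanSingleton ℝ V) := by
    refine hasMFDerivAt_extChartAt_symm_comp (congrArg Prod.fst hγ0) ?_
    exact hγ.fst.congr_fderiv (ContinuousLinearMap.ext fun _ => rfl)
  have h₂ : HasMFDerivAt 𝓘(ℝ, ℝ) I₂ (fun τ => (extChartAt I₂ y).symm (γ τ).2) 0
      (ContinuousLinearMap.toSpanSingleton ℝ W) := by
    refine hasMFDerivAt_extChartAt_symm_comp (congrArg Prod.snd hγ0) ?_
    exact hγ.snd.congr_fderiv (ContinuousLinearMap.ext fun _ => rfl)
  have e₁ : (extChartAt I₁ x).symm (γ 0).1 = x := by rw [hγ0]; exact extChartAt_to_inv x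
  have e₂ : (extChartAt I₂ y).symm (γ 0).2 = y := by rw [hγ0]; exact extChartAt_to_inv y
  refine ⟨fun τ => ((extChartAt I₁ x).symm (γ τ).1, (extChartAt I₂ y).symm (γ τ).2),
    Prod.ext e₁ e₂, ?_, ?_⟩
  -- For small `τ` both image points lie in the domain of one chart, whose injectivity turns `D (γ
  -- τ) = 0` into an equality in `M₃`.
  · have hS := extChartAt_source_mem_nhds (I := I₃) (f x)
    have hc₁ : ContinuousAt (fun τ => f ((extChartAt I₁ x).symm (γ τ).1)) 0 :=
      ContinuousAt.comp (by simp only [e₁]; exact hf.continuousAt) h₁.1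
    have hc₂ : ContinuousAt (fun τ => g ((extChartAt I₂ y).symm (γ τ).2)) 0 :=
      ContinuousAt.comp (by simp only [e₂]; exact hg.continuousAt) h₂.1
    have hS₁ := hc₁.preimage_mem_nhds (t := (extChartAt I₃ (f x)).source) (by simpa only [e₁])
    have hS₂ := hc₂.preimage_mem_nhds (t := (extChartAt I₃ (f x)).source) (by
      simpa only [e₂, ← hxy])
    filter_upwards [hDγ, hS₁, hS₂] with τ hτ h₁ h₂
    refine (extChartAt I₃ (f x)).injOn h₁ h₂ ?_
    have h3 := sub_eq_zero.1 hτ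
    rw [hG'] at h3
    exact h3
  · exact (h₁.prodMk h₂).congr_mfderiv (ContinuousLinearMap.ext fun _ => rfl)

end Curves

/-! ### Holomorphic maps as real smooth maps -/

section RestrictScalars

variable {E F : Type*} [NormedAddCommGroup E] [NormedSpace ℂ E]
  [NormedAddCommGroup F] [NormedSpace ℂ F]
  {M : Type*} [TopologicalSpace M] [ChartedSpace E M]
  {N : Type*} [TopologicalSpace N] [ChartedSpace F N]

theorem contMDiffWithinAt_real {f : M → N} {s : Set M} {x : M}
    (h : ContMDiffWithinAt 𝓘(ℂ, E) 𝓘(ℂ, F) ω f s x) :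
    ContMDiffWithinAt 𝓘(ℝ, E) 𝓘(ℝ, F) ∞ f s x := by
  rw [contMDiffWithinAt_iff] at h ⊢
  exact ⟨h.1, (h.2.restrict_scalars ℝ).of_le le_top⟩

theorem contMDiff_real {f : M → N} (h : ContMDiff 𝓘(ℂ, E) 𝓘(ℂ, F) ω f) :
    ContMDiff 𝓘(ℝ, E) 𝓘(ℝ, F) ∞ f :=
  fun x => contMDiffWithinAt_real (h x)

theorem contMDiffWithinAt_real_prod {f : M × M → N} {s : Set (M × M)} {x : M × M}
    (h : ContMDiffWithinAt (𝓘(ℂ, E).prod 𝓘(ℂ, E)) 𝓘(ℂ, F) ω f s x) :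
    ContMDiffWithinAt (𝓘(ℝ, E).prod 𝓘(ℝ, E)) 𝓘(ℝ, F) ∞ f s x := by
  rw [contMDiffWithinAt_iff] at h ⊢
  exact ⟨h.1, (h.2.restrict_scalars ℝ).of_le le_top⟩

end RestrictScalars

/-! ### Smoothness of the structure maps of `Ĝ ⇉ M̂` -/

section Hat

variable {EX : Type*} [NormedAddCommGroup EX] [NormedSpace ℂ EX]
  {X : Type*} [TopologicalSpace X] [ChartedSpace EX X] [IsManifold 𝓘(ℂ, EX) ω X]
  {EG : Type*} [NormedAddCommGroup EG] [NormedSpace ℂ EG]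
  {G : Type*} [TopologicalSpace G] [ChartedSpace EG G] [IsManifold 𝓘(ℂ, EG) ω G]
  {Γ : LieGroupoid 𝓘(ℂ, EG) 𝓘(ℂ, EX) ω G X}
  {L : X → Type*} [∀ x, AddCommGroup (L x)] [∀ x, Module ℂ (L x)] [∀ x, TopologicalSpace (L x)]
  [TopologicalSpace (TotalSpace ℂ L)] [FiberBundle ℂ L] [VectorBundle ℂ ℂ L]
  [ContMDiffVectorBundle ω ℂ L 𝓘(ℂ, EX)]
  {F : Type*} [NormedAddCommGroup F] [NormedSpace ℝ F] {K : Type*} [TopologicalSpace K]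
  {J : ModelWithCorners ℝ F K} {N : Type*} [TopologicalSpace N] [ChartedSpace K N]

/-- The fibre of `t^*L` over `g` is `L` at `t(g)`, so in matching trivializations the map is `(g, τ)
↦ (t(g), τ)`. -/
theorem contMDiff_tgtHat :
    ContMDiff (𝓘(ℝ, EG).prod 𝓘(ℝ, ℝ)) (𝓘(ℝ, EX).prod 𝓘(ℝ, ℝ)) ∞
      (tgtHat : ArrowHat Γ L → BaseHat Γ L) := by
  intro z
  obtain ⟨c, hz⟩ := z.exists_mem_source
  have h1 : ContMDiffAt (𝓘(ℝ, EG).prod 𝓘(ℝ, ℝ)) (𝓘(ℝ, EG).prod 𝓘(ℝ, ℝ)) ∞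
      (rprojTriv (L := L) (f := Γ.tgtMap) (Γ.tgt z.base) c) z :=
    (contMDiffOn_rprojTriv _ c).contMDiffAt ((isOpen_rprojTriv_source _ _).mem_nhds hz)
  refine contMDiffWithinAt_rproj (Γ.tgt z.base) c hz ?_ ?_
  · rw [nhdsWithin_univ]
    filter_upwards [(isOpen_rprojTriv_source _ _).mem_nhds hz] with y hy using hy
  · exact (((contMDiff_real Γ.contMDiff_tgt).comp RProj.contMDiff_base) z).prodMk
      (contMDiff_snd.contMDiffAt.comp z h1)

/-- A map into `Ĝ` is smooth if its components in `G` and in `M̂` are smooth. -/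
theorem contMDiffWithinAt_arrowHat {Φ : N → ArrowHat Γ L} {s : Set N} {x : N}
    (h1 : ContMDiffWithinAt J 𝓘(ℝ, EG) ∞ (fun y => (Φ y).base) s x)
    (h2 : ContMDiffWithinAt J (𝓘(ℝ, EX).prod 𝓘(ℝ, ℝ)) ∞ (fun y => tgtHat (Φ y)) s x) :
    ContMDiffWithinAt J (𝓘(ℝ, EG).prod 𝓘(ℝ, ℝ)) ∞ Φ s x := by
  obtain ⟨c, hz⟩ := (Φ x).exists_mem_source
  have hz' : tgtHat (Φ x) ∈ (rprojTriv (L := L) (f := idMap (EX := EX) X)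
    (Γ.tgt (Φ x).base) c).source := hz
  refine contMDiffWithinAt_rproj (Γ.tgt (Φ x).base) c hz ?_ ?_
  · filter_upwards [h2.continuousWithinAt.preimage_mem_nhdsWithin
      ((isOpen_rprojTriv_source _ _).mem_nhds hz')] with y hy using hy
  · have h3 : ContMDiffAt (𝓘(ℝ, EX).prod 𝓘(ℝ, ℝ)) (𝓘(ℝ, EX).prod 𝓘(ℝ, ℝ)) ∞
        (rprojTriv (L := L) (f := idMap (EX := EX) X) (Γ.tgt (Φ x).base) c) (tgtHat (Φ x)) :=
      (contMDiffOn_rprojTriv _ c).contMDiffAt ((isOpen_rprojTriv_source _ _).mem_nhds hz')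
    exact h1.prodMk (contMDiff_snd.contMDiffAt.comp_contMDiffWithinAt x
      (h3.comp_contMDiffWithinAt x h2))

/-- The map `(g, ε) ↦ ε ∘ g` covering the source map of `Ĝ`. -/
def srcTilde (A : LineAction Γ L) (p : ArrowTilde Γ L) : Slit L (idMap (EX := EX) X) :=
  ⟨Γ.src p.base, A.dual p.base p.covec,
    fun h => p.ne_zero (A.dual_injective p.base (h.trans (map_zero _).symm))⟩

theorem contMDiff_srcTilde (A : LineAction Γ L) :
    ContMDiff (𝓘(ℝ, EG).prod 𝓘(ℝ, ℂ)) (𝓘(ℝ, EX).prod 𝓘(ℝ, ℂ)) ∞ (srcTilde A) := by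
  intro p
  have hp : p ∈ (slitTriv (L := L) (f := Γ.tgtMap) (Γ.tgt p.base)).source :=
    FiberBundle.mem_baseSet_trivializationAt' _
  have hsrc : ContMDiff (𝓘(ℝ, EG).prod 𝓘(ℝ, ℂ)) 𝓘(ℝ, EX) ∞
      (fun q : ArrowTilde Γ L => Γ.src q.base) :=
    (contMDiff_real Γ.contMDiff_src).comp Slit.contMDiff_base
  have h1 : ContMDiffAt (𝓘(ℝ, EG).prod 𝓘(ℝ, ℂ)) (𝓘(ℝ, EG).prod 𝓘(ℝ, ℂ)) ∞
      (slitTriv (L := L) (f := Γ.tgtMap) (Γ.tgt p.base)) p :=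
    (contMDiffOn_slitTriv _).contMDiffAt ((isOpen_slitTriv_source _).mem_nhds hp)
  -- `k` is the `1 × 1` matrix of `g : L_{s(g)} → L_{t(g)}`; passing from `ε` to `ε ∘ g` multiplies
  -- the fibre coordinate by `k g`.
  let k : G → ℂ := fun g => ContinuousLinearMap.inCoordinates ℂ L ℂ L (Γ.src p.base) (Γ.src g)
    (Γ.tgt p.base) (Γ.tgt g) (A.act g : L (Γ.src g) →L[ℂ] L (Γ.tgt g)) 1
  have hk : ContMDiffAt 𝓘(ℝ, EG) 𝓘(ℝ, ℂ) ∞ k p.base :=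
    contMDiffWithinAt_real ((A.holomorphic p.base).clm_apply contMDiffAt_const)
  have h2 : ContMDiffAt (𝓘(ℝ, EG).prod 𝓘(ℝ, ℂ)) 𝓘(ℝ, ℂ) ∞
      (fun q : ArrowTilde Γ L =>
        (slitTriv (L := L) (f := Γ.tgtMap) (Γ.tgt p.base) q).2 * k q.base) p := by
    have h3 : ContDiff ℝ ∞ (fun p : ℂ × ℂ => p.1 * p.2) := contDiff_fst.mul contDiff_snd
    exact h3.contMDiff.contMDiffAt.comp p ((contMDiff_snd.contMDiffAt.comp p h1).prodMk_space
      (hk.comp p Slit.contMDiff_base.contMDiffAt))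
  refine contMDiffAt_slit (Γ.src p.base) ?_ ?_
  · exact hsrc.continuous.continuousAt.preimage_mem_nhds
      ((trivializationAt ℂ L (Γ.src p.base)).open_baseSet.mem_nhds
        (FiberBundle.mem_baseSet_trivializationAt' _))
  · refine (hsrc.contMDiffAt.prodMk h2).congr_of_eventuallyEq ?_
    filter_upwards [(isOpen_slitTriv_source _).mem_nhds hp] with q hq
    refine Prod.ext rfl ?_
    change lineCoord L (Γ.src p.base) (Γ.src q.base) (A.dual q.base q.covec) =
      lineCoord L (Γ.tgt p.base) (Γ.tgt q.base) q.covec * k q.base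
    conv_lhs => rw [← ofLineCoord_lineCoord hq q.covec]
    rfl

/-- The source map lifts to `srcTilde` on the slit bundles, where smoothness is tested. -/
theorem contMDiff_srcHat (A : LineAction Γ L) :
    ContMDiff (𝓘(ℝ, EG).prod 𝓘(ℝ, ℝ)) (𝓘(ℝ, EX).prod 𝓘(ℝ, ℝ)) ∞ (srcHat A) := by
  intro z
  obtain ⟨p, rfl⟩ := Slit.toRProj_surjective z
  exact contMDiffAt_of_comp_toRProj
    ((Slit.contMDiff_toRProj.comp (contMDiff_srcTilde A)).contMDiffAt)

/-- Here, and for the inverse and the product below, smoothness is checked on the components in `G`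
and in `M̂`. The latter is the target of the result, which the groupoid axioms give as the identity,
`srcHat`, and the target of the first factor respectively. -/
theorem contMDiff_unitHat (A : LineAction Γ L) :
    ContMDiff (𝓘(ℝ, EX).prod 𝓘(ℝ, ℝ)) (𝓘(ℝ, EG).prod 𝓘(ℝ, ℝ)) ∞ (groupoidHat A).unit := by
  intro p
  refine contMDiffWithinAt_arrowHat
    (((contMDiff_real Γ.contMDiff_unit).comp RProj.contMDiff_base) p) ?_
  have h : (fun q => tgtHat ((groupoidHat A).unit q)) = id := funext (groupoidHat A).tgt_unit
  rw [h]
  exact contMDiff_id p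

theorem contMDiff_invHat (A : LineAction Γ L) :
    ContMDiff (𝓘(ℝ, EG).prod 𝓘(ℝ, ℝ)) (𝓘(ℝ, EG).prod 𝓘(ℝ, ℝ)) ∞ (groupoidHat A).inv := by
  intro z
  refine contMDiffWithinAt_arrowHat
    (((contMDiff_real Γ.contMDiff_inv).comp RProj.contMDiff_base) z) ?_
  have h : (fun q => tgtHat ((groupoidHat A).inv q)) = srcHat A := funext (groupoidHat A).tgt_inv
  rw [h]
  exact contMDiff_srcHat A z

theorem contMDiffOn_mulHat (A : LineAction Γ L) :
    ContMDiffOn ((𝓘(ℝ, EG).prod 𝓘(ℝ, ℝ)).prod (𝓘(ℝ, EG).prod 𝓘(ℝ, ℝ)))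
      (𝓘(ℝ, EG).prod 𝓘(ℝ, ℝ)) ∞
      (fun q : ArrowHat Γ L × ArrowHat Γ L => (groupoidHat A).mul q.1 q.2)
      (groupoidHat A).composable := by
  intro q hq
  have hcomp : ∀ r ∈ (groupoidHat A).composable, Γ.src r.1.base = Γ.tgt r.2.base :=
    fun r hr => congrArg RProj.base hr
  refine contMDiffWithinAt_arrowHat ?_ ?_
  · have h1 := contMDiffWithinAt_real_prod (Γ.contMDiffOn_mul (q.1.base, q.2.base) (hcomp q hq))
    have h2 : ContMDiff ((𝓘(ℝ, EG).prod 𝓘(ℝ, ℝ)).prod (𝓘(ℝ, EG).prod 𝓘(ℝ, ℝ)))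
        (𝓘(ℝ, EG).prod 𝓘(ℝ, EG)) ∞
        (fun r : ArrowHat Γ L × ArrowHat Γ L => (r.1.base, r.2.base)) :=
      (RProj.contMDiff_base.comp contMDiff_fst).prodMk (RProj.contMDiff_base.comp contMDiff_snd)
    have h3 := h1.comp q (h2.contMDiffOn (s := (groupoidHat A).composable) q hq)
      (fun r hr => hcomp r hr)
    exact h3.congr (fun r hr => mulHat_base (hcomp r hr)) (mulHat_base (hcomp q hq))
  · exact ((contMDiff_tgtHat.comp contMDiff_fst) q |>.mono (Set.subset_univ _)).congr
      (fun r hr => tgtHat_mulHat (hcomp r hr)) (tgtHat_mulHat (hcomp q hq))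

end Hat

theorem GroupoidStr.inv_inv {G M : Type*} (Γ : GroupoidStr G M) (g : G) :
    Γ.inv (Γ.inv g) = g := by
  have h1 : Γ.src g = Γ.tgt (Γ.inv g) := (Γ.tgt_inv g).symm
  have h2 : Γ.src (Γ.inv g) = Γ.tgt (Γ.inv (Γ.inv g)) := (Γ.tgt_inv _).symm
  have h := Γ.mul_assoc g (Γ.inv g) (Γ.inv (Γ.inv g)) h1 h2
  rw [Γ.mul_inv, Γ.mul_inv, Γ.tgt_inv, Γ.mul_unit] at h
  have h3 := Γ.unit_mul (Γ.inv (Γ.inv g))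
  rw [Γ.tgt_inv, Γ.src_inv] at h3
  exact h3.symm.trans h

/-- The derivative is kept as a map of model spaces, so changing the base point along an equality
needs no cast between tangent spaces. -/
theorem hasMFDerivAt_of_eq {𝕜 : Type*} [NontriviallyNormedField 𝕜]
    {E : Type*} [NormedAddCommGroup E] [NormedSpace 𝕜 E] {H : Type*} [TopologicalSpace H]
    {I : ModelWithCorners 𝕜 E H} {M : Type*} [TopologicalSpace M] [ChartedSpace H M]
    {E' : Type*} [NormedAddCommGroup E'] [NormedSpace 𝕜 E'] {H' : Type*} [TopologicalSpace H']
    {I' : ModelWithCorners 𝕜 E' H'} {M' : Type*} [TopologicalSpace M'] [ChartedSpace H' M']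
    {f : M → M'} {x y : M} {D : E →L[𝕜] E'} (h : HasMFDerivAt I I' f x D) (hxy : x = y) :
    HasMFDerivAt I I' f y D := by
  subst hxy
  exact h

theorem hasMFDerivWithinAt_of_eq {𝕜 : Type*} [NontriviallyNormedField 𝕜]
    {E : Type*} [NormedAddCommGroup E] [NormedSpace 𝕜 E] {H : Type*} [TopologicalSpace H]
    {I : ModelWithCorners 𝕜 E H} {M : Type*} [TopologicalSpace M] [ChartedSpace H M]
    {E' : Type*} [NormedAddCommGroup E'] [NormedSpace 𝕜 E'] {H' : Type*} [TopologicalSpace H']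
    {I' : ModelWithCorners 𝕜 E' H'} {M' : Type*} [TopologicalSpace M'] [ChartedSpace H' M']
    {f : M → M'} {s : Set M} {x y : M} {D : E →L[𝕜] E'} (h : HasMFDerivWithinAt I I' f s x D)
    (hxy : x = y) : HasMFDerivWithinAt I I' f s y D := by
  subst hxy
  exact h

/-! ### Tangent vectors of the projective bundle in a trivialization -/

section RProj

variable {EX : Type*} [NormedAddCommGroup EX] [NormedSpace ℂ EX]
  {X : Type*} [TopologicalSpace X] [ChartedSpace EX X]
  {L : X → Type*} [∀ x, AddCommGroup (L x)] [∀ x, Module ℂ (L x)] [∀ x, TopologicalSpace (L x)]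
  [TopologicalSpace (TotalSpace ℂ L)] [FiberBundle ℂ L] [VectorBundle ℂ ℂ L]
  [ContMDiffVectorBundle ω ℂ L 𝓘(ℂ, EX)]
  {E : Type*} [NormedAddCommGroup E] [NormedSpace ℂ E]
  {B : Type*} [TopologicalSpace B] [ChartedSpace E B] [IsManifold 𝓘(ℂ, E) ω B]
  {f : ContMDiffMap 𝓘(ℂ, E) 𝓘(ℂ, EX) B X ω}

theorem RProj.hasMFDerivAt_base (z : RProj L f) :
    HasMFDerivAt (𝓘(ℝ, E).prod 𝓘(ℝ, ℝ)) 𝓘(ℝ, E) (RProj.base : RProj L f → B) z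
      (mfderiv (𝓘(ℝ, E).prod 𝓘(ℝ, ℝ)) 𝓘(ℝ, E) RProj.base z) :=
  (RProj.contMDiff_base.mdifferentiable (by simp) z).hasMFDerivAt

/-- The differential of a trivialization and of its inverse. -/
theorem exists_hasMFDerivAt_rprojTriv {x₀ : X} {c : ℂ} {z : RProj L f}
    (hz : z ∈ (rprojTriv (L := L) (f := f) x₀ c).source) :
    ∃ T S : E × ℝ →L[ℝ] E × ℝ,
      HasMFDerivAt (𝓘(ℝ, E).prod 𝓘(ℝ, ℝ)) (𝓘(ℝ, E).prod 𝓘(ℝ, ℝ)) (rprojTriv x₀ c) z T ∧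
      HasMFDerivAt (𝓘(ℝ, E).prod 𝓘(ℝ, ℝ)) (𝓘(ℝ, E).prod 𝓘(ℝ, ℝ))
        (rprojTriv (L := L) (f := f) x₀ c).symm (rprojTriv x₀ c z) S ∧
      (∀ u, S (T u) = u) ∧
      (∀ u : E × ℝ, (T u).1 = mfderiv (𝓘(ℝ, E).prod 𝓘(ℝ, ℝ)) 𝓘(ℝ, E) RProj.base z u) ∧
      ∀ u : E × ℝ, mfderiv (𝓘(ℝ, E).prod 𝓘(ℝ, ℝ)) 𝓘(ℝ, E) RProj.base z (S u) = u.1 := by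
  have hs := (isOpen_rprojTriv_source (L := L) (f := f) x₀ c).mem_nhds hz
  have hq := PartialEquiv.map_source _ hz
  have ht := (isOpen_rprojTriv_target (L := L) (f := f) x₀ c).mem_nhds hq
  have hzz : (rprojTriv x₀ c).symm (rprojTriv x₀ c z) = z := PartialEquiv.left_inv _ hz
  have hT := (((contMDiffOn_rprojTriv (L := L) (f := f) x₀ c).contMDiffAt hs).mdifferentiableAt
    (by simp)).hasMFDerivAt
  have hS := (((contMDiffOn_rprojTriv_symm (L := L) (f := f) x₀ c).contMDiffAt
    ht).mdifferentiableAt (by simp)).hasMFDerivAt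
  refine ⟨_, _, hT, hS, ?_, ?_, ?_⟩
  · have h1 := (hS.comp z hT).congr_of_eventuallyEq (f₁ := id) (by
      filter_upwards [hs] with y hy using ((rprojTriv x₀ c).left_inv hy).symm)
    have h2 := hasMFDerivAt_unique h1 (hasMFDerivAt_id z)
    exact fun u => DFunLike.congr_fun h2 u
  · have h1 := (hasMFDerivAt_fst (rprojTriv x₀ c z)).comp z hT
    have h2 := hasMFDerivAt_unique h1 (RProj.hasMFDerivAt_base z)
    exact fun u => DFunLike.congr_fun h2 u
  · have h1 := (hasMFDerivAt_of_eq (RProj.hasMFDerivAt_base z) hzz.symm).comp _ hS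
    have h2 := h1.congr_of_eventuallyEq (f₁ := Prod.fst) (by
      filter_upwards [ht] with y hy
      have := congrArg Prod.fst ((rprojTriv x₀ c).right_inv hy)
      exact this.symm)
    have h3 := hasMFDerivAt_unique h2 (hasMFDerivAt_fst _)
    exact fun u => DFunLike.congr_fun h3 u

theorem RProj.exists_mfderiv_base (z : RProj L f) (v : E) : ∃ u : E × ℝ,
    (mfderiv (𝓘(ℝ, E).prod 𝓘(ℝ, ℝ)) 𝓘(ℝ, E) RProj.base z u : E) = v := by
  obtain ⟨c, hz⟩ := z.exists_mem_source
  obtain ⟨T, S, -, -, -, -, h⟩ := exists_hasMFDerivAt_rprojTriv hz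
  exact ⟨S (v, 0), h (v, 0)⟩

end RProj

/-! ### The tangent groupoid of `Ĝ` and its projection to that of `G` -/

section Hat

variable {EX : Type*} [NormedAddCommGroup EX] [NormedSpace ℂ EX]
  {X : Type*} [TopologicalSpace X] [ChartedSpace EX X] [IsManifold 𝓘(ℂ, EX) ω X]
  {EG : Type*} [NormedAddCommGroup EG] [NormedSpace ℂ EG]
  {G : Type*} [TopologicalSpace G] [ChartedSpace EG G] [IsManifold 𝓘(ℂ, EG) ω G]
  {Γ : LieGroupoid 𝓘(ℂ, EG) 𝓘(ℂ, EX) ω G X}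
  {L : X → Type*} [∀ x, AddCommGroup (L x)] [∀ x, Module ℂ (L x)] [∀ x, TopologicalSpace (L x)]
  [TopologicalSpace (TotalSpace ℂ L)] [FiberBundle ℂ L] [VectorBundle ℂ ℂ L]
  [ContMDiffVectorBundle ω ℂ L 𝓘(ℂ, EX)]

/-- The differential of the projection of the real projective bundle to its base. -/
abbrev RProj.dbase {E : Type*} [NormedAddCommGroup E] [NormedSpace ℂ E]
    {B : Type*} [TopologicalSpace B] [ChartedSpace E B]
    {f : ContMDiffMap 𝓘(ℂ, E) 𝓘(ℂ, EX) B X ω} (z : RProj L f) : E × ℝ →L[ℝ] E :=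
  mfderiv (𝓘(ℝ, E).prod 𝓘(ℝ, ℝ)) 𝓘(ℝ, E) RProj.base z

theorem hasMFDerivAt_tgtHat (z : ArrowHat Γ L) :
    HasMFDerivAt (𝓘(ℝ, EG).prod 𝓘(ℝ, ℝ)) (𝓘(ℝ, EX).prod 𝓘(ℝ, ℝ)) tgtHat z
      (mfderiv (𝓘(ℝ, EG).prod 𝓘(ℝ, ℝ)) (𝓘(ℝ, EX).prod 𝓘(ℝ, ℝ)) tgtHat z) :=
  (contMDiff_tgtHat.mdifferentiable (by simp) z).hasMFDerivAt

theorem hasMFDerivAt_srcHat (A : LineAction Γ L) (z : ArrowHat Γ L) :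
    HasMFDerivAt (𝓘(ℝ, EG).prod 𝓘(ℝ, ℝ)) (𝓘(ℝ, EX).prod 𝓘(ℝ, ℝ)) (srcHat A) z
      (mfderiv (𝓘(ℝ, EG).prod 𝓘(ℝ, ℝ)) (𝓘(ℝ, EX).prod 𝓘(ℝ, ℝ)) (srcHat A) z) :=
  ((contMDiff_srcHat A).mdifferentiable (by simp) z).hasMFDerivAt

theorem hasMFDerivAt_unitHat (A : LineAction Γ L) (p : BaseHat Γ L) :
    HasMFDerivAt (𝓘(ℝ, EX).prod 𝓘(ℝ, ℝ)) (𝓘(ℝ, EG).prod 𝓘(ℝ, ℝ)) (groupoidHat A).unit p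
      (mfderiv (𝓘(ℝ, EX).prod 𝓘(ℝ, ℝ)) (𝓘(ℝ, EG).prod 𝓘(ℝ, ℝ)) (groupoidHat A).unit p) :=
  ((contMDiff_unitHat A).mdifferentiable (by simp) p).hasMFDerivAt

theorem hasMFDerivAt_invHat (A : LineAction Γ L) (z : ArrowHat Γ L) :
    HasMFDerivAt (𝓘(ℝ, EG).prod 𝓘(ℝ, ℝ)) (𝓘(ℝ, EG).prod 𝓘(ℝ, ℝ)) (groupoidHat A).inv z
      (mfderiv (𝓘(ℝ, EG).prod 𝓘(ℝ, ℝ)) (𝓘(ℝ, EG).prod 𝓘(ℝ, ℝ)) (groupoidHat A).inv z) :=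
  ((contMDiff_invHat A).mdifferentiable (by simp) z).hasMFDerivAt

theorem LieGroupoid.hasMFDerivAt_src (Γ : LieGroupoid 𝓘(ℂ, EG) 𝓘(ℂ, EX) ω G X) (g : G) :
    HasMFDerivAt 𝓘(ℂ, EG) 𝓘(ℂ, EX) Γ.src g (mfderiv 𝓘(ℂ, EG) 𝓘(ℂ, EX) Γ.src g) :=
  (Γ.contMDiff_src.mdifferentiable (by simp) g).hasMFDerivAt

theorem LieGroupoid.hasMFDerivAt_tgt (Γ : LieGroupoid 𝓘(ℂ, EG) 𝓘(ℂ, EX) ω G X) (g : G) :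
    HasMFDerivAt 𝓘(ℂ, EG) 𝓘(ℂ, EX) Γ.tgt g (mfderiv 𝓘(ℂ, EG) 𝓘(ℂ, EX) Γ.tgt g) :=
  (Γ.contMDiff_tgt.mdifferentiable (by simp) g).hasMFDerivAt

theorem LieGroupoid.hasMFDerivAt_unit (Γ : LieGroupoid 𝓘(ℂ, EG) 𝓘(ℂ, EX) ω G X) (x : X) :
    HasMFDerivAt 𝓘(ℂ, EX) 𝓘(ℂ, EG) Γ.unit x (mfderiv 𝓘(ℂ, EX) 𝓘(ℂ, EG) Γ.unit x) :=
  (Γ.contMDiff_unit.mdifferentiable (by simp) x).hasMFDerivAt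

theorem LieGroupoid.hasMFDerivAt_inv (Γ : LieGroupoid 𝓘(ℂ, EG) 𝓘(ℂ, EX) ω G X) (g : G) :
    HasMFDerivAt 𝓘(ℂ, EG) 𝓘(ℂ, EG) Γ.inv g (mfderiv 𝓘(ℂ, EG) 𝓘(ℂ, EG) Γ.inv g) :=
  (Γ.contMDiff_inv.mdifferentiable (by simp) g).hasMFDerivAt

theorem LieGroupoid.hasMFDerivWithinAt_mul (Γ : LieGroupoid 𝓘(ℂ, EG) 𝓘(ℂ, EX) ω G X) {g h : G}
    (hgh : Γ.src g = Γ.tgt h) :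
    HasMFDerivWithinAt (𝓘(ℂ, EG).prod 𝓘(ℂ, EG)) 𝓘(ℂ, EG) (fun p : G × G => Γ.mul p.1 p.2)
      Γ.composable (g, h) (mfderivWithin (𝓘(ℂ, EG).prod 𝓘(ℂ, EG)) 𝓘(ℂ, EG)
        (fun p : G × G => Γ.mul p.1 p.2) Γ.composable (g, h)) :=
  ((Γ.contMDiffOn_mul (g, h) hgh).mdifferentiableWithinAt (by simp)).hasMFDerivWithinAt

theorem LieGroupoid.mfderiv_tgt_inv (Γ : LieGroupoid 𝓘(ℂ, EG) 𝓘(ℂ, EX) ω G X) (g : G) (v : EG) :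
    (mfderiv 𝓘(ℂ, EG) 𝓘(ℂ, EX) Γ.tgt (Γ.inv g)
      (mfderiv 𝓘(ℂ, EG) 𝓘(ℂ, EG) Γ.inv g v : EG) : EX) =
      (mfderiv 𝓘(ℂ, EG) 𝓘(ℂ, EX) Γ.src g v : EX) := by
  have e := ((Γ.hasMFDerivAt_tgt (Γ.inv g)).comp g (Γ.hasMFDerivAt_inv g))
  have e' : Γ.tgt ∘ Γ.inv = Γ.src := funext Γ.tgt_inv
  rw [e'] at e
  exact DFunLike.congr_fun (hasMFDerivAt_unique e (Γ.hasMFDerivAt_src g)) v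

/-- This and the next three lemmas differentiate the fact that the structure maps of `Ĝ` cover those
of `G`. The holomorphic maps downstairs enter through their underlying real differentials. -/
theorem dbase_mfderiv_tgtHat (z : ArrowHat Γ L) (V : EG × ℝ) :
    (tgtHat z).dbase (mfderiv (𝓘(ℝ, EG).prod 𝓘(ℝ, ℝ)) (𝓘(ℝ, EX).prod 𝓘(ℝ, ℝ)) tgtHat z V) =
      (mfderiv 𝓘(ℂ, EG) 𝓘(ℂ, EX) Γ.tgt z.base (z.dbase V) : EX) :=
  DFunLike.congr_fun (hasMFDerivAt_unique
    ((RProj.hasMFDerivAt_base (tgtHat z)).comp z (hasMFDerivAt_tgtHat z))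
    ((hasMFDerivAt_real (Γ.hasMFDerivAt_tgt z.base)).comp z (RProj.hasMFDerivAt_base z))) V

theorem dbase_mfderiv_srcHat (A : LineAction Γ L) (z : ArrowHat Γ L) (V : EG × ℝ) :
    (srcHat A z).dbase
        (mfderiv (𝓘(ℝ, EG).prod 𝓘(ℝ, ℝ)) (𝓘(ℝ, EX).prod 𝓘(ℝ, ℝ)) (srcHat A) z V) =
      (mfderiv 𝓘(ℂ, EG) 𝓘(ℂ, EX) Γ.src z.base (z.dbase V) : EX) :=
  DFunLike.congr_fun (hasMFDerivAt_unique
    ((RProj.hasMFDerivAt_base (srcHat A z)).comp z (hasMFDerivAt_srcHat A z))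
    ((hasMFDerivAt_real (Γ.hasMFDerivAt_src z.base)).comp z (RProj.hasMFDerivAt_base z))) V

theorem dbase_mfderiv_unitHat (A : LineAction Γ L) (p : BaseHat Γ L) (u : EX × ℝ) :
    ((groupoidHat A).unit p).dbase
        (mfderiv (𝓘(ℝ, EX).prod 𝓘(ℝ, ℝ)) (𝓘(ℝ, EG).prod 𝓘(ℝ, ℝ)) (groupoidHat A).unit p u) =
      (mfderiv 𝓘(ℂ, EX) 𝓘(ℂ, EG) Γ.unit p.base (p.dbase u) : EG) :=
  DFunLike.congr_fun (hasMFDerivAt_unique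
    ((RProj.hasMFDerivAt_base ((groupoidHat A).unit p)).comp p (hasMFDerivAt_unitHat A p))
    ((hasMFDerivAt_real (Γ.hasMFDerivAt_unit p.base)).comp p (RProj.hasMFDerivAt_base p))) u

theorem dbase_mfderiv_invHat (A : LineAction Γ L) (z : ArrowHat Γ L) (V : EG × ℝ) :
    ((groupoidHat A).inv z).dbase
        (mfderiv (𝓘(ℝ, EG).prod 𝓘(ℝ, ℝ)) (𝓘(ℝ, EG).prod 𝓘(ℝ, ℝ)) (groupoidHat A).inv z V) =
      (mfderiv 𝓘(ℂ, EG) 𝓘(ℂ, EG) Γ.inv z.base (z.dbase V) : EG) :=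
  DFunLike.congr_fun (hasMFDerivAt_unique
    ((RProj.hasMFDerivAt_base ((groupoidHat A).inv z)).comp z (hasMFDerivAt_invHat A z))
    ((hasMFDerivAt_real (Γ.hasMFDerivAt_inv z.base)).comp z (RProj.hasMFDerivAt_base z))) V

/-- `TĜ` is the fibre product of `TG` and `TM̂` over `TX`. -/
theorem exists_lift_tgtHat (z : ArrowHat Γ L) (v : EG) (u : EX × ℝ)
    (h : (mfderiv 𝓘(ℂ, EG) 𝓘(ℂ, EX) Γ.tgt z.base v : EX) = (tgtHat z).dbase u) :
    ∃ V : EG × ℝ, z.dbase V = v ∧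
      (mfderiv (𝓘(ℝ, EG).prod 𝓘(ℝ, ℝ)) (𝓘(ℝ, EX).prod 𝓘(ℝ, ℝ)) tgtHat z V : EX × ℝ) = u := by
  obtain ⟨c, hz⟩ := z.exists_mem_source
  have hz' : tgtHat z ∈ (rprojTriv (L := L) (f := idMap (EX := EX) X) (Γ.tgt z.base) c).source := hz
  obtain ⟨T, S, -, hS, -, -, hS'⟩ := exists_hasMFDerivAt_rprojTriv hz
  obtain ⟨T₀, S₀, -, hS₀, hST₀, hT₀, -⟩ := exists_hasMFDerivAt_rprojTriv hz'
  -- In trivializations `tgtHat` is `(t, id)`: the `G`-velocity is `v` and the slope velocity is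
  -- copied from `u`. The remaining component is the compatibility `h`.
  refine ⟨S (v, (T₀ u).2), hS' _, ?_⟩
  have hzz := PartialEquiv.left_inv _ hz
  have ht := (isOpen_rprojTriv_target (L := L) (f := Γ.tgtMap) (Γ.tgt z.base) c).mem_nhds
    (PartialEquiv.map_source _ hz)
  have h1 := (hasMFDerivAt_of_eq (hasMFDerivAt_tgtHat z) hzz.symm).comp _ hS
  have h2 := ((hasMFDerivAt_real (Γ.hasMFDerivAt_tgt z.base)).comp
      (rprojTriv (L := L) (f := Γ.tgtMap) (Γ.tgt z.base) c z) (hasMFDerivAt_fst _)).prodMk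
    (hasMFDerivAt_snd (I := 𝓘(ℝ, EG)) (I' := 𝓘(ℝ, ℝ))
      (rprojTriv (L := L) (f := Γ.tgtMap) (Γ.tgt z.base) c z))
  have h3 := hS₀.comp (rprojTriv (L := L) (f := Γ.tgtMap) (Γ.tgt z.base) c z) h2
  have h4 := h1.congr_of_eventuallyEq (f₁ := fun q : G × ℝ => (rprojTriv (L := L)
    (f := idMap (EX := EX) X) (Γ.tgt z.base) c).symm (Γ.tgt q.1, q.2)) (by
      filter_upwards [ht] with q hq
      have hq' : ((Γ.tgt q.1, q.2) : X × ℝ) ∈ (rprojTriv (L := L) (f := idMap (EX := EX) X)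
        (Γ.tgt z.base) c).target := hq
      exact (rprojTriv_symm _ hq').trans (congrArg tgtHat (rprojTriv_symm _ hq)).symm)
  have h5 := DFunLike.congr_fun (hasMFDerivAt_unique h4 h3) (v, (T₀ u).2)
  refine h5.trans ?_
  refine Eq.trans ?_ (hST₀ u)
  refine congrArg S₀ (Prod.ext ?_ rfl)
  exact h.trans (hT₀ u).symm

/-- Inversion exchanges source and target: the lift along targets is taken at the inverse arrow, for
the inverted vector, and then inverted back. -/
theorem exists_lift_srcHat (A : LineAction Γ L) (z : ArrowHat Γ L) (v : EG) (u : EX × ℝ)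
    (h : (mfderiv 𝓘(ℂ, EG) 𝓘(ℂ, EX) Γ.src z.base v : EX) = (srcHat A z).dbase u) :
    ∃ V : EG × ℝ, z.dbase V = v ∧
      (mfderiv (𝓘(ℝ, EG).prod 𝓘(ℝ, ℝ)) (𝓘(ℝ, EX).prod 𝓘(ℝ, ℝ)) (srcHat A) z V : EX × ℝ) = u := by
  set z' := (groupoidHat A).inv z with hz'
  have hzz : (groupoidHat A).inv z' = z := (groupoidHat A).inv_inv z
  have htz : tgtHat z' = srcHat A z := (groupoidHat A).tgt_inv z
  have hb := RProj.hasMFDerivAt_base z'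
  set w : EG := mfderiv 𝓘(ℂ, EG) 𝓘(ℂ, EG) Γ.inv z.base v with hw
  have h1 : (mfderiv 𝓘(ℂ, EG) 𝓘(ℂ, EX) Γ.tgt z'.base w : EX) =
      (mfderiv 𝓘(ℂ, EG) 𝓘(ℂ, EX) Γ.src z.base v : EX) := Γ.mfderiv_tgt_inv z.base v
  obtain ⟨W, hW1, hW2⟩ := exists_lift_tgtHat z' w u (by rw [h1, htz]; exact h)
  have hI := hasMFDerivAt_invHat A z'
  refine ⟨mfderiv (𝓘(ℝ, EG).prod 𝓘(ℝ, ℝ)) (𝓘(ℝ, EG).prod 𝓘(ℝ, ℝ)) (groupoidHat A).inv z' W,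
    ?_, ?_⟩
  · have e := (hasMFDerivAt_of_eq (RProj.hasMFDerivAt_base z) hzz.symm).comp z' hI
    have e' := (hasMFDerivAt_real (Γ.hasMFDerivAt_inv z'.base)).comp z' hb
    have e1 := DFunLike.congr_fun (hasMFDerivAt_unique e e') W
    refine e1.trans ?_
    change (mfderiv 𝓘(ℂ, EG) 𝓘(ℂ, EG) Γ.inv z'.base (z'.dbase W) : EG) = v
    rw [hW1]
    have e2 := (Γ.hasMFDerivAt_inv (Γ.inv z.base)).comp z.base (Γ.hasMFDerivAt_inv z.base)
    have e3 : Γ.inv ∘ Γ.inv = id := funext Γ.toGroupoidStr.inv_inv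
    rw [e3] at e2
    exact DFunLike.congr_fun (hasMFDerivAt_unique e2 (hasMFDerivAt_id z.base)) v
  · have e := (hasMFDerivAt_of_eq (hasMFDerivAt_srcHat A z) hzz.symm).comp z' hI
    have e' : srcHat A ∘ (groupoidHat A).inv = tgtHat := funext (groupoidHat A).src_inv
    rw [e'] at e
    exact (DFunLike.congr_fun (hasMFDerivAt_unique e (hasMFDerivAt_tgtHat z')) W).trans hW2

/-- The projection of `TĜ` to `TG` is multiplicative. -/
theorem dbase_tangentMul [FiniteDimensional ℂ EX] [FiniteDimensional ℂ EG] (A : LineAction Γ L)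
    {z w : ArrowHat Γ L} (hzw : srcHat A z = tgtHat w) {V W : EG × ℝ}
    (hVW : (mfderiv (𝓘(ℝ, EG).prod 𝓘(ℝ, ℝ)) (𝓘(ℝ, EX).prod 𝓘(ℝ, ℝ)) (srcHat A) z V : EX × ℝ) =
      (mfderiv (𝓘(ℝ, EG).prod 𝓘(ℝ, ℝ)) (𝓘(ℝ, EX).prod 𝓘(ℝ, ℝ)) tgtHat w W : EX × ℝ)) :
    ((groupoidHat A).mul z w).dbase
        ((groupoidHat A).tangentMul (𝓘(ℝ, EG).prod 𝓘(ℝ, ℝ)) ⟨z, V⟩ ⟨w, W⟩).snd =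
      (Γ.tangentMul 𝓘(ℂ, EG) ⟨z.base, z.dbase V⟩ ⟨w.base, w.dbase W⟩).snd := by
  have := FiniteDimensional.complete ℂ EG
  have hs : Function.Surjective (mfderiv (𝓘(ℝ, EG).prod 𝓘(ℝ, ℝ)) (𝓘(ℝ, EX).prod 𝓘(ℝ, ℝ))
      (tgtHat : ArrowHat Γ L → BaseHat Γ L) w) := by
    -- `tgtHat` is a submersion: the `TX`-part of `u` lifts because `t` is one, and the fibre
    -- product property lifts the rest.
    intro u
    obtain ⟨v, hv⟩ := Γ.submersion_tgt w.base ((tgtHat w).dbase u)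
    obtain ⟨V, -, hV⟩ := exists_lift_tgtHat w v u hv
    exact ⟨V, hV⟩
  -- The product of tangent vectors is a derivative within the set of composable pairs, which need
  -- not be open. Along a curve that stays in this set the chain rule gives an honest derivative,
  -- and derivatives of curves are unique.
  obtain ⟨c, hc0, hcc, hc⟩ := exists_curve_fiberProduct
    ((contMDiff_srcHat A z).of_le (by simp)) ((contMDiff_tgtHat w).of_le (by simp)) hzw hs hVW
  set S : Set ℝ := c ⁻¹' (groupoidHat A).composable with hSd
  have hS : S ∈ 𝓝 0 := hcc
  have hmul := ((contMDiffOn_mulHat A (z, w) hzw).mdifferentiableWithinAt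
    (by simp)).hasMFDerivWithinAt
  have h1 := ((hasMFDerivWithinAt_of_eq hmul hc0.symm).comp 0 hc.hasMFDerivWithinAt
    (s := S) subset_rfl).hasMFDerivAt hS
  have e0 : (groupoidHat A).mul z w = (groupoidHat A).mul (c 0).1 (c 0).2 := by rw [hc0]
  have h2 := (hasMFDerivAt_of_eq (RProj.hasMFDerivAt_base ((groupoidHat A).mul z w)) e0).comp 0 h1
  have e1 : z = (c 0).1 := by rw [hc0]
  have e2 : w = (c 0).2 := by rw [hc0]
  have hb1 := (hasMFDerivAt_of_eq (RProj.hasMFDerivAt_base z) e1).comp 0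
    ((hasMFDerivAt_fst (c 0)).comp 0 hc)
  have hb2 := (hasMFDerivAt_of_eq (RProj.hasMFDerivAt_base w) e2).comp 0
    ((hasMFDerivAt_snd (c 0)).comp 0 hc)
  have hg : Γ.src z.base = Γ.tgt w.base := congrArg RProj.base hzw
  have e3 : (z.base, w.base) = ((c 0).1.base, (c 0).2.base) := by rw [hc0]
  have hcomp : ∀ τ ∈ S, Γ.src (c τ).1.base = Γ.tgt (c τ).2.base :=
    fun τ hτ => congrArg RProj.base hτ
  have hsub : S ⊆ (fun τ => ((c τ).1.base, (c τ).2.base)) ⁻¹' Γ.composable :=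
    fun τ hτ => hcomp τ hτ
  have h3 := ((hasMFDerivWithinAt_of_eq (hasMFDerivWithinAt_real_prod
    (Γ.hasMFDerivWithinAt_mul hg)) e3).comp 0 (hb1.prodMk hb2).hasMFDerivWithinAt
    (s := S) hsub).hasMFDerivAt hS
  -- Projecting the product curve to `G` gives the product of the projected curves; the claim
  -- compares the two resulting expressions for its velocity.
  have h4 := h3.congr_of_eventuallyEq (f₁ := fun τ => ((groupoidHat A).mul (c τ).1 (c τ).2).base)
    (by filter_upwards [hS] with τ hτ using mulHat_base (hcomp τ hτ))
  have h5 := DFunLike.congr_fun (hasMFDerivAt_unique h2 h4) (1 : ℝ)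
  have hone : ContinuousLinearMap.toSpanSingleton ℝ ((V, W) : (EG × ℝ) × (EG × ℝ)) 1 = (V, W) :=
    one_smul ℝ _
  change ((groupoidHat A).mul z w).dbase (mfderivWithin ((𝓘(ℝ, EG).prod 𝓘(ℝ, ℝ)).prod
    (𝓘(ℝ, EG).prod 𝓘(ℝ, ℝ))) (𝓘(ℝ, EG).prod 𝓘(ℝ, ℝ)) (fun q : ArrowHat Γ L × ArrowHat Γ L =>
      (groupoidHat A).mul q.1 q.2) (groupoidHat A).composable (z, w)
        (ContinuousLinearMap.toSpanSingleton ℝ ((V, W) : (EG × ℝ) × (EG × ℝ)) 1)) =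
    mfderivWithin (𝓘(ℂ, EG).prod 𝓘(ℂ, EG)) 𝓘(ℂ, EG) (fun p : G × G => Γ.mul p.1 p.2)
      Γ.composable (z.base, w.base)
        (z.dbase (ContinuousLinearMap.toSpanSingleton ℝ ((V, W) : (EG × ℝ) × (EG × ℝ)) 1).1,
          w.dbase (ContinuousLinearMap.toSpanSingleton ℝ ((V, W) : (EG × ℝ) × (EG × ℝ)) 1).2) at h5
  rw [hone] at h5
  exact h5

/-- The product of a tangent vector and its inverse is a unit. -/
theorem LieGroupoid.tangentMul_inv (Γ : LieGroupoid 𝓘(ℂ, EG) 𝓘(ℂ, EX) ω G X) (g : G) (v : EG) :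
    ((Γ.tangentMul 𝓘(ℂ, EG) ⟨g, v⟩
      ⟨Γ.inv g, mfderiv 𝓘(ℂ, EG) 𝓘(ℂ, EG) Γ.inv g v⟩).snd : EG) =
      mfderiv 𝓘(ℂ, EX) 𝓘(ℂ, EG) Γ.unit (Γ.tgt g) (mfderiv 𝓘(ℂ, EG) 𝓘(ℂ, EX) Γ.tgt g v) := by
  have hm := Γ.hasMFDerivWithinAt_mul (Γ.tgt_inv g).symm
  -- The map `h ↦ (h, h⁻¹)` takes all of `G` into the composable pairs, so the identity `h h⁻¹ =
  -- 1_{t(h)}` may be differentiated.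
  have hsub : Set.univ ⊆ (fun h => (id h, Γ.inv h)) ⁻¹' Γ.composable :=
    fun h _ => (Γ.tgt_inv h).symm
  have h1 := (hm.comp g ((hasMFDerivAt_id g).prodMk
    (Γ.hasMFDerivAt_inv g)).hasMFDerivWithinAt (s := Set.univ)
      hsub).hasMFDerivAt Filter.univ_mem
  have e : (fun p : G × G => Γ.mul p.1 p.2) ∘ (fun h => (id h, Γ.inv h)) = Γ.unit ∘ Γ.tgt :=
    funext Γ.mul_inv
  rw [e] at h1
  exact DFunLike.congr_fun (hasMFDerivAt_unique h1
    ((Γ.hasMFDerivAt_unit (Γ.tgt g)).comp g (Γ.hasMFDerivAt_tgt g))) v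

end Hat

/-- `ι_Z dα = α` for the form `α = y₂ b(y₁)(dy₁)` and the vector field `Z = y₂ ∂/∂y₂`. -/
theorem fderiv_homogeneous_form {𝕜 : Type*} [NontriviallyNormedField 𝕜] {E : Type*}
    [NormedAddCommGroup E] [NormedSpace 𝕜 E] {b : E → E →L[𝕜] 𝕜} {a : E × 𝕜 → E × 𝕜 →L[𝕜] 𝕜}
    {y₀ : E × 𝕜} (hb : DifferentiableAt 𝕜 b y₀.1)
    (ha : ∀ᶠ y in 𝓝 y₀, ∀ u, a y u = y.2 * b y.1 u.1) (v : E × 𝕜) :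
    fderiv 𝕜 a y₀ (0, y₀.2) v - fderiv 𝕜 a y₀ v (0, y₀.2) = y₀.2 * b y₀.1 v.1 := by
  -- `C` is pull-back along the projection to `E`; it makes `a` the product of `y.2` with a
  -- differentiable map. In the derivative, the vector `(0, y₀.2)` has no `E`-component, so only the
  -- derivative of the factor `y.2` survives.
  let C : (E →L[𝕜] 𝕜) →L[𝕜] (E × 𝕜 →L[𝕜] 𝕜) :=
    (ContinuousLinearMap.compL 𝕜 (E × 𝕜) E 𝕜).flip (ContinuousLinearMap.fst 𝕜 E 𝕜)
  have ha' : a =ᶠ[𝓝 y₀] fun y => y.2 • C (b y.1) := by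
    filter_upwards [ha] with y hy using ContinuousLinearMap.ext hy
  have hD := HasFDerivAt.congr_of_eventuallyEq (hasFDerivAt_snd.smul
    (C.hasFDerivAt.comp y₀ (hb.hasFDerivAt.comp y₀ hasFDerivAt_fst))) ha'
  have h : ∀ u u' : E × 𝕜, fderiv 𝕜 a y₀ u u' =
      y₀.2 * fderiv 𝕜 b y₀.1 u.1 u'.1 + u.2 * b y₀.1 u'.1 := by
    rw [hD.fderiv]
    exact fun _ _ => rfl
  rw [h, h]
  simp only [map_zero, mul_zero, zero_apply, zero_add, add_zero, sub_zero]

/-! ### The contraction of `Ω` with the Euler field, in the preferred charts -/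

section Symplectization

variable {EX : Type*} [NormedAddCommGroup EX] [NormedSpace ℂ EX]
  {X : Type*} [TopologicalSpace X] [ChartedSpace EX X]
  {EG : Type*} [NormedAddCommGroup EG] [NormedSpace ℂ EG]
  {G : Type*} [TopologicalSpace G] [ChartedSpace EG G] [IsManifold 𝓘(ℂ, EG) ω G]
  {Γ : LieGroupoid 𝓘(ℂ, EG) 𝓘(ℂ, EX) ω G X}
  {L : X → Type*} [∀ x, AddCommGroup (L x)] [∀ x, Module ℂ (L x)] [∀ x, TopologicalSpace (L x)]
  [TopologicalSpace (TotalSpace ℂ L)] [FiberBundle ℂ L] [VectorBundle ℂ ℂ L]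
  [ContMDiffVectorBundle ω ℂ L 𝓘(ℂ, EX)]

theorem extChartAt_slit_apply (p q : ArrowTilde Γ L) :
    extChartAt (𝓘(ℂ, EG).prod 𝓘(ℂ, ℂ)) p q =
      (extChartAt 𝓘(ℂ, EG) p.base q.base,
        lineCoord L (Γ.tgt p.base) (Γ.tgt q.base) q.covec) := rfl

theorem extChartAt_slit_symm_apply (p : ArrowTilde Γ L) (y : EG × ℂ) :
    (extChartAt (𝓘(ℂ, EG).prod 𝓘(ℂ, ℂ)) p).symm y =
      (slitTriv (Γ.tgt p.base)).symm ((extChartAt 𝓘(ℂ, EG) p.base).symm y.1, y.2) := rfl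

theorem mem_extChartAt_slit_target (p : ArrowTilde Γ L) {y : EG × ℂ}
    (hy : y ∈ (extChartAt (𝓘(ℂ, EG).prod 𝓘(ℂ, ℂ)) p).target) :
    y.1 ∈ (extChartAt 𝓘(ℂ, EG) p.base).target ∧
      ((extChartAt 𝓘(ℂ, EG) p.base).symm y.1, y.2) ∈
        (slitTriv (L := L) (f := Γ.tgtMap) (Γ.tgt p.base)).target := by
  rw [extChartAt_target] at hy
  obtain ⟨hy, -⟩ := hy
  have h : ((𝓘(ℂ, EG).prod 𝓘(ℂ, ℂ)).symm y : ModelProd EG ℂ) ∈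
    (chartAt (ModelProd EG ℂ) (slitTriv (Γ.tgt p.base) p)).target ∩
      (chartAt (ModelProd EG ℂ) (slitTriv (Γ.tgt p.base) p)).symm ⁻¹'
        (slitTriv (L := L) (f := Γ.tgtMap) (Γ.tgt p.base)).target := hy
  obtain ⟨⟨h1, -⟩, h2⟩ := h
  refine ⟨?_, h2⟩
  rw [extChartAt_target]
  exact ⟨h1, by simp⟩

/-- The preferred chart of `G̃` at `p` combines the chart of `G` at `p.base` with the fibre
coordinate, so in charts the projection is the first projection. -/
theorem hasMFDerivAt_slit_base (p : ArrowTilde Γ L) :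
    HasMFDerivAt (𝓘(ℂ, EG).prod 𝓘(ℂ, ℂ)) 𝓘(ℂ, EG) (Slit.base : ArrowTilde Γ L → G) p
      (ContinuousLinearMap.fst ℂ EG ℂ) := by
  refine ⟨Slit.contMDiff_complex_base.continuous.continuousAt, ?_⟩
  refine HasFDerivAt.hasFDerivWithinAt ?_
  refine hasFDerivAt_fst.congr_of_eventuallyEq ?_
  filter_upwards [extChartAt_target_mem_nhds (I := 𝓘(ℂ, EG).prod 𝓘(ℂ, ℂ)) p] with y hy
  obtain ⟨h1, h2⟩ := mem_extChartAt_slit_target p hy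
  change extChartAt 𝓘(ℂ, EG) p.base
    ((extChartAt (𝓘(ℂ, EG).prod 𝓘(ℂ, ℂ)) p).symm y).base = y.1
  rw [extChartAt_slit_symm_apply, slitTriv_symm _ h2]
  exact (extChartAt 𝓘(ℂ, EG) p.base).right_inv h1

/-- The flow leaves the base point alone and multiplies the fibre coordinate by `exp z`, whose
derivative at `0` is `1`. -/
theorem eulerField_eq (p : ArrowTilde Γ L) :
    (eulerField p : EG × ℂ) = (0, lineCoord L (Γ.tgt p.base) (Γ.tgt p.base) p.covec) := by
  set w := lineCoord L (Γ.tgt p.base) (Γ.tgt p.base) p.covec with hw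
  let γ : ℂ → EG × ℂ := fun z => (extChartAt 𝓘(ℂ, EG) p.base p.base, Complex.exp z * w)
  have hγ : HasFDerivAt γ (ContinuousLinearMap.toSpanSingleton ℂ ((0, w) : EG × ℂ)) 0 := by
    have h1 : HasDerivAt (fun z => Complex.exp z * w) (Complex.exp 0 * w) 0 :=
      (Complex.hasDerivAt_exp 0).mul_const w
    rw [Complex.exp_zero, one_mul] at h1
    exact ((hasDerivAt_const (0 : ℂ) (extChartAt 𝓘(ℂ, EG) p.base p.base)).prodMk h1).hasFDerivAt
  have h0 : γ 0 = extChartAt (𝓘(ℂ, EG).prod 𝓘(ℂ, ℂ)) p p := by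
    rw [extChartAt_slit_apply]
    simp [γ, hw]
  have h := hasMFDerivAt_extChartAt_symm_comp h0 hγ
  have e : (fun z => (extChartAt (𝓘(ℂ, EG).prod 𝓘(ℂ, ℂ)) p).symm (γ z)) = p.flow := by
    funext z
    rw [extChartAt_slit_symm_apply]
    have hs : p.flow z ∈ (slitTriv (L := L) (f := Γ.tgtMap) (Γ.tgt p.base)).source :=
      FiberBundle.mem_baseSet_trivializationAt' _
    rw [← (slitTriv (Γ.tgt p.base)).left_inv hs]
    congr 1
    exact Prod.ext (extChartAt_to_inv p.base) rfl
  rw [e] at h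
  rw [eulerField, h.mfderiv]
  exact one_smul ℂ _

/-- The local coordinate expression of a `t^*L`-valued form in preferred trivializations. -/
def formCoord (θ : ∀ g, TangentSpace 𝓘(ℂ, EG) g →L[ℂ] L (Γ.tgt g)) (g₀ g : G) : EG →L[ℂ] ℂ :=
  ContinuousLinearMap.inCoordinates EG (TangentSpace 𝓘(ℂ, EG)) ℂ L g₀ g
    (Γ.tgt g₀) (Γ.tgt g) (θ g)

theorem formCoord_apply (θ : ∀ g, TangentSpace 𝓘(ℂ, EG) g →L[ℂ] L (Γ.tgt g)) (g₀ : G) {y : EG}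
    (hy : y ∈ (extChartAt 𝓘(ℂ, EG) g₀).target) (v : EG) :
    formCoord θ g₀ ((extChartAt 𝓘(ℂ, EG) g₀).symm y) v =
      (trivializationAt ℂ L (Γ.tgt g₀)).continuousLinearMapAt ℂ _
        (θ _ (mfderiv 𝓘(ℂ, EG) 𝓘(ℂ, EG) (extChartAt 𝓘(ℂ, EG) g₀).symm y v)) := by
  have hs := (extChartAt 𝓘(ℂ, EG) g₀).map_target hy
  rw [extChartAt_source] at hs
  have h := TangentBundle.symmL_trivializationAt (I := 𝓘(ℂ, EG)) hs
  rw [(extChartAt 𝓘(ℂ, EG) g₀).right_inv hy, ModelWithCorners.range_eq_univ,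
    mfderivWithin_univ] at h
  rw [← h]
  rfl

/-- At the centre of its own chart, the trivialization of the tangent bundle is the identity of the
model space. -/
theorem formCoord_self (θ : ∀ g, TangentSpace 𝓘(ℂ, EG) g →L[ℂ] L (Γ.tgt g)) (g : G) (v : EG) :
    formCoord θ g g v = (trivializationAt ℂ L (Γ.tgt g)).continuousLinearMapAt ℂ _ (θ g v) := by
  have h := TangentBundle.symmL_trivializationAt (I := 𝓘(ℂ, EG)) (mem_chart_source EG g)
  rw [mfderivWithin_range_extChartAt_symm] at h
  change (trivializationAt ℂ L (Γ.tgt g)).continuousLinearMapAt ℂ _ (θ g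
    ((trivializationAt EG (TangentSpace 𝓘(ℂ, EG)) g).symmL ℂ g v)) = _
  rw [h]
  rfl

theorem liouvilleForm_apply (θ : ∀ g, TangentSpace 𝓘(ℂ, EG) g →L[ℂ] L (Γ.tgt g))
    (p : ArrowTilde Γ L) (v : EG × ℂ) :
    liouvilleForm θ p v =
      lineCoord L (Γ.tgt p.base) (Γ.tgt p.base) p.covec * formCoord θ p.base p.base v.1 := by
  have hp : Γ.tgt p.base ∈ (trivializationAt ℂ L (Γ.tgt p.base)).baseSet :=
    FiberBundle.mem_baseSet_trivializationAt' _
  rw [formCoord_self]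
  change p.covec (θ p.base (mfderiv (𝓘(ℂ, EG).prod 𝓘(ℂ, ℂ)) 𝓘(ℂ, EG) Slit.base p v)) = _
  rw [(hasMFDerivAt_slit_base p).mfderiv]
  conv_lhs => rw [← ofLineCoord_lineCoord hp p.covec]
  rfl

/-- This puts `Θ` into the shape `y₂ b(y₁)(dy₁)` required by `fderiv_homogeneous_form`: the covector
at `y` has coordinate `y.2`, and the projection to `G` is the first projection. -/
theorem liouvilleForm_chart (θ : ∀ g, TangentSpace 𝓘(ℂ, EG) g →L[ℂ] L (Γ.tgt g))
    (p : ArrowTilde Γ L) {y : EG × ℂ}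
    (hy : y ∈ (extChartAt (𝓘(ℂ, EG).prod 𝓘(ℂ, ℂ)) p).target) (v : EG × ℂ) :
    liouvilleForm θ ((extChartAt (𝓘(ℂ, EG).prod 𝓘(ℂ, ℂ)) p).symm y)
        (mfderiv 𝓘(ℂ, EG × ℂ) (𝓘(ℂ, EG).prod 𝓘(ℂ, ℂ))
          (extChartAt (𝓘(ℂ, EG).prod 𝓘(ℂ, ℂ)) p).symm y v) =
      y.2 * formCoord θ p.base ((extChartAt 𝓘(ℂ, EG) p.base).symm y.1) v.1 := by
  obtain ⟨h1, h2⟩ := mem_extChartAt_slit_target p hy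
  rw [formCoord_apply θ p.base h1]
  have hT := extChartAt_target_mem_nhds' hy
  have hφ : MDifferentiableAt 𝓘(ℂ, EG × ℂ) (𝓘(ℂ, EG).prod 𝓘(ℂ, ℂ))
      (extChartAt (𝓘(ℂ, EG).prod 𝓘(ℂ, ℂ)) p).symm y :=
    (mdifferentiableOn_extChartAt_symm y hy).mdifferentiableAt hT
  have hχ : MDifferentiableAt 𝓘(ℂ, EG) 𝓘(ℂ, EG) (extChartAt 𝓘(ℂ, EG) p.base).symm y.1 :=
    (mdifferentiableOn_extChartAt_symm y.1 h1).mdifferentiableAt (extChartAt_target_mem_nhds' h1)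
  have hb := (Slit.contMDiff_complex_base.mdifferentiable (by simp)
    ((extChartAt (𝓘(ℂ, EG).prod 𝓘(ℂ, ℂ)) p).symm y)).hasMFDerivAt.comp y hφ.hasMFDerivAt
  have hb' := hχ.hasMFDerivAt.comp y
    (hasFDerivAt_fst (𝕜 := ℂ) (E := EG) (F := ℂ) (p := y)).hasMFDerivAt
  have hb2 := hb'.congr_of_eventuallyEq
    (f₁ := Slit.base ∘ (extChartAt (𝓘(ℂ, EG).prod 𝓘(ℂ, ℂ)) p).symm) (by
      filter_upwards [hT] with q hq
      rw [Function.comp_apply, extChartAt_slit_symm_apply,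
        slitTriv_symm _ (mem_extChartAt_slit_target p hq).2]
      rfl)
  have e := DFunLike.congr_fun (hasMFDerivAt_unique hb hb2) v
  have e2 : (extChartAt (𝓘(ℂ, EG).prod 𝓘(ℂ, ℂ)) p).symm y =
      ⟨(extChartAt 𝓘(ℂ, EG) p.base).symm y.1, _, ofLineCoord_ne_zero h2.1 h2.2⟩ := by
    rw [extChartAt_slit_symm_apply, slitTriv_symm _ h2]
  -- Stating the congruence for vectors of the model space allows the base point to be replaced
  -- without a cast.
  have e3 : ∀ (q r : ArrowTilde Γ L) (u u' : EG), q = r → u = u' →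
      q.covec (θ q.base u) = r.covec (θ r.base u') := by
    rintro q _ u _ rfl rfl
    rfl
  exact e3 _ _ _ _ e2 e

/-- `ι_Z Ω = Θ`. -/
theorem symplectization_eulerField {θ : ∀ g, TangentSpace 𝓘(ℂ, EG) g →L[ℂ] L (Γ.tgt g)}
    (hθ : IsHolomorphicForm θ) (p : ArrowTilde Γ L) (v : EG × ℂ) :
    symplectization θ p (eulerField p) v = liouvilleForm θ p v := by
  set w := lineCoord L (Γ.tgt p.base) (Γ.tgt p.base) p.covec with hw
  set y₀ : EG × ℂ := extChartAt (𝓘(ℂ, EG).prod 𝓘(ℂ, ℂ)) p p with hy₀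
  have hy2 : y₀.2 = w := rfl
  have hy1 : y₀.1 = extChartAt 𝓘(ℂ, EG) p.base p.base := rfl
  let b : EG → EG →L[ℂ] ℂ := fun x => formCoord θ p.base ((extChartAt 𝓘(ℂ, EG) p.base).symm x)
  have hb : DifferentiableAt ℂ b y₀.1 := by
    have h := (contMDiffAt_iff.1 (hθ p.base)).2
    rw [ModelWithCorners.range_eq_univ, contDiffWithinAt_univ] at h
    exact h.differentiableAt (by simp)
  let a : EG × ℂ → EG × ℂ →L[ℂ] ℂ := fun y =>
    (liouvilleForm θ ((extChartAt (𝓘(ℂ, EG).prod 𝓘(ℂ, ℂ)) p).symm y)).comp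
      (mfderiv 𝓘(ℂ, EG × ℂ) (𝓘(ℂ, EG).prod 𝓘(ℂ, ℂ))
          (extChartAt (𝓘(ℂ, EG).prod 𝓘(ℂ, ℂ)) p).symm y)
  have ha : ∀ᶠ y in 𝓝 y₀, ∀ u, a y u = y.2 * b y.1 u.1 := by
    filter_upwards [extChartAt_target_mem_nhds (I := 𝓘(ℂ, EG).prod 𝓘(ℂ, ℂ)) p] with y hy
    exact fun u => liouvilleForm_chart θ p hy u
  -- The chart at `p` has identity differential at `p`, so `Ω` there is the antisymmetrized
  -- derivative of the coordinate expression `a`.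
  have hd : mfderiv (𝓘(ℂ, EG).prod 𝓘(ℂ, ℂ)) 𝓘(ℂ, EG × ℂ)
      (extChartAt (𝓘(ℂ, EG).prod 𝓘(ℂ, ℂ)) p) p = ContinuousLinearMap.id ℂ _ :=
    mfderiv_extChartAt_self
  have key : ∀ u u' : EG × ℂ, symplectization θ p u u' =
      fderiv ℂ a y₀ u u' - fderiv ℂ a y₀ u' u := by
    intro u u'
    have h1 : ∀ t : EG × ℂ, (mfderiv (𝓘(ℂ, EG).prod 𝓘(ℂ, ℂ)) 𝓘(ℂ, EG × ℂ)
      (extChartAt (𝓘(ℂ, EG).prod 𝓘(ℂ, ℂ)) p) p t : EG × ℂ) = t := fun t => by rw [hd]; rfl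
    have h2 : symplectization θ p u u' = fderiv ℂ a y₀
        (mfderiv (𝓘(ℂ, EG).prod 𝓘(ℂ, ℂ)) 𝓘(ℂ, EG × ℂ)
          (extChartAt (𝓘(ℂ, EG).prod 𝓘(ℂ, ℂ)) p) p u : EG × ℂ)
        (mfderiv (𝓘(ℂ, EG).prod 𝓘(ℂ, ℂ)) 𝓘(ℂ, EG × ℂ)
          (extChartAt (𝓘(ℂ, EG).prod 𝓘(ℂ, ℂ)) p) p u' : EG × ℂ) - fderiv ℂ a y₀
        (mfderiv (𝓘(ℂ, EG).prod 𝓘(ℂ, ℂ)) 𝓘(ℂ, EG × ℂ)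
          (extChartAt (𝓘(ℂ, EG).prod 𝓘(ℂ, ℂ)) p) p u' : EG × ℂ)
        (mfderiv (𝓘(ℂ, EG).prod 𝓘(ℂ, ℂ)) 𝓘(ℂ, EG × ℂ)
          (extChartAt (𝓘(ℂ, EG).prod 𝓘(ℂ, ℂ)) p) p u : EG × ℂ) := rfl
    rw [h2, h1, h1]
  have hbase : b y₀.1 = formCoord θ p.base p.base := by
    simp only [b, hy1, extChartAt_to_inv]
  have hZ : (eulerField p : EG × ℂ) = (0, w) := eulerField_eq p
  refine (key (eulerField p) v).trans (Eq.trans ?_ (liouvilleForm_apply θ p v).symm)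
  rw [hZ, ← hbase]
  exact fderiv_homogeneous_form hb ha v

end Symplectization

/-! ### `Ĥ` described by real lines of covectors annihilating values of `θ` -/

section ContactHat

variable {EX : Type*} [NormedAddCommGroup EX] [NormedSpace ℂ EX]
  {X : Type*} [TopologicalSpace X] [ChartedSpace EX X]
  {EG : Type*} [NormedAddCommGroup EG] [NormedSpace ℂ EG]
  {G : Type*} [TopologicalSpace G] [ChartedSpace EG G] [IsManifold 𝓘(ℂ, EG) ω G]
  {Γ : LieGroupoid 𝓘(ℂ, EG) 𝓘(ℂ, EX) ω G X}
  {L : X → Type*} [∀ x, AddCommGroup (L x)] [∀ x, Module ℂ (L x)] [∀ x, TopologicalSpace (L x)]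
  [TopologicalSpace (TotalSpace ℂ L)] [FiberBundle ℂ L] [VectorBundle ℂ ℂ L]
  [ContMDiffVectorBundle ω ℂ L 𝓘(ℂ, EX)]

theorem exists_rep_mk_eq_smul {x : X} {ε : L x →L[ℂ] ℂ} (hε : ε ≠ 0) :
    ∃ r : ℝ, r ≠ 0 ∧ (Projectivization.mk ℝ ε hε).rep = r • ε := by
  obtain ⟨a, ha⟩ := Projectivization.exists_smul_eq_mk_rep ℝ ε hε
  exact ⟨a, a.ne_zero, ha.symm⟩

/-- Vanishing of the real part survives real rescaling of the covector, so it is a property of the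
real line. -/
theorem re_rep_mk_eq_zero_iff {x : X} {ε : L x →L[ℂ] ℂ} (hε : ε ≠ 0) (v : L x) :
    ((Projectivization.mk ℝ ε hε).rep v).re = 0 ↔ (ε v).re = 0 := by
  obtain ⟨r, hr, h⟩ := exists_rep_mk_eq_smul hε
  rw [h, smul_apply, Complex.smul_re, smul_eq_mul, mul_eq_zero]
  exact or_iff_right hr

/-- The kernel of the real `1`-form `Re ⟨ε, θ⟩` at a point `(g, [ε])` of `Ĝ`. -/
def reKernelHat (θ : ∀ g, TangentSpace 𝓘(ℂ, EG) g →L[ℂ] L (Γ.tgt g)) (z : ArrowHat Γ L) :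
    Submodule ℝ (TangentSpace (𝓘(ℝ, EG).prod 𝓘(ℝ, ℝ)) z) where
  carrier := {v | (z.line.rep (θ z.base (z.dbase v))).re = 0}
  add_mem' {v w} hv hw := by
    have h := z.dbase.map_add v w
    have h' := (z.line.rep.comp (θ z.base)).map_add (z.dbase v) (z.dbase w)
    simp only [Set.mem_ofPred_eq] at hv hw ⊢
    refine (congrArg (fun u => (z.line.rep (θ z.base u)).re) h).trans
      ((congrArg Complex.re h').trans ?_)
    rw [Complex.add_re]
    exact (congrArg₂ (· + ·) hv hw).trans (add_zero 0)
  zero_mem' := by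
    have h := (z.line.rep.comp (θ z.base)).map_zero
    exact (congrArg (fun u => (z.line.rep (θ z.base u)).re) z.dbase.map_zero).trans
      (congrArg Complex.re h)
  smul_mem' r v hv := by
    have h := z.dbase.map_smul r v
    have h' := (z.line.rep.comp (θ z.base)).map_smul (r : ℂ) (z.dbase v)
    simp only [Set.mem_ofPred_eq] at hv ⊢
    refine (congrArg (fun u => (z.line.rep (θ z.base u)).re) h).trans
      ((congrArg Complex.re h').trans ?_)
    rw [smul_eq_mul, Complex.re_ofReal_mul]
    exact (congrArg (r * ·) hv).trans (mul_zero r)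

theorem mem_reKernelHat {θ : ∀ g, TangentSpace 𝓘(ℂ, EG) g →L[ℂ] L (Γ.tgt g)} {z : ArrowHat Γ L}
    {v : EG × ℝ} :
    v ∈ reKernelHat θ z ↔ (z.line.rep (θ z.base (z.dbase v))).re = 0 := Iff.rfl

theorem dbase_mfderiv_toRProj (p : ArrowTilde Γ L) (v : EG × ℂ) :
    p.toRProj.dbase
        (mfderiv (𝓘(ℝ, EG).prod 𝓘(ℝ, ℂ)) (𝓘(ℝ, EG).prod 𝓘(ℝ, ℝ)) Slit.toRProj p v) =
      (mfderiv (𝓘(ℂ, EG).prod 𝓘(ℂ, ℂ)) 𝓘(ℂ, EG) (Slit.base : ArrowTilde Γ L → G) p v : EG) := by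
  have h1 := (RProj.hasMFDerivAt_base p.toRProj).comp p
    (Slit.contMDiff_toRProj.mdifferentiable (by simp) p).hasMFDerivAt
  have h2 := hasMFDerivAt_real_prod (hasMFDerivAt_slit_base p)
  rw [(hasMFDerivAt_slit_base p).mfderiv]
  exact DFunLike.congr_fun (hasMFDerivAt_unique h1 h2) v

/-- A local section through `p` provides a right inverse of the differential. -/
theorem mfderiv_toRProj_surjective (p : ArrowTilde Γ L) (u : EG × ℝ) : ∃ v : EG × ℂ,
    (mfderiv (𝓘(ℝ, EG).prod 𝓘(ℝ, ℂ)) (𝓘(ℝ, EG).prod 𝓘(ℝ, ℝ)) Slit.toRProj p v : EG × ℝ) = u := by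
  obtain ⟨σ, h1, h2, h3⟩ := exists_section_toRProj p
  have hσ := (h1.mdifferentiableAt (by simp)).hasMFDerivAt
  have hp := (Slit.contMDiff_toRProj.mdifferentiable (by simp) p).hasMFDerivAt
  have h4 := (hasMFDerivAt_of_eq hp h2.symm).comp p.toRProj hσ
  have h5 := h4.congr_of_eventuallyEq (f₁ := id) (by
    filter_upwards [h3] with z hz using hz.symm)
  exact ⟨_, DFunLike.congr_fun (hasMFDerivAt_unique h5 (hasMFDerivAt_id _)) u⟩

/-- By `ι_Z Ω = Θ` the left side says `Re ⟨ε, θ(dp(v))⟩ = 0`, and `dp` factors through `TĜ`. Thus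
`reKernel` is the full preimage of `reKernelHat`. -/
theorem mem_reKernel_iff {θ : ∀ g, TangentSpace 𝓘(ℂ, EG) g →L[ℂ] L (Γ.tgt g)}
    (hθ : IsHolomorphicForm θ) (p : ArrowTilde Γ L) (v : EG × ℂ) :
    v ∈ reKernel θ p ↔ (mfderiv (𝓘(ℝ, EG).prod 𝓘(ℝ, ℂ)) (𝓘(ℝ, EG).prod 𝓘(ℝ, ℝ))
      Slit.toRProj p v : EG × ℝ) ∈ reKernelHat θ p.toRProj := by
  have h1 : v ∈ reKernel θ p ↔ (liouvilleForm θ p v).re = 0 := by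
    rw [← symplectization_eulerField hθ p v]
    exact Iff.rfl
  refine h1.trans ((re_rep_mk_eq_zero_iff p.ne_zero _).symm.trans ?_)
  exact Iff.of_eq (congrArg (fun u : EG => (p.toRProj.line.rep (θ p.base u)).re = 0)
    (dbase_mfderiv_toRProj p v).symm)

/-- A full preimage under a surjective differential has the given subspace as its image. Every
member of the supremum is therefore `reKernelHat`, and there is at least one point of `G̃` over `z`.
-/
theorem contactHat_eq {θ : ∀ g, TangentSpace 𝓘(ℂ, EG) g →L[ℂ] L (Γ.tgt g)}
    (hθ : IsHolomorphicForm θ) (z : ArrowHat Γ L) : contactHat θ z = reKernelHat θ z := by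
  have key : ∀ p : ArrowTilde Γ L, (reKernel θ p).map
      (mfderiv (𝓘(ℝ, EG).prod 𝓘(ℝ, ℂ)) (𝓘(ℝ, EG).prod 𝓘(ℝ, ℝ))
        Slit.toRProj p).toLinearMap = reKernelHat θ p.toRProj := by
    intro p
    apply le_antisymm
    · rintro _ ⟨v, hv, rfl⟩
      exact (mem_reKernel_iff hθ p v).1 hv
    · intro u hu
      obtain ⟨v, hv⟩ := mfderiv_toRProj_surjective p u
      refine ⟨v, (mem_reKernel_iff hθ p v).2 ?_, hv⟩
      rw [hv]
      exact hu
  apply le_antisymm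
  · refine iSup₂_le fun p h => ?_
    subst h
    exact (key p).le
  · obtain ⟨p, rfl⟩ := Slit.toRProj_surjective z
    exact (key p).ge.trans (le_iSup₂_of_le p rfl le_rfl)

/-- The vector `u` of `L` is annihilated by the real parts of the covectors of the line `b` over
its base point. -/
def Annihilates (b : RProj L (idMap (EX := EX) X)) (u : TotalSpace ℂ L) : Prop :=
  ∀ v : L b.base, (⟨_, v⟩ : TotalSpace ℂ L) = u → ((b.line.rep : L b.base →L[ℂ] ℂ) v).re = 0

theorem annihilates_mk {b : RProj L (idMap (EX := EX) X)} {v : L b.base} :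
    Annihilates b ⟨_, v⟩ ↔ ((b.line.rep : L b.base →L[ℂ] ℂ) v).re = 0 := by
  refine ⟨fun h => h v rfl, ?_⟩
  intro h w hw
  have : w = v := by
    rw [TotalSpace.mk.injEq] at hw
    exact eq_of_heq hw.2
  rwa [this]

/-- Membership now depends only on the target of the arrow and on a point of the total space of `L`,
both of which can be rewritten along equalities of base points. -/
theorem mem_contactHat {θ : ∀ g, TangentSpace 𝓘(ℂ, EG) g →L[ℂ] L (Γ.tgt g)}
    (hθ : IsHolomorphicForm θ) {z : ArrowHat Γ L} {v : EG × ℝ} :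
    v ∈ contactHat θ z ↔ Annihilates (tgtHat z) ⟨_, θ z.base (z.dbase v)⟩ := by
  rw [contactHat_eq hθ, mem_reKernelHat]
  exact (annihilates_mk (b := tgtHat z)).symm

/-- The source of `(g, [ε])` is `[ε ∘ g]`, and `(ε ∘ g)(v) = ε(g.v)`. -/
theorem annihilates_act_iff (A : LineAction Γ L) (z : ArrowHat Γ L) (v : L (Γ.src z.base)) :
    Annihilates (srcHat A z) ⟨_, v⟩ ↔ Annihilates (tgtHat z) ⟨_, A.act z.base v⟩ := by
  obtain ⟨p, rfl⟩ := Slit.toRProj_surjective z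
  exact (annihilates_mk (b := srcHat A p.toRProj)).trans
    ((re_rep_mk_eq_zero_iff (srcTilde A p).ne_zero v).trans
      ((re_rep_mk_eq_zero_iff p.ne_zero (A.act p.base v)).symm.trans
        (annihilates_mk (b := tgtHat p.toRProj)).symm))

theorem annihilates_add {b : RProj L (idMap (EX := EX) X)} {v w : L b.base}
    (hv : Annihilates b ⟨_, v⟩) : Annihilates b ⟨_, v + w⟩ ↔ Annihilates b ⟨_, w⟩ := by
  rw [annihilates_mk] at hv
  have h := map_add (b.line.rep : L b.base →L[ℂ] ℂ) v w
  have h' : ((b.line.rep : L b.base →L[ℂ] ℂ) (v + w)).re = (b.line.rep w).re :=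
    (congrArg Complex.re h).trans ((Complex.add_re _ _).trans
      ((congrArg (· + ((b.line.rep : L b.base →L[ℂ] ℂ) w).re) hv).trans (zero_add _)))
  exact annihilates_mk.trans (⟨fun k => h'.symm.trans k, fun k => h'.trans k⟩ : _ ↔ _) |>.trans
    annihilates_mk.symm

theorem annihilates_zero {b : RProj L (idMap (EX := EX) X)} {y : X} (hy : b.base = y) :
    Annihilates b ⟨y, (0 : L y)⟩ := by
  subst hy
  exact annihilates_mk.2 (congrArg Complex.re (map_zero (b.line.rep : L b.base →L[ℂ] ℂ)))

/-- A vector annihilated by the real parts of all the covectors vanishes. -/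
theorem eq_zero_of_annihilates {x y : X} (hxy : y = x) {v : L y}
    (h : ∀ b : RProj L (idMap (EX := EX) X), b.base = x → Annihilates b ⟨y, v⟩) : v = 0 := by
  subst hxy
  have hy : y ∈ (trivializationAt ℂ L y).baseSet := FiberBundle.mem_baseSet_trivializationAt' _
  have hz : ∀ c : ℂ, c ≠ 0 →
      (c * (trivializationAt ℂ L y).continuousLinearMapAt ℂ y v).re = 0 := fun c hc =>
    (re_rep_mk_eq_zero_iff (ofLineCoord_ne_zero hy hc) v).1
      (annihilates_mk.1 (h ⟨y, Projectivization.mk ℝ _ (ofLineCoord_ne_zero hy hc)⟩ rfl))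
  -- The covectors with coordinates `1` and `i` detect the real and the imaginary part of the
  -- coordinate of `v`.
  have h1 := hz 1 one_ne_zero
  have h2 := hz Complex.I Complex.I_ne_zero
  have h0 : (trivializationAt ℂ L y).continuousLinearMapAt ℂ y v = 0 := by
    apply Complex.ext
    · simpa using h1
    · simpa using h2
  rw [← (trivializationAt ℂ L y).symmL_continuousLinearMapAt (R := ℂ) hy v, h0, map_zero]

/-- The witness is `(g, [ε ∘ g⁻¹])`. It lets vectors of `L` over `s(g)` be tested against sources of
arrows over `g`. -/
theorem exists_srcHat_eq (A : LineAction Γ L) (g : G) (b : BaseHat Γ L) (hb : b.base = Γ.src g) :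
    ∃ z : ArrowHat Γ L, z.base = g ∧ srcHat A z = b := by
  obtain ⟨x, ε, hε, rfl⟩ := exists_mk b
  change x = Γ.src g at hb
  subst hb
  have e : A.dual g (ε.comp ((A.act g).symm : L (Γ.tgt g) →L[ℂ] L (Γ.src g))) = ε := by
    ext v
    exact congrArg ε ((A.act g).symm_apply_apply v)
  have h0 : ε.comp ((A.act g).symm : L (Γ.tgt g) →L[ℂ] L (Γ.src g)) ≠ 0 := by
    intro h
    rw [h, map_zero] at e
    exact hε e.symm
  refine ⟨⟨g, Projectivization.mk ℝ _ h0⟩, rfl, ?_⟩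
  change (⟨Γ.src g, Projectivization.mk ℝ (A.dual g _) _⟩ : BaseHat Γ L) = _
  congr 1
  congr 1

end ContactHat

theorem tangentBundle_mk_eq {𝕜 : Type*} [NontriviallyNormedField 𝕜]
    {E : Type*} [NormedAddCommGroup E] [NormedSpace 𝕜 E] {H : Type*} [TopologicalSpace H]
    {I : ModelWithCorners 𝕜 E H} {M : Type*} [TopologicalSpace M] [ChartedSpace H M]
    {x y : M} (hxy : x = y) {u v : E} (huv : u = v) :
    (⟨x, u⟩ : TangentBundle I M) = ⟨y, v⟩ := by
  subst hxy huv
  rfl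

theorem exists_mk_eq {X : Type*} (L : X → Type*) {x y : X} (h : x = y) (v : L y) :
    ∃ w : L x, (⟨x, w⟩ : TotalSpace ℂ L) = ⟨y, v⟩ := by
  subst h
  exact ⟨v, rfl⟩

/-! ### The two implications -/

section Multiplicativity

variable {EX : Type*} [NormedAddCommGroup EX] [NormedSpace ℂ EX]
  {X : Type*} [TopologicalSpace X] [ChartedSpace EX X] [IsManifold 𝓘(ℂ, EX) ω X]
  {EG : Type*} [NormedAddCommGroup EG] [NormedSpace ℂ EG]
  {G : Type*} [TopologicalSpace G] [ChartedSpace EG G] [IsManifold 𝓘(ℂ, EG) ω G]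
  {Γ : LieGroupoid 𝓘(ℂ, EG) 𝓘(ℂ, EX) ω G X}
  {L : X → Type*} [∀ x, AddCommGroup (L x)] [∀ x, Module ℂ (L x)] [∀ x, TopologicalSpace (L x)]
  [TopologicalSpace (TotalSpace ℂ L)] [FiberBundle ℂ L] [VectorBundle ℂ ℂ L]
  [ContMDiffVectorBundle ω ℂ L 𝓘(ℂ, EX)]
  {θ : ∀ g, TangentSpace 𝓘(ℂ, EG) g →L[ℂ] L (Γ.tgt g)}

theorem mk_form_congr {g g' : G} (hg : g = g') {v v' : EG} (hv : v = v') :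
    (⟨_, θ g v⟩ : TotalSpace ℂ L) = ⟨_, θ g' v'⟩ := by
  subst hg hv
  rfl

theorem dbase_congr {b b' : BaseHat Γ L} (hb : b = b') {u u' : EX × ℝ} (hu : u = u') :
    b.dbase u = b'.dbase u' := by
  subst hb hu
  rfl

theorem mem_contactHat_of_eq_zero (hθ : IsHolomorphicForm θ) {z : ArrowHat Γ L} {V : EG × ℝ}
    (h : θ z.base (z.dbase V) = 0) : V ∈ contactHat θ z := by
  rw [mem_contactHat hθ, h]
  exact annihilates_zero rfl

/-- This and the next two lemmas read the axioms for `Ĥ` in `TG`: the result of each structure map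
is projected by `dbase`, and its `θ`-value is tested against the target of the resulting arrow. -/
theorem unit_mem_contactHat_iff (hθ : IsHolomorphicForm θ) (A : LineAction Γ L) (p : BaseHat Γ L)
    (u : EX × ℝ) :
    (mfderiv (𝓘(ℝ, EX).prod 𝓘(ℝ, ℝ)) (𝓘(ℝ, EG).prod 𝓘(ℝ, ℝ)) (groupoidHat A).unit p u : EG × ℝ) ∈
        contactHat θ ((groupoidHat A).unit p) ↔
      Annihilates p ⟨_, θ (Γ.unit p.base) (mfderiv 𝓘(ℂ, EX) 𝓘(ℂ, EG) Γ.unit p.base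
        (p.dbase u : EX))⟩ := by
  have h : tgtHat ((groupoidHat A).unit p) = p := (groupoidHat A).tgt_unit p
  exact (mem_contactHat hθ).trans (Iff.of_eq (congrArg₂ Annihilates h
    (mk_form_congr rfl (dbase_mfderiv_unitHat A p u))))

theorem inv_mem_contactHat_iff (hθ : IsHolomorphicForm θ) (A : LineAction Γ L) (z : ArrowHat Γ L)
    (V : EG × ℝ) :
    (mfderiv (𝓘(ℝ, EG).prod 𝓘(ℝ, ℝ)) (𝓘(ℝ, EG).prod 𝓘(ℝ, ℝ)) (groupoidHat A).inv z V : EG × ℝ) ∈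
        contactHat θ ((groupoidHat A).inv z) ↔
      Annihilates (srcHat A z) ⟨_, θ (Γ.inv z.base) (mfderiv 𝓘(ℂ, EG) 𝓘(ℂ, EG) Γ.inv z.base
        (z.dbase V : EG))⟩ := by
  have h : tgtHat ((groupoidHat A).inv z) = srcHat A z := (groupoidHat A).tgt_inv z
  exact (mem_contactHat hθ).trans (Iff.of_eq (congrArg₂ Annihilates h
    (mk_form_congr rfl (dbase_mfderiv_invHat A z V))))

theorem mul_mem_contactHat_iff [FiniteDimensional ℂ EX] [FiniteDimensional ℂ EG]
    (hθ : IsHolomorphicForm θ) (A : LineAction Γ L)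
    {z w : ArrowHat Γ L} (hzw : srcHat A z = tgtHat w) {V W : EG × ℝ}
    (hVW : (mfderiv (𝓘(ℝ, EG).prod 𝓘(ℝ, ℝ)) (𝓘(ℝ, EX).prod 𝓘(ℝ, ℝ)) (srcHat A) z V : EX × ℝ) =
      (mfderiv (𝓘(ℝ, EG).prod 𝓘(ℝ, ℝ)) (𝓘(ℝ, EX).prod 𝓘(ℝ, ℝ)) tgtHat w W : EX × ℝ)) :
    ((groupoidHat A).tangentMul (𝓘(ℝ, EG).prod 𝓘(ℝ, ℝ)) ⟨z, V⟩ ⟨w, W⟩).snd ∈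
        contactHat θ ((groupoidHat A).mul z w) ↔
      Annihilates (tgtHat z) ⟨_, θ (Γ.mul z.base w.base)
        (Γ.tangentMul 𝓘(ℂ, EG) ⟨z.base, z.dbase V⟩ ⟨w.base, w.dbase W⟩).snd⟩ := by
  have hg : Γ.src z.base = Γ.tgt w.base := congrArg RProj.base hzw
  have h : tgtHat ((groupoidHat A).mul z w) = tgtHat z := tgtHat_mulHat hg
  rw [← h, ← mk_form_congr (mulHat_base hg) (dbase_tangentMul A hzw hVW)]
  exact mem_contactHat hθ

/-- If `θ` is a map of groupoids with multiplicative kernel, then `Ĥ` is multiplicative. -/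
theorem isMultiplicative_contactHat [FiniteDimensional ℂ EX] [FiniteDimensional ℂ EG]
    (hθ : IsHolomorphicForm θ) {A : LineAction Γ L}
    (hA : IsGroupoidMap A θ) {H : ∀ g, Submodule ℂ (TangentSpace 𝓘(ℂ, EG) g)}
    (hH : ∀ g (v : EG), v ∈ H g ↔ θ g v = 0)
    (hM : IsMultiplicative Γ.toGroupoidStr 𝓘(ℂ, EG) 𝓘(ℂ, EX) H) :
    IsMultiplicative (groupoidHat A) (𝓘(ℝ, EG).prod 𝓘(ℝ, ℝ)) (𝓘(ℝ, EX).prod 𝓘(ℝ, ℝ))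
      (contactHat θ) where
  covers z u := by
    obtain ⟨v, hv, hvu⟩ := hM.covers z.base ((srcHat A z).dbase u)
    obtain ⟨V, hV, hVu⟩ := exists_lift_srcHat A z v u hvu
    refine ⟨V, mem_contactHat_of_eq_zero hθ ?_, hVu⟩
    rw [hV]
    exact (hH _ _).1 hv
  unit_mem p u := by
    refine (unit_mem_contactHat_iff hθ A p u).2 ?_
    rw [(hH _ _).1 (hM.unit_mem p.base (p.dbase u))]
    exact annihilates_zero (Γ.tgt_unit p.base).symm
  inv_mem z V hV := by
    refine (inv_mem_contactHat_iff hθ A z V).2 ?_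
    have hV' := (mem_contactHat hθ (z := z) (v := V)).1 hV
    set v : EG := z.dbase V with hv
    set v' : EG := mfderiv 𝓘(ℂ, EG) 𝓘(ℂ, EG) Γ.inv z.base v with hv'
    obtain ⟨ℓ, hℓ⟩ := exists_mk_eq L (Γ.tgt_inv z.base).symm (θ (Γ.inv z.base) v')
    -- The product `v · v⁻¹` is a unit vector, hence in `H`, so `0 = θ(v) + g.θ(v⁻¹)`. As `Re
    -- ε(θ(v)) = 0`, the covector `ε ∘ g` annihilates `θ(v⁻¹)` in real part.
    have h1 := hA ⟨z.base, v⟩ ⟨Γ.inv z.base, v'⟩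
      (tangentBundle_mk_eq (Γ.tgt_inv z.base).symm (Γ.mfderiv_tgt_inv z.base v).symm) ℓ hℓ
    have h2 := (mk_form_congr (θ := θ) (Γ.mul_inv z.base)
      (Γ.tangentMul_inv z.base v)).symm.trans h1
    rw [(hH _ _).1 (hM.unit_mem (Γ.tgt z.base) _)] at h2
    have h3 : Annihilates (tgtHat z) ⟨_, θ z.base v + A.act z.base ℓ⟩ := by
      rw [← h2]
      exact annihilates_zero (Γ.tgt_unit _).symm
    rw [← hℓ, annihilates_act_iff]
    exact (annihilates_add (b := tgtHat z) hV').1 h3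
  mul_mem := by
    rintro ⟨z, V⟩ ⟨w, W⟩ h hV hW
    have hzw : srcHat A z = tgtHat w := congrArg TotalSpace.proj h
    have hVW : (mfderiv (𝓘(ℝ, EG).prod 𝓘(ℝ, ℝ)) (𝓘(ℝ, EX).prod 𝓘(ℝ, ℝ)) (srcHat A) z V :
        EX × ℝ) = (mfderiv (𝓘(ℝ, EG).prod 𝓘(ℝ, ℝ)) (𝓘(ℝ, EX).prod 𝓘(ℝ, ℝ)) tgtHat w W :
        EX × ℝ) :=
      congrArg (fun u : TangentBundle (𝓘(ℝ, EX).prod 𝓘(ℝ, ℝ)) (BaseHat Γ L) =>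
        (u.snd : EX × ℝ)) h
    have hV' := (mem_contactHat hθ (z := z) (v := V)).1 hV
    have hW' := (mem_contactHat hθ (z := w) (v := W)).1 hW
    refine (mul_mem_contactHat_iff hθ A hzw hVW).2 ?_
    have hg : Γ.src z.base = Γ.tgt w.base := congrArg RProj.base hzw
    obtain ⟨ℓ, hℓ⟩ := exists_mk_eq L hg (θ w.base (w.dbase W))
    have hd : (mfderiv 𝓘(ℂ, EG) 𝓘(ℂ, EX) Γ.src z.base (z.dbase V : EG) : EX) =
        (mfderiv 𝓘(ℂ, EG) 𝓘(ℂ, EX) Γ.tgt w.base (w.dbase W : EG) : EX) :=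
      (dbase_mfderiv_srcHat A z V).symm.trans
        ((dbase_congr hzw hVW).trans (dbase_mfderiv_tgtHat w W))
    have h1 := hA ⟨z.base, z.dbase V⟩ ⟨w.base, w.dbase W⟩ (tangentBundle_mk_eq hg hd) ℓ hℓ
    refine (congrArg (Annihilates (tgtHat z)) h1).mpr ?_
    -- The term `θ(V)` is removed by `hV'`. The term `g.θ(W)` is moved to the source of `z`, which
    -- is the target of `w`, where `hW'` applies.
    refine (annihilates_add (b := tgtHat z) hV').2 ?_
    refine (annihilates_act_iff A z ℓ).1 ?_
    rw [hℓ, hzw]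
    exact hW'

/-- If `Ĥ` covers `TM̂`, then `ker θ` covers `TX`. -/
theorem ker_covers_of_contactHat_covers (hθ : IsHolomorphicForm θ)
    (hs : ∀ g, Function.Surjective (θ g)) (A : LineAction Γ L)
    (hc : ∀ z : ArrowHat Γ L, ∀ u : EX × ℝ, ∃ V : EG × ℝ, V ∈ contactHat θ z ∧
      (mfderiv (𝓘(ℝ, EG).prod 𝓘(ℝ, ℝ)) (𝓘(ℝ, EX).prod 𝓘(ℝ, ℝ)) (srcHat A) z V : EX × ℝ) = u)
    (g : G) (u : EX) :
    ∃ v : EG, θ g v = 0 ∧ (mfderiv 𝓘(ℂ, EG) 𝓘(ℂ, EX) Γ.src g v : EX) = u := by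
  have hg : Γ.tgt g ∈ (trivializationAt ℂ L (Γ.tgt g)).baseSet :=
    FiberBundle.mem_baseSet_trivializationAt' _
  -- A nonzero covector is injective on the line, so `θ` at `g` may be replaced by the scalar form
  -- `φ`.
  let ε : L (Γ.tgt g) →L[ℂ] ℂ := ofLineCoord L (Γ.tgt g) (Γ.tgt g) 1
  have hε : ε ≠ 0 := ofLineCoord_ne_zero hg one_ne_zero
  have hεi : ∀ v, ε v = 0 → v = 0 := by
    intro v hv
    have h1 : (trivializationAt ℂ L (Γ.tgt g)).continuousLinearMapAt ℂ (Γ.tgt g) v = 0 := by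
      simpa [ε, ofLineCoord] using hv
    rw [← (trivializationAt ℂ L (Γ.tgt g)).symmL_continuousLinearMapAt (R := ℂ) hg v, h1, map_zero]
  let φ : EG →L[ℂ] ℂ := ε.comp (θ g)
  let σ : EG →L[ℂ] EX := mfderiv 𝓘(ℂ, EG) 𝓘(ℂ, EX) Γ.src g
  suffices h : ∃ v : EG, φ v = 0 ∧ σ v = u by
    obtain ⟨v, hv, hu⟩ := h
    exact ⟨v, hεi _ hv, hu⟩
  -- If `φ` is nonzero on `ker ds`, any lift of `u` can be corrected into `ker φ` without changing
  -- its source.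
  by_cases hk : ∃ k, σ k = 0 ∧ φ k ≠ 0
  · obtain ⟨k, hk, hk'⟩ := hk
    obtain ⟨v, hv⟩ : ∃ v : EG, σ v = u := Γ.submersion_src g u
    refine ⟨v - (φ v / φ k) • k, ?_, ?_⟩
    · rw [map_sub, map_smul, smul_eq_mul, div_mul_cancel₀ _ hk', sub_self]
    · rw [map_sub, map_smul, hk, smul_zero, sub_zero, hv]
  -- If `φ` vanishes on `ker ds`, its value depends only on the source. Take `V` with `φ V = 1`: a
  -- vector of `Ĥ` at `(g, [ε])` with the same source in `TX` would have `φ`-value `1`, whose real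
  -- part is not zero.
  · exfalso
    push Not at hk
    obtain ⟨V, hV⟩ : ∃ V : EG, θ g V = _ := hs g ((trivializationAt ℂ L (Γ.tgt g)).symmL ℂ (Γ.tgt g) 1)
    have hφV : φ V = 1 := by
      have h1 := lineCoord_ofLineCoord hg (1 : ℂ)
      rw [lineCoord, ← hV] at h1
      exact h1
    let z : ArrowHat Γ L := ⟨g, Projectivization.mk ℝ ε hε⟩
    obtain ⟨w, hw⟩ := (srcHat A z).exists_mfderiv_base (σ V)
    obtain ⟨W, hW, hWw⟩ := hc z w
    have h1 : σ (z.dbase W) = σ V := by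
      rw [← hw, ← hWw]
      exact (dbase_mfderiv_srcHat A z W).symm
    have h2 : φ (z.dbase W) = φ V := by
      have := hk (z.dbase W - V) (by rw [map_sub, h1, sub_self])
      rwa [map_sub, sub_eq_zero] at this
    rw [contactHat_eq hθ] at hW
    have h3 : (φ (z.dbase W)).re = 0 := (re_rep_mk_eq_zero_iff hε _).1 hW
    rw [h2, hφV] at h3
    exact one_ne_zero h3

/-- If `Ĥ` is multiplicative, then so is `ker θ`. -/
theorem isMultiplicative_of_contactHat [FiniteDimensional ℂ EX] [FiniteDimensional ℂ EG]
    (hθ : IsHolomorphicForm θ)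
    (hs : ∀ g, Function.Surjective (θ g)) {A : LineAction Γ L}
    {H : ∀ g, Submodule ℂ (TangentSpace 𝓘(ℂ, EG) g)}
    (hH : ∀ g (v : EG), v ∈ H g ↔ θ g v = 0)
    (hM : IsMultiplicative (groupoidHat A) (𝓘(ℝ, EG).prod 𝓘(ℝ, ℝ)) (𝓘(ℝ, EX).prod 𝓘(ℝ, ℝ))
      (contactHat θ)) :
    IsMultiplicative Γ.toGroupoidStr 𝓘(ℂ, EG) 𝓘(ℂ, EX) H where
  covers g u := by
    obtain ⟨v, hv, hu⟩ := ker_covers_of_contactHat_covers hθ hs A hM.covers g u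
    exact ⟨v, (hH g v).2 hv, hu⟩
  unit_mem x u := by
    -- It suffices to test against every real line `b` over `x`; the vector `u` is lifted to `TM̂`
    -- at `b`, where `Ĥ` contains its unit vector.
    refine (hH _ _).2 (eq_zero_of_annihilates (EX := EX) (Γ.tgt_unit x) fun b hb => ?_)
    subst hb
    obtain ⟨w, hw⟩ := b.exists_mfderiv_base u
    rw [← hw]
    exact (unit_mem_contactHat_iff hθ A b w).1 (hM.unit_mem b w)
  inv_mem g v hv := by
    refine (hH _ _).2 (eq_zero_of_annihilates (EX := EX) (Γ.tgt_inv g) fun b hb => ?_)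
    obtain ⟨z, rfl, rfl⟩ := exists_srcHat_eq A g b hb
    obtain ⟨V, rfl⟩ := z.exists_mfderiv_base v
    exact (inv_mem_contactHat_iff hθ A z V).1
      (hM.inv_mem z V (mem_contactHat_of_eq_zero hθ ((hH _ _).1 hv)))
  mul_mem := by
    rintro ⟨g, v⟩ ⟨h, w⟩ hvw hv hw
    have hg : Γ.src g = Γ.tgt h := congrArg TotalSpace.proj hvw
    have hd : (mfderiv 𝓘(ℂ, EG) 𝓘(ℂ, EX) Γ.src g v : EX) =
        (mfderiv 𝓘(ℂ, EG) 𝓘(ℂ, EX) Γ.tgt h w : EX) :=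
      congrArg (fun u : TangentBundle 𝓘(ℂ, EX) X => (u.snd : EX)) hvw
    refine (hH _ _).2 (eq_zero_of_annihilates (EX := EX) (Γ.tgt_mul g h hg) fun b hb => ?_)
    -- For a line `b = [ε]`, the arrows `(g, [ε])` and `(h, [ε ∘ g])` are composable.
    let z : ArrowHat Γ L := arrowOf g b hb.symm
    have hz : tgtHat z = b := tgtHat_arrowOf g b hb.symm
    let z' : ArrowHat Γ L := arrowOf h (srcHat A z) hg.symm
    have hz' : tgtHat z' = srcHat A z := tgtHat_arrowOf h (srcHat A z) hg.symm
    obtain ⟨V, hV⟩ : ∃ V : EG × ℝ, z.dbase V = v := z.exists_mfderiv_base v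
    -- Any lift `V` of `v` will do; `W` is then chosen over `w` with target equal to the source of
    -- `V`. Both lie in `Ĥ` because `θ` kills their projections.
    obtain ⟨W, hW, hVW⟩ := exists_lift_tgtHat z' w
      (mfderiv (𝓘(ℝ, EG).prod 𝓘(ℝ, ℝ)) (𝓘(ℝ, EX).prod 𝓘(ℝ, ℝ)) (srcHat A) z V)
      (hd.symm.trans ((congrArg (fun u : EG => (mfderiv 𝓘(ℂ, EG) 𝓘(ℂ, EX) Γ.src g u : EX))
        hV.symm).trans ((dbase_mfderiv_srcHat A z V).symm.trans (dbase_congr hz'.symm rfl))))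
    have h1 := hM.mul_mem ⟨z, V⟩ ⟨z', W⟩ (tangentBundle_mk_eq hz'.symm hVW.symm)
      (mem_contactHat_of_eq_zero hθ ((congrArg (θ g) hV).trans ((hH _ _).1 hv)))
      (mem_contactHat_of_eq_zero hθ ((congrArg (θ h) hW).trans ((hH _ _).1 hw)))
    have h2 := (mul_mem_contactHat_iff hθ A hz'.symm hVW.symm).1 h1
    rw [hz] at h2
    exact (congrArg₂ (fun u u' : EG => Annihilates b ⟨_, θ (Γ.mul g h)
      (Γ.tangentMul 𝓘(ℂ, EG) ⟨g, u⟩ ⟨h, u'⟩).snd⟩) hV hW).mp h2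

end Multiplicativity

end

end HolContact

theorem mainTheorem10
    {EX : Type*} [NormedAddCommGroup EX] [NormedSpace ℂ EX] [FiniteDimensional ℂ EX]
    {X : Type*} [TopologicalSpace X] [ChartedSpace EX X] [IsManifold 𝓘(ℂ, EX) ω X]
    {EG : Type*} [NormedAddCommGroup EG] [NormedSpace ℂ EG] [FiniteDimensional ℂ EG]
    {G : Type*} [TopologicalSpace G] [ChartedSpace EG G] [IsManifold 𝓘(ℂ, EG) ω G]
    -- a complex Lie groupoid `G ⇉ X`
    (Γ : HolContact.LieGroupoid 𝓘(ℂ, EG) 𝓘(ℂ, EX) ω G X)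
    -- a holomorphic line bundle `L → X` with an action of `G`, i.e. an LB-groupoid `t^*L`
    (L : X → Type*) [∀ x, AddCommGroup (L x)] [∀ x, Module ℂ (L x)]
    [∀ x, TopologicalSpace (L x)] [TopologicalSpace (Bundle.TotalSpace ℂ L)]
    [FiberBundle ℂ L] [VectorBundle ℂ ℂ L] [ContMDiffVectorBundle ω ℂ L 𝓘(ℂ, EX)]
    (A : HolContact.LineAction Γ L)
    -- a holomorphic contact structure `H` on `G` with `TG / H ≅ t^*L` through `θ`
    (H : ∀ g, Submodule ℂ (TangentSpace 𝓘(ℂ, EG) g))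
    (hH : HolContact.IsMaximallyNonintegrable 𝓘(ℂ, EG) ω H)
    (θ : ∀ g, TangentSpace 𝓘(ℂ, EG) g →L[ℂ] L (Γ.tgt g))
    (hθ : HolContact.IsHolomorphicForm θ)
    (hsurj : ∀ g, Function.Surjective (θ g))
    (hker : ∀ g, LinearMap.ker (θ g).toLinearMap = H g)
    -- if `H` is multiplicative, then `t^*L` is `TG / H` as an LB-groupoid
    (hLB : HolContact.IsMultiplicative Γ.toGroupoidStr 𝓘(ℂ, EG) 𝓘(ℂ, EX) H →
      HolContact.IsGroupoidMap A θ) :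
    HolContact.IsMultiplicative (HolContact.groupoidHat A)
        (𝓘(ℝ, EG).prod 𝓘(ℝ, ℝ)) (𝓘(ℝ, EX).prod 𝓘(ℝ, ℝ)) (HolContact.contactHat θ) ↔
      HolContact.IsMultiplicative Γ.toGroupoidStr 𝓘(ℂ, EG) 𝓘(ℂ, EX) H :=
  have hH' : ∀ g (v : EG), v ∈ H g ↔ θ g v = 0 := fun g v => by
    rw [← hker g]
    exact Iff.rfl
  ⟨HolContact.isMultiplicative_of_contactHat hθ hsurj hH',
    fun h => HolContact.isMultiplicative_contactHat hθ (hLB h) hH' h⟩
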